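/- Let $(M,\mathcal D,g)$ be a (sub-)Riemannian manifold: $M$ is a smooth connected manifold of dimension $n$, $\mathcal D\subseteq TM$ is a smooth distribution of constant rank $1\le k\le n$ satisfying Hörmander's condition, and $g$ is a smooth scalar product on $\mathcal D$. Let $H(\xi)=\frac12\sum_{i\le k}\langle\xi,X_i\rangle^2$ be the Hamiltonian on $T^*M$ ($X_1,\dots,X_k$ any local orthonormal frame of $\mathcal D$), and let $\exp_q(t,\xi)$ be the projection to $M$ of the Hamiltonian flow of $H$ at time $t$ started at $\xi\in T_q^*M$. Let $\mathcal V$ be a complement, that is, a smooth subbundle with $TM=\mathcal D\oplus\mathcal V$, and let $\mathbf h_q$ and $\mathbf v_q$ be the annihilators in $T_q^*M$ of $\mathcal V_q$ and $\mathcal D_q$. Let $\{\mu_q\}_{q\in M}$ be any family of probability measures adapted to the splitting: $\mu_q$ is a measure on $\{\xi\in T_q^*M: 2H(\xi)=1\}=\mathbb S_q^{k-1}\times\mathbf v_q$, with $\mathbb S_q^{k-1}=\{\xi\in\mathbf h_q:2H(\xi)=1\}$, which is the product of the uniform probability measure on the Euclidean sphere $\mathbb S_q^{k-1}$ and of a probability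 measure on $\mathbf v_q$ for which all linear functions are square integrable; and $q\mapsto\int f^2\,d\mu_q$ is continuous for every continuous fibrewise linear $f:T^*M\to\mathbb R$. The microscopic Laplacian is $$(L^{\mathcal V}\phi)(q)=\lim_{t\to0^+}\frac{2k}{t^2}\int\big(\phi(\exp_q(t,\xi))-\phi(q)\big)\,d\mu_q(\xi),\qquad \phi\in C^\infty(M).$$ Let $\omega$ be a smooth volume form on $M$, let $\operatorname{grad} f\in\Gamma(\mathcal D)$ be the horizontal gradient ($g(\operatorname{grad}f,Y)=df(Y)$ for all $Y\in\Gamma(\mathcal D)$), let $\operatorname{div}_\omega$ be the divergence ($\mathcal L_X\omega=\operatorname{div}_\omega(X)\,\omega$), and let $\Delta_\omega=\operatorname{div}_\omega\circ\operatorname{grad}$ be the macroscopic Laplacian. Then the limit that defines $L^{\mathcal V}\phi$ exists at every point for every $\phi\in C^\infty(M)$, and: 1. $L^{\mathcal V}$ and $\Delta_\omega$ are second order differential operators with smooth coefficients, with the same principal symbol, namely $2H$, and with no constant (zeroth order) term. 2. On the domain of any local frame $X_1,\dots,X_n$ of $TM$ such that $X_1,\dots,X_k$ is an orthonormal frame of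 $\mathcal D$ and $X_{k+1},\dots,X_n$ is a frame of $\mathcal V$, $$\chi^{(\mathcal V,\omega)}:=\Delta_\omega-L^{\mathcal V}=\sum_{i=1}^k\sum_{j=k+1}^n c_{ji}^j X_i+\operatorname{grad}(\theta),\qquad \theta=\log|\omega(X_1,\dots,X_n)|,$$ where the structural functions are defined by $[X_i,X_j]=\sum_{\ell=1}^n c_{ij}^\ell X_\ell$ and vector fields are seen as derivations. 3. The following are equivalent: (a) $L^{\mathcal V}$ is symmetric on $C_0^\infty(M)$ for the product $(f_1,f_2)_\omega=\int_M f_1f_2\,\omega$; (b) $L^{\mathcal V}=\Delta_\omega$ (on $C_0^\infty(M)$ or, equivalently, on $C^\infty(M)$); (c) the vector field $\sum_{i\le k}\sum_{j>k}c_{ji}^jX_i+\operatorname{grad}(\theta)$ vanishes on the domain of every local frame as in 2. -/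

import Mathlib

open Set Filter Topology MeasureTheory Manifold VectorField Bundle
open scoped ContDiff

noncomputable section

namespace SubRiem

/-- The model space `ℝⁿ`. -/
abbrev Model (n : ℕ) : Type := EuclideanSpace ℝ (Fin n)

/-- The cotangent space `T_q^* M` of an `n`-dimensional manifold. In Mathlib the tangent space at
`q` is a copy of the model space (through the derivative of the preferred chart at `q`), so that
covectors at `q` are linear forms on that space. -/
abbrev Cotangent (n : ℕ) {M : Type*} (_q : M) : Type := Model n →L[ℝ] ℝ

section Manifold

variable {n : ℕ} {M : Type*} [TopologicalSpace M] [ChartedSpace (EuclideanSpace ℝ (Fin n)) M]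
    [IsManifold (𝓡 n) ∞ M]

/-- The vector field `X` is smooth on `U`. -/
def SmoothFieldOn (X : ∀ q : M, TangentSpace (𝓡 n) q) (U : Set M) : Prop :=
  ContMDiffOn (𝓡 n) (𝓡 n).tangent ∞ (fun q => (⟨q, X q⟩ : TangentBundle (𝓡 n) M)) U

/-- The real function `f` is smooth on `U`. -/
def SmoothFunOn (n : ℕ) {M : Type*} [TopologicalSpace M]
    [ChartedSpace (EuclideanSpace ℝ (Fin n)) M]
    [IsManifold (𝓡 n) ∞ M] (f : M → ℝ) (U : Set M) : Prop :=
  ContMDiffOn (𝓡 n) 𝓘(ℝ, ℝ) ∞ f U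

/-- `C^∞(M)`. -/
def SmoothFun (n : ℕ) {M : Type*} [TopologicalSpace M]
    [ChartedSpace (EuclideanSpace ℝ (Fin n)) M]
    [IsManifold (𝓡 n) ∞ M] (f : M → ℝ) : Prop :=
  ContMDiff (𝓡 n) 𝓘(ℝ, ℝ) ∞ f

/-- The differential `d_q f`, as a covector. -/
def differential (n : ℕ) {M : Type*} [TopologicalSpace M]
    [ChartedSpace (EuclideanSpace ℝ (Fin n)) M]
    [IsManifold (𝓡 n) ∞ M] (f : M → ℝ) (q : M) : Cotangent n q :=
  mfderiv (𝓡 n) 𝓘(ℝ, ℝ) f q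

/-- The vector field which has the constant components `w` in the chart at `x`
(on the domain of that chart). -/
def chartField (x : M) (w : Model n) (q : M) : TangentSpace (𝓡 n) q :=
  mpullback (𝓡 n) 𝓘(ℝ, Model n) (extChartAt (𝓡 n) x) (fun _ => w) q

/-- The coordinate vector field `∂_i` of the chart at `x`. -/
def coordField (x : M) (i : Fin n) (q : M) : TangentSpace (𝓡 n) q :=
  chartField x (EuclideanSpace.single i 1) q

/-- A smooth subbundle of rank `r` of the tangent bundle: it is locally spanned by `r` pointwise
linearly independent smooth vector fields. -/
def IsSmoothSubbundle (r : ℕ) (D : ∀ q : M, Submodule ℝ (TangentSpace (𝓡 n) q)) : Prop :=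
  ∀ q₀ : M, ∃ U : Set M, IsOpen U ∧ q₀ ∈ U ∧ ∃ X : Fin r → ∀ q : M, TangentSpace (𝓡 n) q,
    (∀ i, SmoothFieldOn (X i) U) ∧
    ∀ q ∈ U, LinearIndependent ℝ (fun i => X i q) ∧
      Submodule.span ℝ (Set.range fun i => X i q) = D q

/-- The vector fields obtained from smooth sections of `D` by iterated Lie brackets
`[...[[X₁, X₂], X₃], ..., X_m]`. -/
inductive IsIteratedBracket (D : ∀ q : M, Submodule ℝ (TangentSpace (𝓡 n) q)) :
    (∀ q : M, TangentSpace (𝓡 n) q) → Prop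
  | of (X : ∀ q : M, TangentSpace (𝓡 n) q) (hX : SmoothFieldOn X univ) (hD : ∀ q, X q ∈ D q) :
      IsIteratedBracket D X
  | bracket (X Y : ∀ q : M, TangentSpace (𝓡 n) q) (hX : IsIteratedBracket D X)
      (hY : SmoothFieldOn Y univ) (hD : ∀ q, Y q ∈ D q) :
      IsIteratedBracket D (mlieBracket (𝓡 n) X Y)

end Manifold

/-- A (sub-)Riemannian structure of rank `k` on an `n`-dimensional manifold `M`: a smooth
distribution of rank `k` which satisfies Hörmander's condition, with a smooth scalar product. -/
structure Structure (n k : ℕ) (M : Type*) [TopologicalSpace M]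
    [ChartedSpace (EuclideanSpace ℝ (Fin n)) M]
    [IsManifold (𝓡 n) ∞ M] where
  /-- the distribution -/
  D : ∀ q : M, Submodule ℝ (TangentSpace (𝓡 n) q)
  smooth_D : IsSmoothSubbundle k D
  hormander : ∀ q : M, Submodule.span ℝ {v | ∃ X, IsIteratedBracket D X ∧ X q = v} = ⊤
  /-- the metric -/
  g : ∀ q : M, LinearMap.BilinForm ℝ (D q)
  symm_g : ∀ q v w, g q v w = g q w v
  pos_g : ∀ q v, v ≠ 0 → 0 < g q v v
  smooth_g : ∀ U : Set M, IsOpen U → ∀ X Y : ∀ q : M, D q,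
    SmoothFieldOn (fun q => (X q : TangentSpace (𝓡 n) q)) U →
    SmoothFieldOn (fun q => (Y q : TangentSpace (𝓡 n) q)) U →
    SmoothFunOn n (fun q => g q (X q) (Y q)) U

/-- A smooth volume form: a nowhere vanishing smooth `n`-form (it orients the manifold, and is
positive for that orientation). -/
structure VolumeForm (n : ℕ) (M : Type*) [TopologicalSpace M]
    [ChartedSpace (EuclideanSpace ℝ (Fin n)) M]
    [IsManifold (𝓡 n) ∞ M] where
  /-- the form -/
  form : ∀ q : M, (TangentSpace (𝓡 n) q) [⋀^Fin n]→ₗ[ℝ] ℝ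
  smooth : ∀ U : Set M, IsOpen U → ∀ X : Fin n → ∀ q : M, TangentSpace (𝓡 n) q,
    (∀ i, SmoothFieldOn (X i) U) → SmoothFunOn n (fun q => form q (fun i => X i q)) U
  ne_zero : ∀ q, form q ≠ 0

section Volume

variable {n : ℕ} {M : Type*} [TopologicalSpace M] [ChartedSpace (EuclideanSpace ℝ (Fin n)) M]
    [IsManifold (𝓡 n) ∞ M]

/-- The Lie derivative `𝓛_X vol` at `q`, by the formula
`(𝓛_X vol)(Y₁, …, Y_n) = X(vol(Y₁, …, Y_n)) - ∑ i, vol(Y₁, …, [X, Y_i], …, Y_n)`,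
where `Y_i` extends the vector `v_i ∈ T_q M` with constant components in the chart at `q`. -/
def VolumeForm.lieDeriv (vol : VolumeForm n M) (X : ∀ q : M, TangentSpace (𝓡 n) q) (q : M)
    (v : Fin n → Model n) : ℝ :=
  differential n (fun p => vol.form p (fun i => chartField q (v i) p)) q (X q)
    - ∑ i, vol.form q (Function.update (fun j => chartField q (v j) q) i
        (mlieBracket (𝓡 n) X (chartField q (v i)) q))

/-- The divergence: the factor in `𝓛_X vol = div_vol(X) vol`, read off on the coordinate basis at `q`. -/
def VolumeForm.div (vol : VolumeForm n M) (X : ∀ q : M, TangentSpace (𝓡 n) q) (q : M) : ℝ :=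
  vol.lieDeriv X q (fun i => EuclideanSpace.single i 1) / vol.form q (fun i => coordField q i q)

variable [MeasurableSpace M]

/-- The measure `|vol(∂₁, …, ∂_n)| dx₁ ⋯ dx_n` on the domain of the chart at `x`, extended by zero. -/
def VolumeForm.chartMeasure (vol : VolumeForm n M) (x : M) : Measure M :=
  Measure.map (extChartAt (𝓡 n) x).symm
    (((volume : Measure (Model n)).restrict (extChartAt (𝓡 n) x).target).withDensity
      (fun y => ENNReal.ofReal
        |vol.form ((extChartAt (𝓡 n) x).symm y)
          (fun i => coordField x i ((extChartAt (𝓡 n) x).symm y))|))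

/-- The Borel measure on `M` defined by `vol`. The measures `chartMeasure` agree on the overlaps of
the charts, and the measure of `vol` is the smallest measure that dominates all of them. -/
def VolumeForm.measure (vol : VolumeForm n M) : Measure M := ⨆ x : M, vol.chartMeasure x

/-- Symmetry of an operator on `C^∞_0(M)` for the `L²` product of `vol`. -/
def IsSymmetricL2 (vol : VolumeForm n M) (P : (M → ℝ) → M → ℝ) : Prop :=
  ∀ f₁ f₂ : M → ℝ, SmoothFun n f₁ → HasCompactSupport f₁ → SmoothFun n f₂ → HasCompactSupport f₂ →
    ∫ q, P f₁ q * f₂ q ∂vol.measure = ∫ q, f₁ q * P f₂ q ∂vol.measure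

end Volume

section Operators

variable {n : ℕ} {M : Type*} [TopologicalSpace M] [ChartedSpace (EuclideanSpace ℝ (Fin n)) M]
    [IsManifold (𝓡 n) ∞ M]

/-- The operator `P` on `C^∞(M)` is a second order linear differential operator with smooth
coefficients, principal symbol `σ : T^*M → ℝ`, and constant (zeroth order) term `ζ`: in every chart
`P f = ∑ a_ij ∂_i ∂_j f + ∑ b_i ∂_i f + ζ f` with `a` symmetric, and
`σ(ξ) = ∑ a_ij ξ(∂_i) ξ(∂_j)`. -/
structure IsSecondOrderOperator (P : (M → ℝ) → M → ℝ) (σ : ∀ q : M, Cotangent n q → ℝ)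
    (ζ : M → ℝ) : Prop where
  smooth_const : SmoothFun n ζ
  local_form : ∀ x : M, ∃ (a : Fin n → Fin n → Model n → ℝ) (b : Fin n → Model n → ℝ),
    (∀ i j, ContDiffOn ℝ ∞ (a i j) (extChartAt (𝓡 n) x).target) ∧
    (∀ i, ContDiffOn ℝ ∞ (b i) (extChartAt (𝓡 n) x).target) ∧
    (∀ i j, ∀ y ∈ (extChartAt (𝓡 n) x).target, a i j y = a j i y) ∧
    (∀ f : M → ℝ, SmoothFun n f → ∀ y ∈ (extChartAt (𝓡 n) x).target,
      P f ((extChartAt (𝓡 n) x).symm y) =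
        (∑ i, ∑ j, a i j y *
          fderiv ℝ (fun z => fderiv ℝ (f ∘ (extChartAt (𝓡 n) x).symm) z
            (EuclideanSpace.single j 1)) y (EuclideanSpace.single i 1))
        + (∑ i, b i y *
          fderiv ℝ (f ∘ (extChartAt (𝓡 n) x).symm) y (EuclideanSpace.single i 1))
        + ζ ((extChartAt (𝓡 n) x).symm y) * f ((extChartAt (𝓡 n) x).symm y)) ∧
    (∀ q ∈ (extChartAt (𝓡 n) x).source, ∀ ξ : Cotangent n q,
      σ q ξ = ∑ i, ∑ j, a i j (extChartAt (𝓡 n) x q) *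
        ξ (coordField x i q) * ξ (coordField x j q))

end Operators

namespace Structure

variable {n k : ℕ} {M : Type*} [TopologicalSpace M] [ChartedSpace (EuclideanSpace ℝ (Fin n)) M]
    [IsManifold (𝓡 n) ∞ M]

instance finiteDimensional_tangent (q : M) : FiniteDimensional ℝ (TangentSpace (𝓡 n) q) :=
  inferInstanceAs (FiniteDimensional ℝ (Model n))

theorem nondegenerate_g (S : Structure n k M) (q : M) : (S.g q).Nondegenerate := by
  refine ⟨fun v hv => ?_, fun v hv => ?_⟩ <;>
  · by_contra h
    exact (S.pos_g q v h).ne' (hv v)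

theorem finrank_D (S : Structure n k M) (q : M) : Module.finrank ℝ (S.D q) = k := by
  obtain ⟨U, -, hq, X, -, h⟩ := S.smooth_D q
  obtain ⟨h1, h2⟩ := h q hq
  rw [← h2, finrank_span_eq_card h1, Fintype.card_fin]

theorem exists_orthonormal (S : Structure n k M) (q : M) :
    ∃ u : Fin k → S.D q, ∀ i j, S.g q (u i) (u j) = if i = j then 1 else 0 := by
  obtain ⟨v, hv⟩ := LinearMap.BilinForm.exists_orthogonal_basis (B := S.g q)
    ⟨fun x y => by simpa using S.symm_g q x y⟩
  let e : Fin k ≃ Fin (Module.finrank ℝ (S.D q)) := finCongr (S.finrank_D q).symm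
  refine ⟨fun i => (Real.sqrt (S.g q (v (e i)) (v (e i))))⁻¹ • v (e i), fun i j => ?_⟩
  have hpos := S.pos_g q (v (e i)) (v.ne_zero _)
  by_cases hij : i = j
  · subst hij
    simp only [map_smul, LinearMap.smul_apply, smul_eq_mul, if_true]
    have hs := Real.mul_self_sqrt hpos.le
    have hs' := (Real.sqrt_pos.2 hpos).ne'
    field_simp
    nlinarith
  · have h0 : S.g q (v (e i)) (v (e j)) = 0 := hv (fun h => hij (e.injective h))
    simp [h0, hij]

/-- The horizontal vector `ξ^♯ ∈ D_q` dual to the restriction of the covector `ξ` to `D_q`: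
`g(ξ^♯, v) = ξ(v)` for all `v ∈ D_q`. -/
def sharp (S : Structure n k M) (q : M) (ξ : Cotangent n q) : S.D q :=
  ((S.g q).toDual (S.nondegenerate_g q)).symm
    ((ξ : Model n →ₗ[ℝ] ℝ).comp (S.D q).subtype)

/-- The horizontal gradient: `g(grad f, v) = df(v)` for all horizontal vectors `v`. -/
def grad (S : Structure n k M) (f : M → ℝ) (q : M) : TangentSpace (𝓡 n) q :=
  (S.sharp q (differential n f q) : TangentSpace (𝓡 n) q)

/-- The macroscopic Laplacian `Δ_vol = div_vol ∘ grad`. -/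
def macroLaplacian (S : Structure n k M) (vol : VolumeForm n M) (f : M → ℝ) (q : M) : ℝ :=
  vol.div (S.grad f) q

/-- The Hamiltonian `H(ξ) = ½ g(ξ^♯, ξ^♯)`, which is `½ ∑ i ≤ k, ξ(X_i)²` for every orthonormal
basis `X_i` of `D_q`. -/
def hamiltonian (S : Structure n k M) (q : M) (ξ : Cotangent n q) : ℝ :=
  (1 / 2) * S.g q (S.sharp q ξ) (S.sharp q ξ)

/-- The Hamiltonian in the canonical coordinates `(y, p)` of `T^*M` given by the chart at `x`. -/
def chartHamiltonian (S : Structure n k M) (x : M) (z : Model n × (Model n →L[ℝ] ℝ)) : ℝ :=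
  S.hamiltonian ((extChartAt (𝓡 n) x).symm z.1)
    (z.2.comp (mfderiv (𝓡 n) 𝓘(ℝ, Model n) (extChartAt (𝓡 n) x) ((extChartAt (𝓡 n) x).symm z.1) :
      Model n →L[ℝ] Model n))

/-- The canonical coordinates `(y, p)` of the covector `ξ ∈ T_q^* M` given by the chart at `x`:
`y` is the coordinate vector of `q` and `p = ∑ ξ(∂_i) dx_i`. -/
def chartCovector (x : M) (ξ : Σ q : M, Cotangent n q) : Model n × (Model n →L[ℝ] ℝ) :=
  (extChartAt (𝓡 n) x ξ.1,
    ξ.2.comp ((mfderiv (𝓡 n) 𝓘(ℝ, Model n) (extChartAt (𝓡 n) x) ξ.1).inverse :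
      Model n →L[ℝ] Model n))

/-- The curve `Λ` in `T^*M` is an integral curve of the Hamiltonian vector field of `H` on `[0, T]`:
in canonical coordinates it solves Hamilton's equations `y' = ∂H/∂p`, `p' = -∂H/∂y`. -/
def IsHamiltonianCurve (S : Structure n k M) (T : ℝ) (Λ : ℝ → Σ q : M, Cotangent n q) : Prop :=
  ContinuousOn (fun s => (Λ s).1) (Icc 0 T) ∧
  ∀ t ∈ Icc 0 T,
    (∀ η : Model n →L[ℝ] ℝ,
      HasDerivWithinAt (fun s => η (chartCovector (Λ t).1 (Λ s)).1)
        (fderiv ℝ (S.chartHamiltonian (Λ t).1) (chartCovector (Λ t).1 (Λ t)) (0, η))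
        (Icc 0 T) t) ∧
    (∀ w : Model n,
      HasDerivWithinAt (fun s => (chartCovector (Λ t).1 (Λ s)).2 w)
        (-fderiv ℝ (S.chartHamiltonian (Λ t).1) (chartCovector (Λ t).1 (Λ t)) (w, 0))
        (Icc 0 T) t)

open Classical in
/-- The exponential map: `exp_q(t, ξ)` is the endpoint at time `t` of the normal geodesic with
initial covector `ξ ∈ T_q^* M` (and `q` if this geodesic is not defined up to time `t`). -/
def exp (S : Structure n k M) (q : M) (t : ℝ) (ξ : Cotangent n q) : M :=
  if h : ∃ Λ : ℝ → Σ q : M, Cotangent n q, S.IsHamiltonianCurve t Λ ∧ Λ 0 = ⟨q, ξ⟩ then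
    (h.choose t).1
  else q

/-- A complement of the distribution: a smooth subbundle `V` with `T_q M = D_q ⊕ V_q`. -/
structure Complement (S : Structure n k M) where
  /-- the subbundle -/
  V : ∀ q : M, Submodule ℝ (TangentSpace (𝓡 n) q)
  smooth_V : IsSmoothSubbundle (n - k) V
  isCompl : ∀ q, IsCompl (S.D q) (V q)

variable {S : Structure n k M}

/-- The isomorphism of `D_q` with the space `h_q` of horizontal covectors, the annihilator of `V_q`:
it takes `u` to the covector that vanishes on `V_q` and equals `g(u, ·)` on `D_q`. It is isometric
for the scalar product on `h_q` given by the restriction of `2H`. -/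
def Complement.flat (V : S.Complement) (q : M) (u : S.D q) : Cotangent n q :=
  LinearMap.toContinuousLinearMap
    (((S.g q u).comp (Submodule.projectionOnto (S.D q) (V.V q) (V.isCompl q)) :
      TangentSpace (𝓡 n) q →ₗ[ℝ] ℝ) : Model n →ₗ[ℝ] ℝ)

/-- The uniform probability measure of the unit sphere of `ℝ^k`. -/
def uniformSphere (k : ℕ) : Measure (Metric.sphere (0 : EuclideanSpace ℝ (Fin k)) 1) :=
  ((volume : Measure (EuclideanSpace ℝ (Fin k))).toSphere univ)⁻¹ •
    (volume : Measure (EuclideanSpace ℝ (Fin k))).toSphere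

/-- The uniform probability measure on the unit sphere `{2H = 1}` of `h_q`, as a measure on
`T_q^* M`: the image of the uniform measure of the sphere of `ℝ^k` under the isometry of `ℝ^k` with
`h_q` given by an orthonormal basis (its choice is irrelevant). -/
def Complement.sphereMeasure (V : S.Complement) (q : M) : Measure (Cotangent n q) :=
  (uniformSphere k).map fun a : Metric.sphere (0 : EuclideanSpace ℝ (Fin k)) 1 =>
    V.flat q (∑ i, a.1 i • (S.exists_orthonormal q).choose i)

/-- A family of probability measures on the fibres `{ξ ∈ T_q^* M : 2H(ξ) = 1}`, adapted to the
splitting `D ⊕ V`: it is the product of the uniform measure of the sphere of `h_q` and a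
`2`-decreasing probability measure `ν` on the annihilator `v_q` of `D_q`, where the product is
transported to `T_q^* M` by `(η, ζ) ↦ η + ζ`; and `q ↦ ∫ f² dμ_q` is continuous for every continuous
fibrewise linear `f : T^*M → ℝ`, that is, for `f(ξ) = ξ(Y)` with a continuous vector field `Y`. -/
def Complement.IsAdapted (V : S.Complement) (μ : ∀ q : M, Measure (Cotangent n q)) : Prop :=
  (∀ q : M, ∃ ν : Measure (Cotangent n q), IsProbabilityMeasure ν ∧
    (∀ᵐ ξ ∂ν, ∀ v ∈ S.D q, ξ v = 0) ∧
    (∀ ℓ : Cotangent n q →L[ℝ] ℝ, MemLp ℓ 2 ν) ∧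
    μ q = ((V.sphereMeasure q).prod ν).map (fun p => p.1 + p.2)) ∧
  ∀ Y : ∀ q : M, TangentSpace (𝓡 n) q,
    Continuous (fun q => (⟨q, Y q⟩ : TangentBundle (𝓡 n) M)) →
    Continuous (fun q => ∫ ξ, (ξ (Y q)) ^ 2 ∂μ q)

/-- The rescaled mean increment of `φ` along the normal geodesics of length `t` from `q`. -/
def microQuotient (S : Structure n k M) (μ : ∀ q : M, Measure (Cotangent n q)) (φ : M → ℝ) (q : M)
    (t : ℝ) : ℝ :=
  2 * (k : ℝ) / t ^ 2 * ∫ ξ, (φ (S.exp q t ξ) - φ q) ∂μ q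

/-- The microscopic Laplacian: the limit of the rescaled mean increments as `t → 0⁺`. -/
def microLaplacian (S : Structure n k M) (μ : ∀ q : M, Measure (Cotangent n q)) (φ : M → ℝ)
    (q : M) : ℝ :=
  limUnder (𝓝[>] (0 : ℝ)) (S.microQuotient μ φ q)

/-- A smooth local frame `X₁, …, X_n` of `TM` on `U` (indexed from `0`) such that the first `k`
fields are an orthonormal frame of `D` and the others are a frame of `V`. -/
structure Complement.IsAdaptedFrame (V : S.Complement) (U : Set M)
    (X : Fin n → ∀ q : M, TangentSpace (𝓡 n) q) : Prop where
  frame : IsLocalFrameOn (𝓡 n) (Model n) ∞ X U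
  mem_V : ∀ i : Fin n, k ≤ (i : ℕ) → ∀ q ∈ U, X i q ∈ V.V q
  mem_D : ∀ i : Fin n, (i : ℕ) < k → ∀ q ∈ U, X i q ∈ S.D q
  orthonormal : ∀ i j : Fin n, ∀ (hi : (i : ℕ) < k) (hj : (j : ℕ) < k), ∀ q, ∀ hq : q ∈ U,
    S.g q ⟨X i q, mem_D i hi q hq⟩ ⟨X j q, mem_D j hj q hq⟩ = if i = j then 1 else 0

/-- The structural functions of a local frame: `[X_i, X_j] = ∑ l, c_ij^l X_l`. -/
def structureFun {U : Set M} {X : Fin n → ∀ q : M, TangentSpace (𝓡 n) q}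
    (hX : IsLocalFrameOn (𝓡 n) (Model n) ∞ X U) (i j l : Fin n) (q : M) : ℝ :=
  hX.coeff l q (mlieBracket (𝓡 n) (X i) (X j) q)

/-- The vector field `∑_{i ≤ k} ∑_{j > k} c_ji^j X_i + grad θ`, with `θ = log |vol(X₁, …, X_n)|`. -/
def Complement.chi (V : S.Complement) (vol : VolumeForm n M) {U : Set M}
    {X : Fin n → ∀ q : M, TangentSpace (𝓡 n) q} (hX : V.IsAdaptedFrame U X) (q : M) :
    TangentSpace (𝓡 n) q :=
  (∑ i ∈ Finset.univ.filter (fun i : Fin n => (i : ℕ) < k),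
      ∑ j ∈ Finset.univ.filter (fun j : Fin n => k ≤ (j : ℕ)),
        structureFun hX.frame j i j q • X i q)
    + S.grad (fun p => Real.log |vol.form p (fun i => X i p)|) q

end Structure

end SubRiem

end

open Set Filter Topology MeasureTheory Manifold VectorField Bundle
open scoped ContDiff

set_option linter.unusedSectionVars false

noncomputable section

/-! In a local orthonormal frame of the distribution the Hamiltonian is H = ½ ∑ ξ(X_i)². Along its
flow a function f on M has derivative ∑ ξ(X_i) X_i f, and a fibrewise linear function ξ(Y) has
derivative ∑ ξ(X_i) ξ([X_i, Y]) (`hasDerivWithinAt_pairing`). The second derivative of f along a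
normal geodesic is therefore ∑ ξ(X_i) ξ(X_j) X_j X_i f + ∑ ξ(X_j) ξ([X_j, X_i]) X_i f. Under an
adapted measure the horizontal part of ξ is uniform on a sphere and independent of the vertical
part. So ξ(X_i) has mean zero, and ξ(v) ξ(w) has mean g(v, pr w)/k for horizontal v, with pr the
projection along V (`Complement.IsAdapted.moments`). In Taylor's formula the first order term drops
out, and 2k/t² · t²/2 · 1/k = 1 leaves L^V = ∑ X_i² + ∑ c_{ji}^j X_i with i, j ≤ k.

The analytic difficulty is that vertical covectors are unbounded, so geodesics of all initial
momenta must be controlled on one time interval. Conservation of energy gives |ξ(X_i)| ≤ 1. Hence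
the base speed is bounded and Hamilton's equation for the momentum has a right side of linear
growth, which gives a uniform existence time (`exists_geodesics`). The second derivative of f then
grows at most linearly in the momentum. It is dominated by an integrable function, and dominated
convergence applies (`tendsto_microQuotient`).

The divergence computed in the adapted frame gives Δ_ω = ∑ X_i² + ∑_i (∑_{j ≤ n} c_{ji}^j + X_i θ)
X_i (`macroLaplacian_eq`). The difference of the two operators is the vector field χ. Both are
locally sums of squares plus first order terms, which yields smooth coefficients and the symbol 2H
(`IsLocallySumOfSquares.isSecondOrderOperator`).

For the equivalences, Δ_ω is symmetric by the divergence theorem. If L^V is symmetric too, then so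
is the derivation D = Δ_ω - L^V. Moving a factor f across the pairing in two ways gives ∫ φψ Df = -∫
φψ Df for all test functions φ, ψ, hence Df = 0 (`microLaplacian_eq_of_symmetric`). Finally, χ
vanishes if and only if it kills all test functions. -/

namespace SubRiem

/-! ### The Hamiltonian flow of ½ ∑ p(X_i)² on a normed space. -/

section HamiltonianODE

variable {E : Type*} [NormedAddCommGroup E] [NormedSpace ℝ E] {ι : Type*} [Fintype ι]

/-- The Hamiltonian vector field of `½ ∑ i, p(X_i(y))²` on `E × E^*`. -/
def hamField (X : ι → E → E) (z : E × (E →L[ℝ] ℝ)) : E × (E →L[ℝ] ℝ) :=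
  (∑ i, z.2 (X i z.1) • X i z.1, -∑ i, z.2 (X i z.1) • z.2.comp (fderiv ℝ (X i) z.1))

theorem hasFDerivAt_halfSumSq {X : ι → E → E} {z : E × (E →L[ℝ] ℝ)}
    (hX : ∀ i, DifferentiableAt ℝ (X i) z.1) :
    HasFDerivAt (fun z : E × (E →L[ℝ] ℝ) => (1 / 2 : ℝ) * ∑ i, z.2 (X i z.1) ^ 2)
      (∑ i, z.2 (X i z.1) • ((ContinuousLinearMap.apply ℝ ℝ (X i z.1)).comp
          (ContinuousLinearMap.snd ℝ E (E →L[ℝ] ℝ)) +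
        (z.2.comp (fderiv ℝ (X i) z.1)).comp (ContinuousLinearMap.fst ℝ E (E →L[ℝ] ℝ)))) z := by
  have h : ∀ i, HasFDerivAt (fun z : E × (E →L[ℝ] ℝ) => z.2 (X i z.1))
      ((ContinuousLinearMap.apply ℝ ℝ (X i z.1)).comp
          (ContinuousLinearMap.snd ℝ E (E →L[ℝ] ℝ)) +
        (z.2.comp (fderiv ℝ (X i) z.1)).comp (ContinuousLinearMap.fst ℝ E (E →L[ℝ] ℝ))) z := by
    intro i
    have h1 : HasFDerivAt (fun z : E × (E →L[ℝ] ℝ) => X i z.1)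
        ((fderiv ℝ (X i) z.1).comp (ContinuousLinearMap.fst ℝ E (E →L[ℝ] ℝ))) z :=
      (hX i).hasFDerivAt.comp z hasFDerivAt_fst
    have h2 := (hasFDerivAt_snd (𝕜 := ℝ) (p := z)).clm_apply h1
    refine h2.congr_fderiv ?_
    ext v <;> simp [add_comm]
  have h3 := (HasFDerivAt.fun_sum fun i (_ : i ∈ Finset.univ) => (h i).pow 2).const_mul (1 / 2 : ℝ)
  refine h3.congr_fderiv ?_
  rw [Finset.smul_sum]
  refine Finset.sum_congr rfl fun i _ => ?_
  rw [smul_smul]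
  congr 1
  simp

/-- The Poisson bracket of H with the linear function p(W). The momentum equation contributes the
terms -p(DX_i W), the base equation p(DW X_i), and together they form the bracket. The speed factor
`e` allows the field to be cut off in the momentum later. -/
theorem hasDerivWithinAt_pairing {X : ι → E → E} {y : ℝ → E} {p : ℝ → E →L[ℝ] ℝ} {W : E → E}
    {s : Set ℝ} {t e : ℝ}
    (hz : HasDerivWithinAt (fun s => (y s, p s)) (e • hamField X (y t, p t)) s t)
    (hW : DifferentiableAt ℝ W (y t)) :
    HasDerivWithinAt (fun s => p s (W (y s)))
      (e * ∑ i, p t (X i (y t)) * p t (lieBracket ℝ (X i) W (y t))) s t := by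
  have hy : HasDerivWithinAt y (e • ∑ i, p t (X i (y t)) • X i (y t)) s t := hz.fst
  have hp : HasDerivWithinAt p
      (e • -∑ i, p t (X i (y t)) • (p t).comp (fderiv ℝ (X i) (y t))) s t := hz.snd
  have h2 := hp.clm_apply (hW.hasFDerivAt.comp_hasDerivWithinAt t hy)
  refine h2.congr_deriv ?_
  simp only [lieBracket, map_sub, map_smul, map_sum, smul_eq_mul, Function.comp,
    smul_apply, neg_apply, sum_apply,
    ContinuousLinearMap.comp_apply, mul_sub, Finset.sum_sub_distrib]
  ring

theorem contDiff_hamField {X : ι → E → E} (hX : ∀ i, ContDiff ℝ ∞ (X i)) :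
    ContDiff ℝ ∞ (hamField X) := by
  have h1 : ∀ i, ContDiff ℝ ∞ (fun z : E × (E →L[ℝ] ℝ) => X i z.1) :=
    fun i => (hX i).comp contDiff_fst
  have h2 : ∀ i, ContDiff ℝ ∞ (fun z : E × (E →L[ℝ] ℝ) => z.2 (X i z.1)) :=
    fun i => contDiff_snd.clm_apply (h1 i)
  have h3 : ∀ i, ContDiff ℝ ∞ (fun z : E × (E →L[ℝ] ℝ) => fderiv ℝ (X i) z.1) :=
    fun i => ((hX i).fderiv_right (m := ∞) le_rfl).comp contDiff_fst
  refine ContDiff.prodMk ?_ ?_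
  · exact ContDiff.sum fun i _ => (h2 i).smul (h1 i)
  · exact (ContDiff.sum fun i _ => (h2 i).smul (contDiff_snd.clm_comp (h3 i))).neg

/-- The derivative of the energy is a sum of p(X_i) p(X_j) p([X_j, X_i]), symmetric times
antisymmetric in (i, j), so it vanishes whatever the speed factor `e t`. -/
theorem energy_const {X : ι → E → E} (hX : ∀ i, Differentiable ℝ (X i)) {T : ℝ}
    {y : ℝ → E} {p : ℝ → E →L[ℝ] ℝ} {e : ℝ → ℝ}
    (hz : ∀ t ∈ Icc 0 T,
      HasDerivWithinAt (fun s => (y s, p s)) (e t • hamField X (y t, p t)) (Icc 0 T) t) :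
    ∀ t ∈ Icc 0 T, ∑ i, p t (X i (y t)) ^ 2 = ∑ i, p 0 (X i (y 0)) ^ 2 := by
  have hd : ∀ t ∈ Icc 0 T,
      HasDerivWithinAt (fun s => ∑ i, p s (X i (y s)) ^ 2) 0 (Icc 0 T) t := by
    intro t ht
    have h := HasDerivWithinAt.fun_sum (u := Finset.univ) fun i (_ : i ∈ Finset.univ) =>
      (hasDerivWithinAt_pairing (hz t ht) (hX i (y t))).pow 2
    refine h.congr_deriv ?_
    have h1 : ∑ i, ∑ j, p t (X i (y t)) * (p t (X j (y t)) *
        p t (lieBracket ℝ (X j) (X i) (y t))) = 0 := by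
      have h2 : ∑ i, ∑ j, p t (X i (y t)) * (p t (X j (y t)) *
        p t (lieBracket ℝ (X j) (X i) (y t))) = -∑ i, ∑ j, p t (X i (y t)) * (p t (X j (y t)) *
        p t (lieBracket ℝ (X j) (X i) (y t))) := by
        conv_lhs => rw [Finset.sum_comm]
        simp only [← Finset.sum_neg_distrib]
        refine Finset.sum_congr rfl fun i _ => Finset.sum_congr rfl fun j _ => ?_
        rw [lieBracket_swap]
        simp only [map_neg]
        ring
      linarith
    calc _ = 2 * e t * ∑ i, ∑ j, p t (X i (y t)) * (p t (X j (y t)) *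
        p t (lieBracket ℝ (X j) (X i) (y t))) := by
          simp only [Finset.mul_sum]
          refine Finset.sum_congr rfl fun i _ => Finset.sum_congr rfl fun j _ => ?_
          norm_num
          ring
      _ = 0 := by rw [h1, mul_zero]
  intro t ht
  refine constant_of_has_deriv_right_zero (fun s hs => (hd s hs).continuousWithinAt)
    (fun s hs => ?_) t ht
  exact (hd s (Ico_subset_Icc_self hs)).mono_of_mem_nhdsWithin (Icc_mem_nhdsGE_of_mem hs)

theorem abs_le_one_of_sum_sq {a : ι → ℝ} (h : ∑ i, a i ^ 2 = 1) (i : ι) : |a i| ≤ 1 := by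
  rw [← sq_le_one_iff_abs_le_one, ← h]
  exact Finset.single_le_sum (f := fun i => a i ^ 2) (fun j _ => sq_nonneg (a j))
    (Finset.mem_univ i)

theorem norm_hamField_fst_le {X : ι → E → E} {B : ℝ} {z : E × (E →L[ℝ] ℝ)}
    (hB : ∀ i, ‖X i z.1‖ ≤ B) (h1 : ∑ i, z.2 (X i z.1) ^ 2 = 1) :
    ‖(hamField X z).1‖ ≤ Fintype.card ι * B := by
  refine (norm_sum_le _ _).trans ?_
  rw [← nsmul_eq_mul, ← Finset.card_univ, ← Finset.sum_const]
  refine Finset.sum_le_sum fun i _ => ?_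
  rw [norm_smul, Real.norm_eq_abs]
  have := abs_le_one_of_sum_sq h1 i
  nlinarith [hB i, norm_nonneg (X i z.1), abs_nonneg (z.2 (X i z.1))]

/-- The momentum equation is quadratic in p, but on the energy level one factor is at most 1. The
resulting linear growth is what makes the existence time independent of the initial momentum. -/
theorem norm_hamField_snd_le {X : ι → E → E} {B : ℝ} {z : E × (E →L[ℝ] ℝ)}
    (hB : ∀ i, ‖fderiv ℝ (X i) z.1‖ ≤ B) (h1 : ∑ i, z.2 (X i z.1) ^ 2 = 1) :
    ‖(hamField X z).2‖ ≤ Fintype.card ι * B * ‖z.2‖ := by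
  rw [hamField, norm_neg]
  refine (norm_sum_le _ _).trans ?_
  rw [mul_assoc, ← nsmul_eq_mul, ← Finset.card_univ, ← Finset.sum_const]
  refine Finset.sum_le_sum fun i _ => ?_
  rw [norm_smul, Real.norm_eq_abs]
  have h2 : ‖z.2.comp (fderiv ℝ (X i) z.1)‖ ≤ ‖z.2‖ * ‖fderiv ℝ (X i) z.1‖ :=
    ContinuousLinearMap.opNorm_comp_le _ _
  have h3 : ‖z.2‖ * ‖fderiv ℝ (X i) z.1‖ ≤ ‖z.2‖ * B := by gcongr; exact hB i
  have := abs_le_one_of_sum_sq h1 i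
  nlinarith [norm_nonneg (z.2.comp (fderiv ℝ (X i) z.1)), abs_nonneg (z.2 (X i z.1))]

/-- A priori bounds for the (time changed) Hamiltonian flow on the energy level `∑ p(X_i)² = 1`. -/
theorem hamField_bounds {X : ι → E → E} (hX : ∀ i, Differentiable ℝ (X i)) {B : ℝ}
    (hB : ∀ i y, ‖X i y‖ ≤ B) (hB' : ∀ i y, ‖fderiv ℝ (X i) y‖ ≤ B) (hB0 : 0 ≤ B) {T : ℝ}
    {y : ℝ → E} {p : ℝ → E →L[ℝ] ℝ} {e : ℝ → ℝ}
    (he : ∀ t ∈ Icc 0 T, 0 ≤ e t ∧ e t ≤ 1)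
    (hz : ∀ t ∈ Icc 0 T,
      HasDerivWithinAt (fun s => (y s, p s)) (e t • hamField X (y t, p t)) (Icc 0 T) t)
    (h1 : ∑ i, p 0 (X i (y 0)) ^ 2 = 1) :
    ∀ t ∈ Icc 0 T, ‖y t - y 0‖ ≤ Fintype.card ι * B * t ∧
      ‖p t‖ ≤ ‖p 0‖ * Real.exp (Fintype.card ι * B * t) := by
  have hE : ∀ t ∈ Icc 0 T, ∑ i, p t (X i (y t)) ^ 2 = 1 := fun t ht => by
    rw [energy_const hX hz t ht, h1]
  have hC : 0 ≤ Fintype.card ι * B := by positivity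
  intro t ht
  constructor
  · have := norm_image_sub_le_of_norm_deriv_le_segment' (f := y) (a := 0) (b := T)
      (C := Fintype.card ι * B) (fun s hs => (hz s hs).fst) (fun s hs => ?_) t ht
    · simpa using this
    · have hs' := Ico_subset_Icc_self hs
      have h2 := norm_hamField_fst_le (z := (y s, p s)) (fun i => hB i _) (hE s hs')
      rw [Prod.smul_fst, norm_smul, Real.norm_of_nonneg (he s hs').1]
      nlinarith [(he s hs').1, (he s hs').2, norm_nonneg (hamField X (y s, p s)).1]
  · have hp : ∀ s ∈ Icc 0 T,
        HasDerivWithinAt p (e s • hamField X (y s, p s)).2 (Icc 0 T) s := fun s hs => (hz s hs).snd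
    have := norm_le_gronwallBound_of_norm_deriv_right_le (f := p) (a := 0) (b := T) (δ := ‖p 0‖)
      (K := Fintype.card ι * B) (ε := 0) (fun s hs => (hp s hs).continuousWithinAt)
      (fun s hs => (hp s (Ico_subset_Icc_self hs)).mono_of_mem_nhdsWithin
        (Icc_mem_nhdsGE_of_mem hs)) le_rfl (fun s hs => ?_) t ht
    · simpa [gronwallBound_ε0] using this
    · have hs' := Ico_subset_Icc_self hs
      have h2 := norm_hamField_snd_le (z := (y s, p s)) (fun i => hB' i _) (hE s hs')
      rw [Prod.smul_snd, norm_smul, Real.norm_of_nonneg (he s hs').1, add_zero]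
      refine le_trans ?_ h2
      nlinarith [(he s hs').1, (he s hs').2, norm_nonneg (hamField X (y s, p s)).2]

/-- Such a field is bounded and globally Lipschitz, so Picard–Lindelöf on a ball of radius L·T
around x covers the whole interval, with no restriction on T. -/
theorem exists_integralCurve_of_hasCompactSupport [FiniteDimensional ℝ E] {F : E → E}
    (hF : ContDiff ℝ ∞ F) (hc : HasCompactSupport F) (x : E) {T : ℝ} (hT : 0 ≤ T) :
    ∃ α : ℝ → E, α 0 = x ∧ ∀ t ∈ Icc 0 T, HasDerivWithinAt α (F (α t)) (Icc 0 T) t := by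
  obtain ⟨K, hK⟩ := (hF.of_le (m := 1) (by simp)).lipschitzWith_of_hasCompactSupport hc (by simp)
  obtain ⟨L, hL⟩ := hc.exists_bound_of_continuous hF.continuous
  have hL0 : 0 ≤ L := (norm_nonneg _).trans (hL x)
  have h : IsPicardLindelof (fun _ => F) (tmin := 0) (tmax := T) ⟨0, ⟨le_rfl, hT⟩⟩ x
      (L.toNNReal * T.toNNReal) 0 L.toNNReal K := by
    refine .of_time_independent (fun y _ => ?_) hK.lipschitzOnWith ?_
    · rw [Real.coe_toNNReal _ hL0]; exact hL y
    · simp [Real.coe_toNNReal _ hL0, Real.coe_toNNReal _ hT, hT]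
  exact h.exists_eq_forall_mem_Icc_hasDerivWithinAt₀

/-- On the energy level `∑ p(X_i)² = 1`, the Hamiltonian flow of compactly supported fields exists
for a time that does not depend on the initial point. -/
theorem exists_hamField_integralCurve [FiniteDimensional ℝ E] {X : ι → E → E}
    (hX : ∀ i, ContDiff ℝ ∞ (X i)) (hc : ∀ i, HasCompactSupport (X i)) {B : ℝ}
    (hB : ∀ i y, ‖X i y‖ ≤ B) (hB' : ∀ i y, ‖fderiv ℝ (X i) y‖ ≤ B) (hB0 : 0 ≤ B)
    {T : ℝ} (hT : 0 ≤ T) (hT' : Fintype.card ι * B * T ≤ Real.log 2)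
    (y₀ : E) (p₀ : E →L[ℝ] ℝ) (h1 : ∑ i, p₀ (X i y₀) ^ 2 = 1) :
    ∃ z : ℝ → E × (E →L[ℝ] ℝ), z 0 = (y₀, p₀) ∧
      ∀ t ∈ Icc 0 T, HasDerivWithinAt z (hamField X (z t)) (Icc 0 T) t := by
  -- The time bound makes the exponential growth factor at most 2, so momenta stay below 2‖p₀‖ and
  -- the solution never leaves the region where the cut-off equals 1.
  let χ : ContDiffBump (0 : E →L[ℝ] ℝ) :=
    ⟨2 * ‖p₀‖ + 1, 2 * ‖p₀‖ + 2, by positivity, by linarith⟩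
  have hF : ContDiff ℝ ∞ (fun z : E × (E →L[ℝ] ℝ) => χ z.2 • hamField X z) :=
    (χ.contDiff.comp contDiff_snd).smul (contDiff_hamField hX)
  have hFc : HasCompactSupport (fun z : E × (E →L[ℝ] ℝ) => χ z.2 • hamField X z) := by
    refine HasCompactSupport.intro
      (K := (⋃ i, tsupport (X i)) ×ˢ Metric.closedBall (0 : E →L[ℝ] ℝ) χ.rOut)
      ((isCompact_iUnion fun i => hc i).prod (isCompact_closedBall _ _)) ?_
    rintro ⟨y, p⟩ h
    rw [mem_prod, not_and_or] at h
    rcases h with h | h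
    · have hy : ∀ i, y ∉ tsupport (X i) := by simpa using h
      have h2 : ∀ i, X i y = 0 := fun i => image_eq_zero_of_notMem_tsupport (hy i)
      simp [hamField, h2]
    · have : χ p = 0 := χ.zero_of_le_dist (le_of_lt (by simpa using h))
      simp [this]
  obtain ⟨z, hz0, hz⟩ := exists_integralCurve_of_hasCompactSupport hF hFc (y₀, p₀) hT
  refine ⟨z, hz0, fun t ht => ?_⟩
  -- A cut-off trajectory follows the Hamiltonian field with speed χ ∈ [0, 1], so the a priori
  -- bounds apply before it is known that χ = 1 along it.
  have hb := hamField_bounds (fun i => (hX i).differentiable (by simp)) hB hB' hB0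
    (y := fun t => (z t).1) (p := fun t => (z t).2) (e := fun t => χ (z t).2)
    (fun t _ => ⟨χ.nonneg, χ.le_one⟩) hz (by simpa [hz0] using h1) t ht
  have h2 : Real.exp (Fintype.card ι * B * t) ≤ 2 := by
    rw [← Real.exp_log (show (0 : ℝ) < 2 by norm_num)]
    refine Real.exp_le_exp.2 (le_trans ?_ hT')
    exact mul_le_mul_of_nonneg_left ht.2 (by positivity)
  have h3 : χ (z t).2 = 1 := by
    refine χ.one_of_mem_closedBall ?_
    rw [mem_closedBall_zero_iff]
    refine hb.2.trans ?_
    simp only [hz0]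
    change _ ≤ 2 * ‖p₀‖ + 1
    nlinarith [norm_nonneg p₀]
  have := hz t ht
  rwa [h3, one_smul] at this

/-- Second order Taylor estimate with a remainder controlled by the oscillation of the second
derivative. -/
theorem abs_taylor_two_le {u v w : ℝ → ℝ} {T c ε : ℝ}
    (hu : ∀ t ∈ Icc 0 T, HasDerivWithinAt u (v t) (Icc 0 T) t)
    (hv : ∀ t ∈ Icc 0 T, HasDerivWithinAt v (w t) (Icc 0 T) t) (hT : 0 ≤ T)
    (hw : ∀ t ∈ Icc 0 T, |w t - c| ≤ ε) :
    |u T - u 0 - T * v 0 - T ^ 2 / 2 * c| ≤ ε * T ^ 2 := by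
  have hε : 0 ≤ ε := (abs_nonneg _).trans (hw 0 ⟨le_rfl, hT⟩)
  -- The mean value inequality is used twice, on v - ct and then on u minus its quadratic model.
  -- Bounding the slope ε·t by ε·T loses a factor 2 against the sharp constant, which is harmless.
  have h1 : ∀ t ∈ Icc 0 T, ‖(v t - c * t) - (v 0 - c * 0)‖ ≤ ε * (t - 0) := by
    refine norm_image_sub_le_of_norm_deriv_le_segment' (f := fun t => v t - c * t)
      (f' := fun t => w t - c * 1)
      (fun t ht => (hv t ht).sub ((hasDerivWithinAt_id _ _).const_mul c)) fun t ht => ?_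
    simpa using hw t (Ico_subset_Icc_self ht)
  have h2 := norm_image_sub_le_of_norm_deriv_le_segment'
      (f := fun t => u t - v 0 * t - c * (t ^ 2 / 2))
      (f' := fun t => v t - v 0 * 1 - c * t) (C := ε * T) (a := 0) (b := T)
      (fun t ht => ?_) (fun t ht => ?_) T ⟨hT, le_rfl⟩
  · rw [Real.norm_eq_abs] at h2
    exact le_of_eq_of_le (congrArg _ (by ring)) (h2.trans_eq (by ring))
  · refine (((hu t ht).sub ((hasDerivWithinAt_id t _).const_mul (v 0))).sub
      ((((hasDerivWithinAt_id t _).pow 2).div_const 2).const_mul c)).congr_deriv ?_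
    simp only [id]
    ring
  · have h3 := h1 t (Ico_subset_Icc_self ht)
    have h4 : v t - v 0 * 1 - c * t = (v t - c * t) - (v 0 - c * 0) := by ring
    rw [h4]
    refine h3.trans ?_
    have := ht.2
    gcongr
    linarith

end HamiltonianODE

/-- A function which is smooth on an open set agrees near any given compact ball in that set with a
smooth compactly supported function. -/
theorem exists_contDiff_hasCompactSupport_eqOn {E F : Type*} [NormedAddCommGroup E]
    [NormedSpace ℝ E] [FiniteDimensional ℝ E] [NormedAddCommGroup F] [NormedSpace ℝ F]
    {O : Set E} (hO : IsOpen O) {y₀ : E} (hy₀ : y₀ ∈ O) :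
    ∃ r > 0, Metric.closedBall y₀ r ⊆ O ∧ ∀ f : E → F, ContDiffOn ℝ ∞ f O →
      ∃ g : E → F, ContDiff ℝ ∞ g ∧ HasCompactSupport g ∧ EqOn g f (Metric.ball y₀ r) := by
  obtain ⟨r, hr, hrO⟩ := Metric.isOpen_iff.1 hO y₀ hy₀
  let χ : ContDiffBump y₀ := ⟨r / 4, r / 2, by positivity, by linarith⟩
  have hχ : tsupport χ ⊆ O := by
    rw [χ.tsupport_eq]
    exact (Metric.closedBall_subset_ball (by change r / 2 < r; linarith)).trans hrO
  refine ⟨r / 4, by positivity, (Metric.closedBall_subset_ball (by linarith)).trans hrO,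
    fun f hf => ⟨fun y => χ y • f y, ?_, ?_, fun y hy => ?_⟩⟩
  · rw [contDiff_iff_contDiffAt]
    intro y
    by_cases hy : y ∈ O
    · exact χ.contDiff.contDiffAt.smul (hf.contDiffAt (hO.mem_nhds hy))
    · refine (contDiffAt_const (c := (0 : F))).congr_of_eventuallyEq ?_
      have h : (tsupport χ)ᶜ ∈ 𝓝 y :=
        (isClosed_tsupport χ).isOpen_compl.mem_nhds fun h => hy (hχ h)
      filter_upwards [h] with y' hy'
      simp [image_eq_zero_of_notMem_tsupport hy']
  · exact χ.hasCompactSupport.smul_right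
  · have : χ y = 1 := χ.one_of_mem_closedBall (Metric.ball_subset_closedBall hy)
    simp [this]

end SubRiem

namespace SubRiem

/-! ### Vector fields, functions and brackets in a chart. -/

section Charts

variable {n : ℕ} {M : Type*} [TopologicalSpace M] [ChartedSpace (EuclideanSpace ℝ (Fin n)) M]
    [IsManifold (𝓡 n) ∞ M]

theorem two_le_infty : (2 : WithTop ℕ∞) ≤ ∞ := WithTop.coe_le_coe.2 (le_top : (2 : ℕ∞) ≤ ⊤)

theorem mlieBracket_model (V W : Model n → Model n) (y : Model n) :
    mlieBracket 𝓘(ℝ, Model n) V W y = lieBracket ℝ V W y := by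
  have h1 := congrFun (mlieBracketWithin_univ (I := 𝓘(ℝ, Model n)) (V := V) (W := W)) y
  have h2 := congrFun (mlieBracketWithin_eq_lieBracketWithin (𝕜 := ℝ) (V := V) (W := W)
    (s := univ)) y
  have h3 := congrFun (lieBracketWithin_univ (𝕜 := ℝ) (V := V) (W := W)) y
  exact h1.symm.trans (h2.trans h3)

/-- The derivative at `q` of the chart at `x`. -/
def chartDeriv (x q : M) : Model n →L[ℝ] Model n :=
  mfderiv (𝓡 n) 𝓘(ℝ, Model n) (extChartAt (𝓡 n) x) q

/-- The vector field `X` in the chart at `x`. -/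
def chartRep (x : M) (X : ∀ q : M, TangentSpace (𝓡 n) q) (y : Model n) : Model n :=
  chartDeriv x ((extChartAt (𝓡 n) x).symm y) (X ((extChartAt (𝓡 n) x).symm y))

theorem chartRep_apply {x q : M} (hq : q ∈ (extChartAt (𝓡 n) x).source)
    (X : ∀ q : M, TangentSpace (𝓡 n) q) :
    chartRep x X (extChartAt (𝓡 n) x q) = chartDeriv x q (X q) := by
  rw [chartRep, (extChartAt (𝓡 n) x).left_inv hq]

theorem isInvertible_chartDeriv {x q : M} (hq : q ∈ (extChartAt (𝓡 n) x).source) :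
    (chartDeriv x q : Model n →L[ℝ] Model n).IsInvertible :=
  isInvertible_mfderiv_extChartAt hq

theorem chartDeriv_inverse_apply {x q : M} (hq : q ∈ (extChartAt (𝓡 n) x).source) (v : Model n) :
    (chartDeriv x q).inverse (chartDeriv x q v) = v :=
  (isInvertible_chartDeriv hq).inverse_apply_self v

theorem chartDeriv_apply_inverse {x q : M} (hq : q ∈ (extChartAt (𝓡 n) x).source) (v : Model n) :
    chartDeriv x q ((chartDeriv x q).inverse v) = v :=
  (isInvertible_chartDeriv hq).self_apply_inverse v

theorem mfderiv_extChartAt_symm_eq {x : M} {y : Model n} (hy : y ∈ (extChartAt (𝓡 n) x).target) :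
    (mfderiv 𝓘(ℝ, Model n) (𝓡 n) (extChartAt (𝓡 n) x).symm y : Model n →L[ℝ] Model n) =
      (chartDeriv x ((extChartAt (𝓡 n) x).symm y)).inverse := by
  have h1 := mfderiv_extChartAt_comp_mfderivWithin_extChartAt_symm (I := 𝓡 n) hy
  have h2 := mfderivWithin_extChartAt_symm_comp_mfderiv_extChartAt (I := 𝓡 n) hy
  rw [modelWithCornersSelf_coe, range_id, mfderivWithin_univ] at h1 h2
  exact (ContinuousLinearMap.inverse_eq h1 h2).symm

/-- The coordinate expression of a field is its pullback under the inverse chart. This gives access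
to the smoothness of pullbacks and to the naturality of the Lie bracket. -/
theorem chartRep_eq_mpullback {x : M} (X : ∀ q : M, TangentSpace (𝓡 n) q) {y : Model n}
    (hy : y ∈ (extChartAt (𝓡 n) x).target) :
    chartRep x X y = mpullback 𝓘(ℝ, Model n) (𝓡 n) (extChartAt (𝓡 n) x).symm X y := by
  have h := isInvertible_chartDeriv ((extChartAt (𝓡 n) x).map_target hy)
  rw [mpullback_apply]
  change _ = ContinuousLinearMap.inverse (mfderiv 𝓘(ℝ, Model n) (𝓡 n) (extChartAt (𝓡 n) x).symm y :
    Model n →L[ℝ] Model n) _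
  rw [mfderiv_extChartAt_symm_eq hy]
  obtain ⟨e, he⟩ := h
  rw [chartRep, ← he, ContinuousLinearMap.inverse_equiv]
  exact (congrArg (fun L : Model n →L[ℝ] Model n => L (X ((extChartAt (𝓡 n) x).symm y)))
    (ContinuousLinearMap.inverse_equiv e.symm)).symm

theorem isOpen_chart_inter (x : M) {U : Set M} (hU : IsOpen U) :
    IsOpen ((extChartAt (𝓡 n) x).target ∩ (extChartAt (𝓡 n) x).symm ⁻¹' U) :=
  (continuousOn_extChartAt_symm x).isOpen_inter_preimage (isOpen_extChartAt_target x) hU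

theorem contMDiffAt_extChartAt_symm' {x : M} {y : Model n}
    (hy : y ∈ (extChartAt (𝓡 n) x).target) :
    ContMDiffAt 𝓘(ℝ, Model n) (𝓡 n) ∞ (extChartAt (𝓡 n) x).symm y :=
  (contMDiffOn_extChartAt_symm x).contMDiffAt ((isOpen_extChartAt_target x).mem_nhds hy)

theorem contMDiffAt_extChartAt'' {x q : M} (hq : q ∈ (extChartAt (𝓡 n) x).source) :
    ContMDiffAt (𝓡 n) 𝓘(ℝ, Model n) ∞ (extChartAt (𝓡 n) x) q :=
  contMDiffAt_extChartAt' (by rwa [← extChartAt_source (𝓡 n)])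

theorem SmoothFieldOn.contDiffOn_chartRep {X : ∀ q : M, TangentSpace (𝓡 n) q} {U : Set M}
    (hU : IsOpen U) (hX : SmoothFieldOn X U) (x : M) :
    ContDiffOn ℝ ∞ (chartRep x X)
      ((extChartAt (𝓡 n) x).target ∩ (extChartAt (𝓡 n) x).symm ⁻¹' U) := by
  intro y hy
  refine ContDiffAt.contDiffWithinAt ?_
  have h1 : ContMDiffAt 𝓘(ℝ, Model n) 𝓘(ℝ, Model n).tangent ∞
      (fun y => (⟨y, mpullback 𝓘(ℝ, Model n) (𝓡 n) (extChartAt (𝓡 n) x).symm X y⟩ :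
        TangentBundle 𝓘(ℝ, Model n) (Model n))) y := by
    refine ContMDiffAt.mpullback_vectorField_preimage (n := ∞) (hX.contMDiffAt (hU.mem_nhds hy.2))
      (contMDiffAt_extChartAt_symm' hy.1) ?_ le_rfl
    change ContinuousLinearMap.IsInvertible (mfderiv 𝓘(ℝ, Model n) (𝓡 n)
      (extChartAt (𝓡 n) x).symm y : Model n →L[ℝ] Model n)
    rw [mfderiv_extChartAt_symm_eq hy.1]
    exact (isInvertible_chartDeriv ((extChartAt (𝓡 n) x).map_target hy.1)).inverse
  have h2 := contMDiffAt_vectorSpace_iff_contDiffAt.1 h1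
  refine h2.congr_of_eventuallyEq ?_
  filter_upwards [(isOpen_extChartAt_target x).mem_nhds hy.1] with z hz
  exact chartRep_eq_mpullback X hz

theorem smoothFieldOn_chart {x : M} {c : Model n → Model n} {U : Set M} (hU : IsOpen U)
    (hc : ContDiffOn ℝ ∞ c ((extChartAt (𝓡 n) x).target ∩ (extChartAt (𝓡 n) x).symm ⁻¹' U)) :
    SmoothFieldOn (fun q => (chartDeriv x q).inverse (c (extChartAt (𝓡 n) x q)) :
      ∀ q : M, TangentSpace (𝓡 n) q) ((extChartAt (𝓡 n) x).source ∩ U) := by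
  intro q hq
  have hy : extChartAt (𝓡 n) x q ∈
      (extChartAt (𝓡 n) x).target ∩ (extChartAt (𝓡 n) x).symm ⁻¹' U :=
    ⟨(extChartAt (𝓡 n) x).map_source hq.1, by
      rw [mem_preimage, (extChartAt (𝓡 n) x).left_inv hq.1]; exact hq.2⟩
  have h1 : ContMDiffAt 𝓘(ℝ, Model n) 𝓘(ℝ, Model n).tangent ∞
      (fun y => (⟨y, c y⟩ : TangentBundle 𝓘(ℝ, Model n) (Model n))) (extChartAt (𝓡 n) x q) :=
    contMDiffAt_vectorSpace_iff_contDiffAt.2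
      (hc.contDiffAt ((isOpen_chart_inter x hU).mem_nhds hy))
  exact (ContMDiffAt.mpullback_vectorField_preimage (n := ∞) h1 (contMDiffAt_extChartAt'' hq.1)
    (isInvertible_chartDeriv hq.1) le_rfl).contMDiffWithinAt

theorem smoothFieldOn_of_chartRep {X : ∀ q : M, TangentSpace (𝓡 n) q} {x : M} {U : Set M}
    (hU : IsOpen U) (hX : ContDiffOn ℝ ∞ (chartRep x X)
      ((extChartAt (𝓡 n) x).target ∩ (extChartAt (𝓡 n) x).symm ⁻¹' U)) :
    SmoothFieldOn X ((extChartAt (𝓡 n) x).source ∩ U) := by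
  refine (smoothFieldOn_chart hU hX).congr fun q hq => ?_
  have h : (chartDeriv x q).inverse (chartRep x X (extChartAt (𝓡 n) x q)) = X q := by
    rw [chartRep_apply hq.1]
    exact chartDeriv_inverse_apply hq.1 _
  exact congrArg (fun v => (⟨q, v⟩ : TangentBundle (𝓡 n) M)) h.symm

theorem smoothFieldOn_chartField (x : M) (w : Model n) :
    SmoothFieldOn (chartField x w) (extChartAt (𝓡 n) x).source := by
  have h := smoothFieldOn_chart (x := x) (c := fun _ => w) isOpen_univ contDiffOn_const
  rwa [inter_univ] at h

theorem chartRep_chartField {x : M} (w : Model n) {y : Model n}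
    (hy : y ∈ (extChartAt (𝓡 n) x).target) : chartRep x (chartField x w) y = w :=
  chartDeriv_apply_inverse ((extChartAt (𝓡 n) x).map_target hy) w

theorem SmoothFunOn.contDiffOn_chart {f : M → ℝ} {U : Set M}
    (hf : SmoothFunOn n f U) (x : M) :
    ContDiffOn ℝ ∞ (f ∘ (extChartAt (𝓡 n) x).symm)
      ((extChartAt (𝓡 n) x).target ∩ (extChartAt (𝓡 n) x).symm ⁻¹' U) := by
  rw [← contMDiffOn_iff_contDiffOn]
  exact ContMDiffOn.comp hf ((contMDiffOn_extChartAt_symm x).mono inter_subset_left)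
    fun y hy => hy.2

theorem smoothFunOn_chart {x : M} {c : Model n → ℝ} {U : Set M}
    (hc : ContDiffOn ℝ ∞ c ((extChartAt (𝓡 n) x).target ∩ (extChartAt (𝓡 n) x).symm ⁻¹' U)) :
    SmoothFunOn n (fun q => c (extChartAt (𝓡 n) x q)) ((extChartAt (𝓡 n) x).source ∩ U) := by
  refine ContMDiffOn.comp (contMDiffOn_iff_contDiffOn.2 hc)
    (fun q hq => (contMDiffAt_extChartAt'' hq.1).contMDiffWithinAt) fun q hq => ?_
  exact ⟨(extChartAt (𝓡 n) x).map_source hq.1, by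
      rw [mem_preimage, (extChartAt (𝓡 n) x).left_inv hq.1]; exact hq.2⟩

theorem smoothFunOn_of_chart {f : M → ℝ} {x : M} {U : Set M}
    (hf : ContDiffOn ℝ ∞ (f ∘ (extChartAt (𝓡 n) x).symm)
      ((extChartAt (𝓡 n) x).target ∩ (extChartAt (𝓡 n) x).symm ⁻¹' U)) :
    SmoothFunOn n f ((extChartAt (𝓡 n) x).source ∩ U) := by
  refine (smoothFunOn_chart hf).congr fun q hq => ?_
  rw [Function.comp_apply, (extChartAt (𝓡 n) x).left_inv hq.1]

theorem differential_apply {f : M → ℝ} {x q : M} (hq : q ∈ (extChartAt (𝓡 n) x).source)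
    (hf : MDifferentiableAt (𝓡 n) 𝓘(ℝ, ℝ) f q) (v : TangentSpace (𝓡 n) q) :
    differential n f q v =
      fderiv ℝ (f ∘ (extChartAt (𝓡 n) x).symm) (extChartAt (𝓡 n) x q) (chartDeriv x q v) := by
  have hy := (extChartAt (𝓡 n) x).map_source hq
  have hf' : MDifferentiableAt (𝓡 n) 𝓘(ℝ, ℝ) f
      ((extChartAt (𝓡 n) x).symm (extChartAt (𝓡 n) x q)) := by
    rwa [(extChartAt (𝓡 n) x).left_inv hq]
  have h1 := mfderiv_comp (extChartAt (𝓡 n) x q) hf'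
    ((contMDiffAt_extChartAt_symm' hy).mdifferentiableAt (by simp))
  rw [mfderiv_eq_fderiv] at h1
  rw [h1]
  change _ = (mfderiv (𝓡 n) 𝓘(ℝ, ℝ) f ((extChartAt (𝓡 n) x).symm (extChartAt (𝓡 n) x q)) :
    Model n →L[ℝ] ℝ) ((mfderiv 𝓘(ℝ, Model n) (𝓡 n) (extChartAt (𝓡 n) x).symm
      (extChartAt (𝓡 n) x q) : Model n →L[ℝ] Model n) (chartDeriv x q v))
  rw [mfderiv_extChartAt_symm_eq hy, (extChartAt (𝓡 n) x).left_inv hq]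
  exact congrArg (differential n f q) (chartDeriv_inverse_apply hq v).symm

/-- Naturality of the bracket under the inverse chart turns the manifold bracket into the elementary
one of the coordinate expressions. -/
theorem chartDeriv_mlieBracket {X Y : ∀ q : M, TangentSpace (𝓡 n) q} {x q : M} {U : Set M}
    (hU : IsOpen U) (hX : SmoothFieldOn X U) (hY : SmoothFieldOn Y U) (hqU : q ∈ U)
    (hq : q ∈ (extChartAt (𝓡 n) x).source) :
    chartDeriv x q (mlieBracket (𝓡 n) X Y q) =
      lieBracket ℝ (chartRep x X) (chartRep x Y) (extChartAt (𝓡 n) x q) := by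
  have hy := (extChartAt (𝓡 n) x).map_source hq
  have hqq := (extChartAt (𝓡 n) x).left_inv hq
  have hqU' : (extChartAt (𝓡 n) x).symm (extChartAt (𝓡 n) x q) ∈ U := by rwa [hqq]
  have hM : IsManifold (𝓡 n) (minSmoothness ℝ 2) M :=
    IsManifold.of_le (n := ∞) (by rw [minSmoothness_of_isRCLikeNormedField]; exact two_le_infty)
  have h := mpullback_mlieBracket (n := ∞) (I := 𝓘(ℝ, Model n)) (I' := 𝓡 n)
    (f := (extChartAt (𝓡 n) x).symm) (V := X) (W := Y) (x₀ := extChartAt (𝓡 n) x q)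
    ((hX.contMDiffAt (hU.mem_nhds hqU')).mdifferentiableAt (by simp))
    ((hY.contMDiffAt (hU.mem_nhds hqU')).mdifferentiableAt (by simp))
    (contMDiffAt_extChartAt_symm' hy)
    (by rw [minSmoothness_of_isRCLikeNormedField]; exact two_le_infty)
  rw [← chartRep_eq_mpullback _ hy, chartRep_apply hq] at h
  refine h.trans ?_
  refine (mlieBracket_model _ _ _).trans ?_
  have he : ∀ Z : ∀ q : M, TangentSpace (𝓡 n) q,
      (mpullback 𝓘(ℝ, Model n) (𝓡 n) (extChartAt (𝓡 n) x).symm Z : Model n → Model n)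
      =ᶠ[𝓝 (extChartAt (𝓡 n) x q)] chartRep x Z := by
    intro Z
    filter_upwards [(isOpen_extChartAt_target x).mem_nhds hy] with z hz
    exact (chartRep_eq_mpullback Z hz).symm
  exact (he X).lieBracket_vectorField_eq (he Y)

end Charts

end SubRiem

namespace SubRiem

/-! ### Weak and strong derivatives of curves in ℝⁿ and in its dual. -/

section Coordinates

variable {n : ℕ}

/-- Hamilton's equations are stated by testing against fixed covectors and vectors. In finite
dimension this is equivalent to differentiability of the curve, since finitely many coordinates
suffice. -/
theorem hasDerivWithinAt_model_iff {y : ℝ → Model n} {v : Model n} {s : Set ℝ} {t : ℝ} :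
    (∀ η : Model n →L[ℝ] ℝ, HasDerivWithinAt (fun r => η (y r)) (η v) s t) ↔
      HasDerivWithinAt y v s t := by
  refine ⟨fun h => ?_, fun h η => η.hasFDerivAt.comp_hasDerivWithinAt t h⟩
  rw [hasDerivWithinAt_iff_hasFDerivWithinAt, hasFDerivWithinAt_euclidean]
  intro i
  have := (h (EuclideanSpace.proj i)).hasFDerivWithinAt
  refine this.congr_fderiv ?_
  ext
  simp

theorem dual_eq_sum (p : Model n →L[ℝ] ℝ) :
    p = ∑ i, p (EuclideanSpace.single i 1) • (EuclideanSpace.proj i : Model n →L[ℝ] ℝ) := by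
  ext v
  have hv : v = ∑ i, v i • EuclideanSpace.single i (1 : ℝ) := by
    ext j
    simp [Finset.sum_apply, Pi.single_apply]
  conv_lhs => rw [hv]
  simp [mul_comm]

theorem hasDerivWithinAt_dual_iff {p : ℝ → Model n →L[ℝ] ℝ} {p' : Model n →L[ℝ] ℝ} {s : Set ℝ}
    {t : ℝ} :
    (∀ w : Model n, HasDerivWithinAt (fun r => p r w) (p' w) s t) ↔
      HasDerivWithinAt p p' s t := by
  refine ⟨fun h => ?_, fun h w =>
    (ContinuousLinearMap.apply ℝ ℝ w).hasFDerivAt.comp_hasDerivWithinAt t h⟩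
  have h1 := HasDerivWithinAt.fun_sum (u := Finset.univ) fun i (_ : i ∈ Finset.univ) =>
    (h (EuclideanSpace.single i 1)).smul_const (EuclideanSpace.proj i : Model n →L[ℝ] ℝ)
  rw [← dual_eq_sum p'] at h1
  refine h1.congr_of_eventuallyEq (Eventually.of_forall fun r => ?_) ?_ <;> exact dual_eq_sum _

end Coordinates

/-! ### Hamilton's equations in a horizontal orthonormal frame. -/

namespace Structure

variable {n k : ℕ} {M : Type*} [TopologicalSpace M] [ChartedSpace (EuclideanSpace ℝ (Fin n)) M]
    [IsManifold (𝓡 n) ∞ M] {S : Structure n k M}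

section Pointwise

variable {q : M} {e : Fin k → S.D q}

theorem g_eq_sum (he : ∀ i j, S.g q (e i) (e j) = if i = j then 1 else 0) (v : S.D q) :
    v = ∑ i, S.g q (e i) v • e i := by
  have hli : LinearIndependent ℝ e := by
    rw [Fintype.linearIndependent_iff]
    intro c hc i
    have := congrArg (S.g q (e i)) hc
    simpa [map_sum, he] using this
  have hspan : ⊤ ≤ Submodule.span ℝ (Set.range e) :=
    (hli.span_eq_top_of_card_eq_finrank' (by simp [S.finrank_D q])).ge
  let b := Module.Basis.mk hli hspan
  have hb : ∀ i, b i = e i := fun i => by simp [b]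
  conv_lhs => rw [← b.sum_repr v]
  refine Finset.sum_congr rfl fun i _ => ?_
  rw [hb]
  congr 1
  conv_rhs => rw [← b.sum_repr v]
  simp [map_sum, hb, he]

theorem g_sharp (S : Structure n k M) (q : M) (ξ : Cotangent n q) (v : S.D q) :
    S.g q (S.sharp q ξ) v = ξ (v : TangentSpace (𝓡 n) q) := by
  have := LinearMap.BilinForm.apply_toDual_symm_apply (hB := S.nondegenerate_g q)
    ((ξ : Model n →ₗ[ℝ] ℝ).comp (S.D q).subtype) v
  exact this

theorem sharp_eq_sum (he : ∀ i j, S.g q (e i) (e j) = if i = j then 1 else 0)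
    (ξ : Cotangent n q) :
    S.sharp q ξ = ∑ i, ξ (e i : TangentSpace (𝓡 n) q) • e i := by
  conv_lhs => rw [g_eq_sum he (S.sharp q ξ)]
  refine Finset.sum_congr rfl fun i _ => ?_
  rw [S.symm_g, g_sharp]

theorem hamiltonian_eq_sum (he : ∀ i j, S.g q (e i) (e j) = if i = j then 1 else 0)
    (ξ : Cotangent n q) :
    S.hamiltonian q ξ = 1 / 2 * ∑ i, ξ (e i : TangentSpace (𝓡 n) q) ^ 2 := by
  rw [hamiltonian, g_sharp]
  congr 1
  have h := congrArg (fun v : S.D q => ξ (v : TangentSpace (𝓡 n) q)) (sharp_eq_sum he ξ)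
  refine h.trans ?_
  simp only [Submodule.coe_sum, Submodule.coe_smul]
  refine (map_sum ξ _ _).trans (Finset.sum_congr rfl fun i _ => ?_)
  refine (map_smul ξ _ _).trans ?_
  rw [smul_eq_mul, sq]

end Pointwise

/-- `X₁, …, X_k` is a smooth orthonormal frame of `D` on `U`. -/
structure IsHorizontalFrame (S : Structure n k M) (U : Set M)
    (X : Fin k → ∀ q : M, TangentSpace (𝓡 n) q) : Prop where
  smooth : ∀ i, SmoothFieldOn (X i) U
  mem_D : ∀ i, ∀ q ∈ U, X i q ∈ S.D q
  orthonormal : ∀ q, ∀ hq : q ∈ U, ∀ i j,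
    S.g q ⟨X i q, mem_D i q hq⟩ ⟨X j q, mem_D j q hq⟩ = if i = j then 1 else 0

section Frame

variable {U : Set M} {X : Fin k → ∀ q : M, TangentSpace (𝓡 n) q}

theorem IsHorizontalFrame.mono (hX : S.IsHorizontalFrame U X) {U' : Set M} (h : U' ⊆ U) :
    S.IsHorizontalFrame U' X :=
  ⟨fun i => (hX.smooth i).mono h, fun i q hq => hX.mem_D i q (h hq),
    fun q hq => hX.orthonormal q (h hq)⟩

theorem IsHorizontalFrame.hamiltonian_eq (hX : S.IsHorizontalFrame U X) {q : M} (hq : q ∈ U)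
    (ξ : Cotangent n q) : S.hamiltonian q ξ = 1 / 2 * ∑ i, ξ (X i q) ^ 2 :=
  hamiltonian_eq_sum (hX.orthonormal q hq) ξ

theorem IsHorizontalFrame.chartHamiltonian_eq (hX : S.IsHorizontalFrame U X) (x : M)
    {z : Model n × (Model n →L[ℝ] ℝ)} (hz : (extChartAt (𝓡 n) x).symm z.1 ∈ U) :
    S.chartHamiltonian x z = 1 / 2 * ∑ i, z.2 (chartRep x (X i) z.1) ^ 2 := by
  rw [chartHamiltonian, hX.hamiltonian_eq hz]
  rfl

theorem IsHorizontalFrame.differentiableAt_chartRep (hX : S.IsHorizontalFrame U X) (hU : IsOpen U)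
    {x q : M} (hq : q ∈ (extChartAt (𝓡 n) x).source) (hqU : q ∈ U) (i : Fin k) :
    DifferentiableAt ℝ (chartRep x (X i)) (extChartAt (𝓡 n) x q) :=
  (((hX.smooth i).contDiffOn_chartRep hU x).contDiffAt ((isOpen_chart_inter x hU).mem_nhds
    ⟨(extChartAt (𝓡 n) x).map_source hq, by
      rw [mem_preimage, (extChartAt (𝓡 n) x).left_inv hq]; exact hqU⟩)).differentiableAt (by simp)

/-- The differential of H is the symplectic pairing with `hamField`. Both Hamilton equations are
read off by setting w = 0 or η = 0. -/
theorem IsHorizontalFrame.fderiv_chartHamiltonian (hX : S.IsHorizontalFrame U X) (hU : IsOpen U)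
    {x q : M} (hq : q ∈ (extChartAt (𝓡 n) x).source) (hqU : q ∈ U) (p : Model n →L[ℝ] ℝ)
    (w : Model n) (η : Model n →L[ℝ] ℝ) :
    fderiv ℝ (S.chartHamiltonian x) (extChartAt (𝓡 n) x q, p) (w, η) =
      η (hamField (fun i => chartRep x (X i)) (extChartAt (𝓡 n) x q, p)).1 -
        (hamField (fun i => chartRep x (X i)) (extChartAt (𝓡 n) x q, p)).2 w := by
  have hy : extChartAt (𝓡 n) x q ∈
      (extChartAt (𝓡 n) x).target ∩ (extChartAt (𝓡 n) x).symm ⁻¹' U :=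
    ⟨(extChartAt (𝓡 n) x).map_source hq, by
      rw [mem_preimage, (extChartAt (𝓡 n) x).left_inv hq]; exact hqU⟩
  have h1 := hasFDerivAt_halfSumSq (X := fun i => chartRep x (X i))
    (z := (extChartAt (𝓡 n) x q, p)) (hX.differentiableAt_chartRep hU hq hqU)
  have h2 : S.chartHamiltonian x =ᶠ[𝓝 (extChartAt (𝓡 n) x q, p)]
      fun z => (1 / 2 : ℝ) * ∑ i, z.2 (chartRep x (X i) z.1) ^ 2 := by
    filter_upwards [continuousAt_fst.preimage_mem_nhds ((isOpen_chart_inter x hU).mem_nhds hy)]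
      with z hz
    exact hX.chartHamiltonian_eq x hz.2
  rw [h2.fderiv_eq, h1.fderiv]
  simp only [hamField, map_sum, map_smul, sum_apply, smul_apply, neg_apply, add_apply,
    ContinuousLinearMap.comp_apply, smul_eq_mul, mul_add, Finset.sum_add_distrib, sub_neg_eq_add]
  rfl

/-- Hamilton's equations at time `t` in the chart at `x`, for the frame `X`. -/
def HamiltonAt (X : Fin k → ∀ q : M, TangentSpace (𝓡 n) q) (x : M) (T : ℝ)
    (Λ : ℝ → Σ q : M, Cotangent n q) (t : ℝ) : Prop :=
  HasDerivWithinAt (fun s => chartCovector x (Λ s))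
    (hamField (fun i => chartRep x (X i)) (chartCovector x (Λ t))) (Icc 0 T) t

theorem chartCovector_snd_chartDeriv {x : M} {ξ : Σ q : M, Cotangent n q}
    (h : ξ.1 ∈ (extChartAt (𝓡 n) x).source) (v : TangentSpace (𝓡 n) ξ.1) :
    (chartCovector x ξ).2 (chartDeriv x ξ.1 v) = ξ.2 v := by
  exact congrArg ξ.2 (chartDeriv_inverse_apply h v)

theorem chartCovector_snd_chartRep {x : M} {ξ : Σ q : M, Cotangent n q}
    (h : ξ.1 ∈ (extChartAt (𝓡 n) x).source) (Y : ∀ q : M, TangentSpace (𝓡 n) q) :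
    (chartCovector x ξ).2 (chartRep x Y (chartCovector x ξ).1) = ξ.2 (Y ξ.1) := by
  have : (chartCovector x ξ).1 = extChartAt (𝓡 n) x ξ.1 := rfl
  rw [this, chartRep_apply h, chartCovector_snd_chartDeriv h]

theorem isHamiltonianCurve_iff (hX : S.IsHorizontalFrame U X) (hU : IsOpen U) {T : ℝ}
    {Λ : ℝ → Σ q : M, Cotangent n q} {t : ℝ} (hqU : (Λ t).1 ∈ U) :
    ((∀ η : Model n →L[ℝ] ℝ,
      HasDerivWithinAt (fun s => η (chartCovector (Λ t).1 (Λ s)).1)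
        (fderiv ℝ (S.chartHamiltonian (Λ t).1) (chartCovector (Λ t).1 (Λ t)) (0, η))
        (Icc 0 T) t) ∧
    (∀ w : Model n,
      HasDerivWithinAt (fun s => (chartCovector (Λ t).1 (Λ s)).2 w)
        (-fderiv ℝ (S.chartHamiltonian (Λ t).1) (chartCovector (Λ t).1 (Λ t)) (w, 0))
        (Icc 0 T) t)) ↔ HamiltonAt X (Λ t).1 T Λ t := by
  have h1 : ∀ w η, fderiv ℝ (S.chartHamiltonian (Λ t).1) (chartCovector (Λ t).1 (Λ t)) (w, η) =
      η (hamField (fun i => chartRep (Λ t).1 (X i)) (chartCovector (Λ t).1 (Λ t))).1 -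
        (hamField (fun i => chartRep (Λ t).1 (X i)) (chartCovector (Λ t).1 (Λ t))).2 w :=
    hX.fderiv_chartHamiltonian hU (mem_extChartAt_source _) hqU _
  simp only [h1, map_zero, zero_apply, sub_zero, zero_sub, neg_neg]
  rw [hasDerivWithinAt_model_iff, hasDerivWithinAt_dual_iff]
  exact ⟨fun h => h.1.prodMk h.2, fun h => ⟨h.fst, h.snd⟩⟩

section Derivatives

variable {T : ℝ} {Λ : ℝ → Σ q : M, Cotangent n q} {t : ℝ} {x : M}

theorem HamiltonAt.hasDerivWithinAt_fun (hΛ : HamiltonAt X x T Λ t)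
    (hc : ContinuousWithinAt (fun s => (Λ s).1) (Icc 0 T) t)
    (ht : t ∈ Icc 0 T)
    (hx : (Λ t).1 ∈ (extChartAt (𝓡 n) x).source) {f : M → ℝ}
    (hf : ContMDiffAt (𝓡 n) 𝓘(ℝ, ℝ) ∞ f (Λ t).1) :
    HasDerivWithinAt (fun s => f (Λ s).1)
      (∑ i, (Λ t).2 (X i (Λ t).1) * differential n f (Λ t).1 (X i (Λ t).1)) (Icc 0 T) t := by
  have hy := (extChartAt (𝓡 n) x).map_source hx
  have hf1 : ContMDiffAt (𝓡 n) 𝓘(ℝ, ℝ) ∞ f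
      ((extChartAt (𝓡 n) x).symm (extChartAt (𝓡 n) x (Λ t).1)) := by
    rwa [(extChartAt (𝓡 n) x).left_inv hx]
  have hf2 : DifferentiableAt ℝ (f ∘ (extChartAt (𝓡 n) x).symm)
      (extChartAt (𝓡 n) x (Λ t).1) :=
    (contMDiffAt_iff_contDiffAt.1
      (hf1.comp _ (contMDiffAt_extChartAt_symm' hy))).differentiableAt (by simp)
  have h1 : HasDerivWithinAt (fun s => (chartCovector x (Λ s)).1) _ (Icc 0 T) t := hΛ.fst
  have h2 := hf2.hasFDerivAt.comp_hasDerivWithinAt t h1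
  have h3 : ∀ᶠ s in 𝓝[Icc 0 T] t, (Λ s).1 ∈ (extChartAt (𝓡 n) x).source :=
    hc.preimage_mem_nhdsWithin ((isOpen_extChartAt_source x).mem_nhds hx)
  refine (h2.congr_of_eventuallyEq_of_mem ?_ ht).congr_deriv ?_
  · filter_upwards [h3] with s hs
    exact congrArg f ((extChartAt (𝓡 n) x).left_inv hs).symm
  · simp only [hamField, map_sum, map_smul, smul_eq_mul]
    refine Finset.sum_congr rfl fun i _ => ?_
    rw [chartCovector_snd_chartRep hx]
    have h4 : (chartCovector x (Λ t)).1 = extChartAt (𝓡 n) x (Λ t).1 := rfl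
    rw [h4, chartRep_apply hx, differential_apply hx (hf.mdifferentiableAt (by simp))]

/-- The Poisson bracket of H with ξ(Y), stated on the manifold. The right side no longer mentions
the chart, which is what allows a change of chart. -/
theorem HamiltonAt.hasDerivWithinAt_field (hΛ : HamiltonAt X x T Λ t)
    (hX : S.IsHorizontalFrame U X) (hU : IsOpen U) (hqU : (Λ t).1 ∈ U)
    (hc : ContinuousWithinAt (fun s => (Λ s).1) (Icc 0 T) t)
    (ht : t ∈ Icc 0 T)
    (hx : (Λ t).1 ∈ (extChartAt (𝓡 n) x).source) {Y : ∀ q : M, TangentSpace (𝓡 n) q}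
    {U' : Set M} (hU' : IsOpen U') (hqU' : (Λ t).1 ∈ U') (hY : SmoothFieldOn Y U') :
    HasDerivWithinAt (fun s => (Λ s).2 (Y (Λ s).1))
      (∑ i, (Λ t).2 (X i (Λ t).1) * (Λ t).2 (mlieBracket (𝓡 n) (X i) Y (Λ t).1)) (Icc 0 T) t := by
  have hy := (extChartAt (𝓡 n) x).map_source hx
  have hW : DifferentiableAt ℝ (chartRep x Y) (extChartAt (𝓡 n) x (Λ t).1) :=
    ((hY.contDiffOn_chartRep hU' x).contDiffAt ((isOpen_chart_inter x hU').mem_nhds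
      ⟨hy, by rw [mem_preimage, (extChartAt (𝓡 n) x).left_inv hx]; exact hqU'⟩)).differentiableAt
        (by simp)
  have hz : HasDerivWithinAt (fun s => ((chartCovector x (Λ s)).1, (chartCovector x (Λ s)).2))
      ((1 : ℝ) • hamField (fun i => chartRep x (X i))
        ((chartCovector x (Λ t)).1, (chartCovector x (Λ t)).2)) (Icc 0 T) t := by
    rw [one_smul]; exact hΛ
  have h2 := hasDerivWithinAt_pairing hz hW
  have h3 : ∀ᶠ s in 𝓝[Icc 0 T] t, (Λ s).1 ∈ (extChartAt (𝓡 n) x).source :=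
    hc.preimage_mem_nhdsWithin ((isOpen_extChartAt_source x).mem_nhds hx)
  refine (h2.congr_of_eventuallyEq_of_mem ?_ ht).congr_deriv ?_
  · filter_upwards [h3] with s hs
    exact (chartCovector_snd_chartRep hs Y).symm
  · rw [one_mul]
    refine Finset.sum_congr rfl fun i _ => ?_
    rw [chartCovector_snd_chartRep hx]
    have h4 : (chartCovector x (Λ t)).1 = extChartAt (𝓡 n) x (Λ t).1 := rfl
    rw [h4, ← chartDeriv_mlieBracket (hU.inter hU') ((hX.smooth i).mono inter_subset_left)
      (hY.mono inter_subset_right) ⟨hqU, hqU'⟩ hx, chartCovector_snd_chartDeriv hx]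

/-- The definition of a Hamiltonian curve uses the chart at the moving point Λ t, whereas ODE theory
needs one fixed chart. The coordinates of the new chart are functions on M and its momenta are
pairings with its coordinate fields. The intrinsic derivative formulas for both, obtained in the old
chart, are Hamilton's equations in the new one. -/
theorem HamiltonAt.change_chart (hΛ : HamiltonAt X x T Λ t)
    (hX : S.IsHorizontalFrame U X) (hU : IsOpen U) (hqU : (Λ t).1 ∈ U)
    (hc : ContinuousWithinAt (fun s => (Λ s).1) (Icc 0 T) t)
    (ht : t ∈ Icc 0 T) (hx : (Λ t).1 ∈ (extChartAt (𝓡 n) x).source) {x' : M}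
    (hx' : (Λ t).1 ∈ (extChartAt (𝓡 n) x').source) : HamiltonAt X x' T Λ t := by
  have hh : ∀ i, (chartCovector x' (Λ t)).2 (chartRep x' (X i) (chartCovector x' (Λ t)).1) =
      (Λ t).2 (X i (Λ t).1) := fun i => chartCovector_snd_chartRep hx' (X i)
  have h4 : (chartCovector x' (Λ t)).1 = extChartAt (𝓡 n) x' (Λ t).1 := rfl
  refine HasDerivWithinAt.prodMk (hasDerivWithinAt_model_iff.1 fun η => ?_)
    (hasDerivWithinAt_dual_iff.1 fun w => ?_)
  · have hf : ContMDiffAt (𝓡 n) 𝓘(ℝ, ℝ) ∞ (fun q => η (extChartAt (𝓡 n) x' q)) (Λ t).1 :=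
      η.contMDiff.contMDiffAt.comp _ (contMDiffAt_extChartAt'' hx')
    refine (hΛ.hasDerivWithinAt_fun hc ht hx hf).congr_deriv ?_
    simp only [map_sum, map_smul, smul_eq_mul]
    simp only [hh]
    refine Finset.sum_congr rfl fun i _ => ?_
    rw [differential_apply hx' (hf.mdifferentiableAt (by simp)), h4, chartRep_apply hx']
    have h5 : (fun q => η (extChartAt (𝓡 n) x' q)) ∘ (extChartAt (𝓡 n) x').symm
        =ᶠ[𝓝 (extChartAt (𝓡 n) x' (Λ t).1)] η := by
      filter_upwards [(isOpen_extChartAt_target x').mem_nhds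
        ((extChartAt (𝓡 n) x').map_source hx')] with y hy
      exact congrArg η ((extChartAt (𝓡 n) x').right_inv hy)
    rw [h5.fderiv_eq, η.fderiv]
  · have h6 := hΛ.hasDerivWithinAt_field hX hU hqU hc ht hx (isOpen_extChartAt_source x') hx'
      (smoothFieldOn_chartField x' w)
    refine h6.congr_deriv ?_
    simp only [sum_apply, smul_apply, neg_apply,
      ContinuousLinearMap.comp_apply, smul_eq_mul, ← Finset.sum_neg_distrib]
    simp only [hh]
    refine Finset.sum_congr rfl fun i _ => ?_
    rw [← mul_neg]
    congr 1
    rw [← chartCovector_snd_chartDeriv hx' (mlieBracket (𝓡 n) (X i) (chartField x' w) (Λ t).1),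
      chartDeriv_mlieBracket (hU.inter (isOpen_extChartAt_source x'))
        ((hX.smooth i).mono inter_subset_left)
        ((smoothFieldOn_chartField x' w).mono inter_subset_right) ⟨hqU, hx'⟩ hx',
      ← map_neg]
    congr 1
    -- A coordinate field is constant in its own chart, so its bracket with X_i reduces to -DX_i(w),
    -- the term of the momentum equation.
    have h7 : chartRep x' (chartField x' w) =ᶠ[𝓝 (extChartAt (𝓡 n) x' (Λ t).1)] fun _ => w := by
      filter_upwards [(isOpen_extChartAt_target x').mem_nhds
        ((extChartAt (𝓡 n) x').map_source hx')] with y hy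
      exact chartRep_chartField w hy
    rw [lieBracket, h7.fderiv_eq, h7.eq_of_nhds, fderiv_const_apply, h4]
    simp

end Derivatives

end Frame

end Structure

end SubRiem

namespace SubRiem

/-! ### Derivatives along fields, conservation of energy and confinement of geodesics. -/

section FieldDeriv

variable {n : ℕ} {M : Type*} [TopologicalSpace M] [ChartedSpace (EuclideanSpace ℝ (Fin n)) M]
    [IsManifold (𝓡 n) ∞ M]

/-- The derivative `X f` of a function along a vector field. -/
def fieldDeriv (X : ∀ q : M, TangentSpace (𝓡 n) q) (f : M → ℝ) (q : M) : ℝ :=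
  differential n f q (X q)

theorem SmoothFunOn.contMDiffAt {f : M → ℝ} {U : Set M} (hf : SmoothFunOn n f U) (hU : IsOpen U)
    {q : M} (hq : q ∈ U) : ContMDiffAt (𝓡 n) 𝓘(ℝ, ℝ) ∞ f q :=
  ContMDiffOn.contMDiffAt hf (hU.mem_nhds hq)

theorem SmoothFunOn.mdifferentiableAt {f : M → ℝ} {U : Set M} (hf : SmoothFunOn n f U)
    (hU : IsOpen U) {q : M} (hq : q ∈ U) : MDifferentiableAt (𝓡 n) 𝓘(ℝ, ℝ) f q :=
  (hf.contMDiffAt hU hq).mdifferentiableAt (by simp)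

theorem SmoothFunOn.mono {f : M → ℝ} {U U' : Set M} (hf : SmoothFunOn n f U) (h : U' ⊆ U) :
    SmoothFunOn n f U' := ContMDiffOn.mono hf h

theorem SmoothFieldOn.mono {X : ∀ q : M, TangentSpace (𝓡 n) q} {U U' : Set M}
    (hX : SmoothFieldOn X U) (h : U' ⊆ U) : SmoothFieldOn X U' := ContMDiffOn.mono hX h

theorem SmoothFun.smoothFunOn {f : M → ℝ} (hf : SmoothFun n f) (U : Set M) : SmoothFunOn n f U :=
  ContMDiff.contMDiffOn hf

theorem mem_chart_inter {x q : M} {U : Set M} (hq : q ∈ (extChartAt (𝓡 n) x).source)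
    (hqU : q ∈ U) : extChartAt (𝓡 n) x q ∈
      (extChartAt (𝓡 n) x).target ∩ (extChartAt (𝓡 n) x).symm ⁻¹' U :=
  ⟨(extChartAt (𝓡 n) x).map_source hq, by
    rw [mem_preimage, (extChartAt (𝓡 n) x).left_inv hq]; exact hqU⟩

theorem fieldDeriv_comp_symm {X : ∀ q : M, TangentSpace (𝓡 n) q} {f : M → ℝ} {U : Set M}
    (hU : IsOpen U) (hf : SmoothFunOn n f U) {x : M} {y : Model n}
    (hy : y ∈ (extChartAt (𝓡 n) x).target ∩ (extChartAt (𝓡 n) x).symm ⁻¹' U) :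
    fieldDeriv X f ((extChartAt (𝓡 n) x).symm y) =
      fderiv ℝ (f ∘ (extChartAt (𝓡 n) x).symm) y (chartRep x X y) := by
  rw [fieldDeriv, differential_apply ((extChartAt (𝓡 n) x).map_target hy.1)
    (hf.mdifferentiableAt hU hy.2), (extChartAt (𝓡 n) x).right_inv hy.1]
  rfl

theorem SmoothFunOn.of_charts {f : M → ℝ} {U : Set M} (hU : IsOpen U)
    (h : ∀ x ∈ U, ContDiffOn ℝ ∞ (f ∘ (extChartAt (𝓡 n) x).symm)
      ((extChartAt (𝓡 n) x).target ∩ (extChartAt (𝓡 n) x).symm ⁻¹' U)) : SmoothFunOn n f U := by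
  intro q hq
  have := smoothFunOn_of_chart (h q hq)
  exact (this.contMDiffAt ((isOpen_extChartAt_source q).inter hU)
    ⟨mem_extChartAt_source q, hq⟩).contMDiffWithinAt

theorem SmoothFieldOn.of_charts {X : ∀ q : M, TangentSpace (𝓡 n) q} {U : Set M} (hU : IsOpen U)
    (h : ∀ x ∈ U, ContDiffOn ℝ ∞ (chartRep x X)
      ((extChartAt (𝓡 n) x).target ∩ (extChartAt (𝓡 n) x).symm ⁻¹' U)) : SmoothFieldOn X U := by
  intro q hq
  have := smoothFieldOn_of_chartRep hU (h q hq)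
  exact (ContMDiffOn.contMDiffAt this (((isOpen_extChartAt_source q).inter hU).mem_nhds
    ⟨mem_extChartAt_source q, hq⟩)).contMDiffWithinAt

theorem SmoothFieldOn.smooth_fieldDeriv {X : ∀ q : M, TangentSpace (𝓡 n) q} {f : M → ℝ} {U : Set M}
    (hX : SmoothFieldOn X U) (hU : IsOpen U) (hf : SmoothFunOn n f U) :
    SmoothFunOn n (fieldDeriv X f) U := by
  refine SmoothFunOn.of_charts hU fun x _ => ?_
  have h1 := hf.contDiffOn_chart x
  have h2 := hX.contDiffOn_chartRep hU x
  have h3 := (h1.fderiv_of_isOpen (isOpen_chart_inter x hU) (m := ∞) le_rfl).clm_apply h2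
  exact h3.congr fun y hy => fieldDeriv_comp_symm hU hf hy

theorem SmoothFieldOn.mlieBracketField {X Y : ∀ q : M, TangentSpace (𝓡 n) q} {U : Set M}
    (hX : SmoothFieldOn X U) (hY : SmoothFieldOn Y U) (hU : IsOpen U) :
    SmoothFieldOn (mlieBracket (𝓡 n) X Y) U := by
  refine SmoothFieldOn.of_charts hU fun x _ => ?_
  have hO := isOpen_chart_inter (n := n) x hU
  have h1 := hX.contDiffOn_chartRep hU x
  have h2 := hY.contDiffOn_chartRep hU x
  have h3 := ((h2.fderiv_of_isOpen hO (m := ∞) le_rfl).clm_apply h1).sub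
    ((h1.fderiv_of_isOpen hO (m := ∞) le_rfl).clm_apply h2)
  refine h3.congr fun y hy => ?_
  have h4 := chartDeriv_mlieBracket hU hX hY hy.2 ((extChartAt (𝓡 n) x).map_target hy.1)
  rw [(extChartAt (𝓡 n) x).right_inv hy.1] at h4
  exact h4

end FieldDeriv

namespace Structure

variable {n k : ℕ} {M : Type*} [TopologicalSpace M] [ChartedSpace (EuclideanSpace ℝ (Fin n)) M]
    [IsManifold (𝓡 n) ∞ M] {S : Structure n k M}

theorem IsHamiltonianCurve.hamiltonAt {T : ℝ} {Λ : ℝ → Σ q : M, Cotangent n q}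
    (hΛ : S.IsHamiltonianCurve T Λ) {U : Set M} (hU : IsOpen U)
    {X : Fin k → ∀ q : M, TangentSpace (𝓡 n) q} (hX : S.IsHorizontalFrame U X) {t : ℝ}
    (ht : t ∈ Icc 0 T) (hq : (Λ t).1 ∈ U) {x : M}
    (hx : (Λ t).1 ∈ (extChartAt (𝓡 n) x).source) : HamiltonAt X x T Λ t :=
  ((isHamiltonianCurve_iff hX hU hq).1 (hΛ.2 t ht)).change_chart hX hU hq (hΛ.1 t ht) ht
    (mem_extChartAt_source _) hx

/-- Every point has a neighbourhood with a smooth orthonormal frame of `D`. -/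
def HasHorizontalFrames (S : Structure n k M) : Prop :=
  ∀ q : M, ∃ U : Set M, IsOpen U ∧ q ∈ U ∧ ∃ X : Fin k → ∀ q : M, TangentSpace (𝓡 n) q,
    S.IsHorizontalFrame U X

/-- The argument of `energy_const`, now for an arbitrary Hamiltonian curve, which need not stay in
one chart or frame domain: near each time a frame is chosen, and the derivative found is zero. -/
theorem IsHamiltonianCurve.hamiltonian_const (hF : S.HasHorizontalFrames) {T : ℝ}
    {Λ : ℝ → Σ q : M, Cotangent n q} (hΛ : S.IsHamiltonianCurve T Λ) :
    ∀ t ∈ Icc 0 T, S.hamiltonian (Λ t).1 (Λ t).2 = S.hamiltonian (Λ 0).1 (Λ 0).2 := by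
  have hd : ∀ t ∈ Icc 0 T,
      HasDerivWithinAt (fun s => S.hamiltonian (Λ s).1 (Λ s).2) 0 (Icc 0 T) t := by
    intro t ht
    obtain ⟨U, hU, hq, X, hX⟩ := hF (Λ t).1
    have hH := hΛ.hamiltonAt hU hX ht hq (mem_extChartAt_source _)
    have h := (HasDerivWithinAt.fun_sum (u := Finset.univ) fun i (_ : i ∈ Finset.univ) =>
      (hH.hasDerivWithinAt_field hX hU hq (hΛ.1 t ht) ht (mem_extChartAt_source _) hU hq
        (hX.smooth i)).pow 2).const_mul (1 / 2 : ℝ)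
    have h3 : ∀ᶠ s in 𝓝[Icc 0 T] t, (Λ s).1 ∈ U :=
      (hΛ.1 t ht).preimage_mem_nhdsWithin (hU.mem_nhds hq)
    refine (h.congr_of_eventuallyEq_of_mem ?_ ht).congr_deriv ?_
    · filter_upwards [h3] with s hs
      exact hX.hamiltonian_eq hs _
    · set a : Fin k → ℝ := fun i => (Λ t).2 (X i (Λ t).1) with ha
      set c : Fin k → Fin k → ℝ := fun j i => (Λ t).2 (mlieBracket (𝓡 n) (X j) (X i) (Λ t).1)
        with hc
      have hcc : ∀ i j, c j i = -c i j := fun i j => by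
        simp only [hc]
        rw [mlieBracket_swap_apply]
        exact map_neg _ _
      have h2 : ∑ i, ∑ j, a i * (a j * c j i) = -∑ i, ∑ j, a i * (a j * c j i) := by
        conv_lhs => rw [Finset.sum_comm]
        simp only [← Finset.sum_neg_distrib]
        refine Finset.sum_congr rfl fun i _ => Finset.sum_congr rfl fun j _ => ?_
        rw [hcc j i]
        ring
      have h4 : ∑ i, ∑ j, a i * (a j * c j i) = 0 := by linarith
      rw [← h4, Finset.mul_sum]
      refine Finset.sum_congr rfl fun i _ => ?_
      rw [← Finset.mul_sum]
      norm_num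
      ring
  intro t ht
  refine constant_of_has_deriv_right_zero (fun s hs => (hd s hs).continuousWithinAt)
    (fun s hs => ?_) t ht
  exact (hd s (Ico_subset_Icc_self hs)).mono_of_mem_nhdsWithin (Icc_mem_nhdsGE_of_mem hs)

theorem IsHorizontalFrame.abs_le_one {U : Set M} {X : Fin k → ∀ q : M, TangentSpace (𝓡 n) q}
    (hX : S.IsHorizontalFrame U X) {q : M} (hq : q ∈ U) {ξ : Cotangent n q}
    (hξ : S.hamiltonian q ξ = 1 / 2) (i : Fin k) : |ξ (X i q)| ≤ 1 := by
  rw [hX.hamiltonian_eq hq] at hξ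
  exact abs_le_one_of_sum_sq (by linarith) i

variable [T2Space M]

/-- Normal geodesics of unit speed remain near their initial point for a uniform time. -/
theorem exists_time_confined (hF : S.HasHorizontalFrames) {q : M} {W : Set M} (hW : W ∈ 𝓝 q) :
    ∃ t₀ > 0, ∀ T ≤ t₀, ∀ Λ : ℝ → Σ q : M, Cotangent n q, S.IsHamiltonianCurve T Λ →
      (Λ 0).1 = q → S.hamiltonian (Λ 0).1 (Λ 0).2 = 1 / 2 → ∀ t ∈ Icc 0 T, (Λ t).1 ∈ W := by
  obtain ⟨U, hU, hq, X, hX⟩ := hF q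
  -- A bump function supported in W and in the frame domain is followed along the curve. As long as
  -- it stays positive, the curve cannot have left W.
  obtain ⟨ρ, -, hρ⟩ := (SmoothBumpFunction.nhds_basis_tsupport (I := 𝓡 n) q).mem_iff.1
    (inter_mem hW (hU.mem_nhds hq))
  have hρs : SmoothFun n (ρ : M → ℝ) := ρ.contMDiff
  have hb : ∀ i, ∃ C, ∀ p ∈ tsupport ρ, ‖fieldDeriv (X i) ρ p‖ ≤ C := fun i =>
    ρ.hasCompactSupport.isCompact.exists_bound_of_continuousOn
      (((hX.smooth i).smooth_fieldDeriv hU (hρs.smoothFunOn U)).continuousOn.mono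
        fun p hp => (hρ hp).2)
  choose C hC using hb
  have hC0 : 0 ≤ ∑ i, |C i| := Finset.sum_nonneg fun i _ => abs_nonneg _
  -- By unit speed, the derivative of ρ along the curve is at most ∑ |C i|. Within this time ρ drops
  -- by at most 1/2 from its value 1 at q.
  refine ⟨1 / (2 * (∑ i, |C i| + 1)), by positivity, fun T hT Λ hΛ h0 hH t ht => ?_⟩
  have hd : ∀ s ∈ Icc 0 T, ∃ v, HasDerivWithinAt (fun s => ρ (Λ s).1) v (Icc 0 T) s ∧
      ‖v‖ ≤ ∑ i, |C i| := by
    intro s hs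
    by_cases hsu : (Λ s).1 ∈ tsupport ρ
    · have hsU := (hρ hsu).2
      refine ⟨_, (hΛ.hamiltonAt hU hX hs hsU (mem_extChartAt_source _)).hasDerivWithinAt_fun
        (hΛ.1 s hs) hs (mem_extChartAt_source _) (hρs _), ?_⟩
      refine (norm_sum_le _ _).trans (Finset.sum_le_sum fun i _ => ?_)
      rw [norm_mul, Real.norm_eq_abs]
      have h1 := hX.abs_le_one hsU (ξ := (Λ s).2) (by rw [hΛ.hamiltonian_const hF s hs, hH]) i
      have h2 := (hC i _ hsu).trans (le_abs_self _)
      change ‖differential n ρ (Λ s).1 (X i (Λ s).1)‖ ≤ _ at h2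
      calc _ ≤ 1 * ‖differential n ρ (Λ s).1 (X i (Λ s).1)‖ := by gcongr
        _ ≤ _ := by rwa [one_mul]
    -- Outside the closed support, ρ vanishes along the curve near time s by continuity. No frame is
    -- needed there, so the curve may wander anywhere.
    · refine ⟨0, (hasDerivWithinAt_const s _ (0 : ℝ)).congr_of_eventuallyEq_of_mem ?_ hs,
        by simpa using hC0⟩
      filter_upwards [(hΛ.1 s hs).preimage_mem_nhdsWithin
        ((isClosed_tsupport ρ).isOpen_compl.mem_nhds hsu)] with r hr
      exact image_eq_zero_of_notMem_tsupport hr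
  choose! v hv hv' using hd
  have h1 := norm_image_sub_le_of_norm_deriv_le_segment' (C := ∑ i, |C i|) hv
    (fun s hs => hv' s (Ico_subset_Icc_self hs)) t ht
  have h2 : ρ (Λ 0).1 = 1 := by rw [h0]; exact ρ.eq_one
  have h3 : (∑ i, |C i|) * t ≤ 1 / 2 := by
    have : t ≤ 1 / (2 * (∑ i, |C i| + 1)) := ht.2.trans hT
    rw [le_div_iff₀ (by positivity)] at this
    nlinarith [ht.1]
  rw [h2, sub_zero, Real.norm_eq_abs] at h1
  have h4 : ρ (Λ t).1 ≠ 0 := fun h => by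
    rw [h] at h1
    norm_num at h1
    linarith
  exact (hρ (subset_tsupport _ h4)).1

end Structure

end SubRiem

namespace SubRiem

/-! ### Short normal geodesics: existence, uniqueness and continuous dependence. -/

theorem hamField_congr {E : Type*} [NormedAddCommGroup E] [NormedSpace ℝ E] {ι : Type*}
    [Fintype ι] {X X' : ι → E → E} {s : Set E} (hs : IsOpen s) (h : ∀ i, EqOn (X i) (X' i) s)
    {z : E × (E →L[ℝ] ℝ)} (hz : z.1 ∈ s) : hamField X z = hamField X' z := by
  have h1 : ∀ i, X i z.1 = X' i z.1 := fun i => h i hz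
  have h2 : ∀ i, fderiv ℝ (X i) z.1 = fderiv ℝ (X' i) z.1 := fun i =>
    ((h i).eventuallyEq_of_mem (hs.mem_nhds hz)).fderiv_eq
  simp only [hamField, h1, h2]

theorem exists_uniform_bound {E : Type*} [NormedAddCommGroup E] [NormedSpace ℝ E] {ι : Type*}
    [Fintype ι] {X : ι → E → E} (hX : ∀ i, ContDiff ℝ ∞ (X i))
    (hc : ∀ i, HasCompactSupport (X i)) :
    ∃ B, 0 ≤ B ∧ (∀ i y, ‖X i y‖ ≤ B) ∧ ∀ i y, ‖fderiv ℝ (X i) y‖ ≤ B := by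
  choose C hC using fun i => (hc i).exists_bound_of_continuous (hX i).continuous
  choose C' hC' using fun i => ((hc i).fderiv (𝕜 := ℝ)).exists_bound_of_continuous
    ((hX i).continuous_fderiv (by simp))
  have h0 : ∀ i, 0 ≤ |C i| + |C' i| := fun i => by positivity
  have h1 : ∀ i, |C i| + |C' i| ≤ ∑ i, (|C i| + |C' i|) := fun i =>
    Finset.single_le_sum (f := fun i => |C i| + |C' i|) (fun j _ => h0 j) (Finset.mem_univ i)
  refine ⟨∑ i, (|C i| + |C' i|), Finset.sum_nonneg fun i _ => h0 i, fun i y => ?_, fun i y => ?_⟩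
  · linarith [hC i y, h1 i, le_abs_self (C i), abs_nonneg (C' i)]
  · linarith [hC' i y, h1 i, le_abs_self (C' i), abs_nonneg (C i)]

namespace Structure

variable {n k : ℕ} {M : Type*} [TopologicalSpace M] [ChartedSpace (EuclideanSpace ℝ (Fin n)) M]
    [IsManifold (𝓡 n) ∞ M] {S : Structure n k M}

/-- The covector with canonical coordinates `z` in the chart at `x`. -/
def ofChartCovector (x : M) (z : Model n × (Model n →L[ℝ] ℝ)) : Σ q : M, Cotangent n q :=
  ⟨(extChartAt (𝓡 n) x).symm z.1, z.2.comp (chartDeriv x ((extChartAt (𝓡 n) x).symm z.1))⟩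

theorem chartCovector_ofChartCovector {x : M} {z : Model n × (Model n →L[ℝ] ℝ)}
    (hz : z.1 ∈ (extChartAt (𝓡 n) x).target) : chartCovector x (ofChartCovector x z) = z := by
  refine Prod.ext ((extChartAt (𝓡 n) x).right_inv hz) ?_
  refine ContinuousLinearMap.ext fun w => ?_
  exact congrArg z.2 (chartDeriv_apply_inverse ((extChartAt (𝓡 n) x).map_target hz) w)

theorem ofChartCovector_chartCovector {x : M} {ξ : Σ q : M, Cotangent n q}
    (hξ : ξ.1 ∈ (extChartAt (𝓡 n) x).source) : ofChartCovector x (chartCovector x ξ) = ξ := by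
  obtain ⟨q, ξ⟩ := ξ
  have h1 : (extChartAt (𝓡 n) x).symm (extChartAt (𝓡 n) x q) = q :=
    (extChartAt (𝓡 n) x).left_inv hξ
  have h2 : ((ξ : Model n →L[ℝ] ℝ).comp ((chartDeriv x q).inverse : Model n →L[ℝ] Model n)).comp
      (chartDeriv x q) = ξ :=
    ContinuousLinearMap.ext fun w => congrArg ξ (chartDeriv_inverse_apply hξ w)
  refine Sigma.ext h1 (heq_of_eq ?_)
  change ((ξ : Model n →L[ℝ] ℝ).comp ((chartDeriv x q).inverse : Model n →L[ℝ] Model n)).comp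
      (chartDeriv x ((extChartAt (𝓡 n) x).symm (extChartAt (𝓡 n) x q))) = ξ
  rw [h1, h2]

section Curves

variable {U : Set M} {X : Fin k → ∀ q : M, TangentSpace (𝓡 n) q} {x : M} {T : ℝ}

/-- The equations hold in the fixed chart at x by hypothesis. `HamiltonAt.change_chart` carries them
to the chart at each point of the curve, as the definition demands. -/
theorem isHamiltonianCurve_ofChartCovector (hX : S.IsHorizontalFrame U X) (hU : IsOpen U)
    {z : ℝ → Model n × (Model n →L[ℝ] ℝ)}
    (hz : ∀ t ∈ Icc 0 T,
      HasDerivWithinAt z (hamField (fun i => chartRep x (X i)) (z t)) (Icc 0 T) t)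
    (hzO : ∀ t ∈ Icc 0 T,
      (z t).1 ∈ (extChartAt (𝓡 n) x).target ∩ (extChartAt (𝓡 n) x).symm ⁻¹' U) :
    S.IsHamiltonianCurve T (fun t => ofChartCovector x (z t)) := by
  have hc : ContinuousOn (fun s => (ofChartCovector x (z s)).1) (Icc 0 T) :=
    (continuousOn_extChartAt_symm x).comp
      (fun t ht => ((hz t ht).continuousWithinAt).fst) fun t ht => (hzO t ht).1
  refine ⟨hc, fun t ht => ?_⟩
  rw [isHamiltonianCurve_iff hX hU (Λ := fun t => ofChartCovector x (z t)) (hzO t ht).2]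
  have hs := (extChartAt (𝓡 n) x).map_target (hzO t ht).1
  refine HamiltonAt.change_chart (x := x) (Λ := fun t => ofChartCovector x (z t)) ?_ hX hU
    (hzO t ht).2 (hc t ht) ht hs
    (mem_extChartAt_source _)
  unfold HamiltonAt
  rw [chartCovector_ofChartCovector (hzO t ht).1]
  exact (hz t ht).congr_of_mem (fun s hs => chartCovector_ofChartCovector (hzO s hs).1) ht

theorem IsHamiltonianCurve.mono {Λ : ℝ → Σ q : M, Cotangent n q}
    (hΛ : S.IsHamiltonianCurve T Λ) {T' : ℝ} (h : T' ≤ T) : S.IsHamiltonianCurve T' Λ := by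
  have hs : Icc 0 T' ⊆ Icc 0 T := Icc_subset_Icc_right h
  exact ⟨hΛ.1.mono hs, fun t ht => ⟨fun η => ((hΛ.2 t (hs ht)).1 η).mono hs,
    fun w => ((hΛ.2 t (hs ht)).2 w).mono hs⟩⟩

theorem dist_le_of_hamField {E : Type*} [NormedAddCommGroup E] [NormedSpace ℝ E]
    {F : E → E} {K : NNReal} {A : Set E} (hF : LipschitzOnWith K F A) {T : ℝ} {z z' : ℝ → E}
    (hz : ∀ t ∈ Icc 0 T, HasDerivWithinAt z (F (z t)) (Icc 0 T) t)
    (hz' : ∀ t ∈ Icc 0 T, HasDerivWithinAt z' (F (z' t)) (Icc 0 T) t)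
    (hA : ∀ t ∈ Icc 0 T, z t ∈ A) (hA' : ∀ t ∈ Icc 0 T, z' t ∈ A) :
    ∀ t ∈ Icc 0 T, dist (z t) (z' t) ≤ dist (z 0) (z' 0) * Real.exp (K * t) := by
  intro t ht
  have := dist_le_of_trajectories_ODE_of_mem (v := fun _ => F) (s := fun _ => A) (a := 0) (b := T)
    (fun _ _ => hF) (fun s hs => (hz s hs).continuousWithinAt)
    (fun s hs => (hz s (Ico_subset_Icc_self hs)).mono_of_mem_nhdsWithin (Icc_mem_nhdsGE_of_mem hs))
    (fun s hs => hA s (Ico_subset_Icc_self hs)) (fun s hs => (hz' s hs).continuousWithinAt)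
    (fun s hs => (hz' s (Ico_subset_Icc_self hs)).mono_of_mem_nhdsWithin
      (Icc_mem_nhdsGE_of_mem hs))
    (fun s hs => hA' s (Ico_subset_Icc_self hs)) le_rfl t ht
  simpa using this

variable [T2Space M]

set_option maxHeartbeats 1000000 in
/-- The normal geodesics of unit speed from `q` exist, are unique, and depend continuously on the
initial covector, for a uniform time. -/
theorem exists_geodesics (hF : S.HasHorizontalFrames) (hU : IsOpen U)
    (hX : S.IsHorizontalFrame U X) {q : M} (hq : q ∈ U) :
    ∃ t₀ > 0, ∃ K ⊆ (extChartAt (𝓡 n) q).target ∩ (extChartAt (𝓡 n) q).symm ⁻¹' U, IsCompact K ∧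
      ∃ Λ : Cotangent n q → ℝ → Σ q : M, Cotangent n q,
      (∀ ξ : Cotangent n q, S.hamiltonian q ξ = 1 / 2 → Λ ξ 0 = ⟨q, ξ⟩ ∧
        S.IsHamiltonianCurve t₀ (Λ ξ) ∧
        (∀ t ∈ Icc 0 t₀, (Λ ξ t).1 ∈ (extChartAt (𝓡 n) q).source ∧
          (chartCovector q (Λ ξ t)).1 ∈ K ∧
          ‖(chartCovector q (Λ ξ t)).2‖ ≤ 2 * ‖(chartCovector q ⟨q, ξ⟩).2‖) ∧
        ∀ t ∈ Ioc 0 t₀, S.exp q t ξ = (Λ ξ t).1) ∧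
      ∀ t ∈ Icc 0 t₀, ContinuousOn (fun ξ => (Λ ξ t).1) {ξ | S.hamiltonian q ξ = 1 / 2} := by
  classical
  set ψ := extChartAt (𝓡 n) q with hψ
  have hO : IsOpen (ψ.target ∩ ψ.symm ⁻¹' U) := isOpen_chart_inter q hU
  have hy₀ : ψ q ∈ ψ.target ∩ ψ.symm ⁻¹' U := mem_chart_inter (mem_extChartAt_source q) hq
  obtain ⟨r, hr, hrO, hcut⟩ := exists_contDiff_hasCompactSupport_eqOn (F := Model n) hO hy₀
  choose Y hYs hYc hYe using fun i => hcut _ ((hX.smooth i).contDiffOn_chartRep hU q)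
  obtain ⟨B, hB0, hB, hB'⟩ := exists_uniform_bound hYs hYc
  have hYX : ∀ z : Model n × (Model n →L[ℝ] ℝ), z.1 ∈ Metric.ball (ψ q) r →
      hamField Y z = hamField (fun i => chartRep q (X i)) z := fun z hz =>
    hamField_congr Metric.isOpen_ball hYe hz
  have hW : ψ.source ∩ ψ ⁻¹' Metric.ball (ψ q) r ∈ 𝓝 q :=
    inter_mem (extChartAt_source_mem_nhds q)
      ((continuousAt_extChartAt q).preimage_mem_nhds (Metric.ball_mem_nhds _ hr))
  obtain ⟨t₁, ht₁, hconf⟩ := exists_time_confined hF hW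
  set m : ℝ := Fintype.card (Fin k) * B with hm
  have hm0 : 0 ≤ m := by positivity
  have hlog : 0 < Real.log 2 := Real.log_pos (by norm_num)
  -- Three constraints: t₁ confines every Hamiltonian curve, log 2 keeps momenta at most doubled,
  -- and r/2 keeps the base point inside the ball where the cut-off frame is the true one.
  set t₀ : ℝ := min t₁ (min (Real.log 2) (r / 2) / (m + 1)) with ht₀
  have ht₀0 : 0 < t₀ := lt_min ht₁ (by positivity)
  have hmt : m * t₀ ≤ min (Real.log 2) (r / 2) := by
    have h1 : t₀ ≤ min (Real.log 2) (r / 2) / (m + 1) := min_le_right _ _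
    rw [le_div_iff₀ (by positivity)] at h1
    nlinarith
  have hball : ∀ y, ‖y - ψ q‖ ≤ m * t₀ → y ∈ Metric.ball (ψ q) r := fun y hy => by
    rw [mem_ball_iff_norm]
    have := hmt.trans (min_le_right _ _)
    linarith
  have hE : ∀ ξ : Cotangent n q, S.hamiltonian q ξ = 1 / 2 →
      ∑ i, (chartCovector q ⟨q, ξ⟩).2 (Y i (chartCovector q ⟨q, ξ⟩).1) ^ 2 = 1 := by
    intro ξ hξ
    rw [hX.hamiltonian_eq hq] at hξ
    have h1 : ∀ i, (chartCovector q ⟨q, ξ⟩).2 (Y i (chartCovector q ⟨q, ξ⟩).1) = ξ (X i q) := by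
      intro i
      rw [hYe i (show (chartCovector q ⟨q, ξ⟩).1 ∈ Metric.ball (ψ q) r from
        Metric.mem_ball_self hr)]
      exact chartCovector_snd_chartRep (ξ := ⟨q, ξ⟩) (mem_extChartAt_source q) (X i)
    simp only [h1]
    linarith
  have hex : ∀ ξ : Cotangent n q, ∃ z : ℝ → Model n × (Model n →L[ℝ] ℝ),
      S.hamiltonian q ξ = 1 / 2 → z 0 = chartCovector q ⟨q, ξ⟩ ∧
        ∀ t ∈ Icc 0 t₀, HasDerivWithinAt z (hamField Y (z t)) (Icc 0 t₀) t := by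
    intro ξ
    by_cases hξ : S.hamiltonian q ξ = 1 / 2
    · obtain ⟨z, h1, h2⟩ := exists_hamField_integralCurve hYs hYc hB hB' hB0 ht₀0.le
        (hmt.trans (min_le_left _ _)) (chartCovector q ⟨q, ξ⟩).1 (chartCovector q ⟨q, ξ⟩).2
        (hE ξ hξ)
      exact ⟨z, fun _ => ⟨h1, h2⟩⟩
    · exact ⟨fun _ => 0, fun h => absurd h hξ⟩
  choose z hz using hex
  have hbd : ∀ ξ : Cotangent n q, S.hamiltonian q ξ = 1 / 2 → ∀ t ∈ Icc 0 t₀,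
      (z ξ t).1 ∈ Metric.ball (ψ q) r ∧ (z ξ t).1 ∈ Metric.closedBall (ψ q) r ∧
        ‖(z ξ t).2‖ ≤ 2 * ‖(chartCovector q ⟨q, ξ⟩).2‖ := by
    intro ξ hξ t ht
    obtain ⟨h0, h1⟩ := hz ξ hξ
    have h2 := hamField_bounds (fun i => (hYs i).differentiable (by simp)) hB hB' hB0
      (y := fun t => (z ξ t).1) (p := fun t => (z ξ t).2) (e := fun _ => 1)
      (fun _ _ => by norm_num) (fun t ht => by rw [one_smul]; exact h1 t ht)
      (by simp only [h0]; exact hE ξ hξ) t ht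
    have hmt' : m * t ≤ m * t₀ := mul_le_mul_of_nonneg_left ht.2 hm0
    have h3 : (z ξ t).1 ∈ Metric.ball (ψ q) r := by
      refine hball _ (le_trans ?_ hmt')
      have := h2.1
      simp only [h0] at this
      exact this
    refine ⟨h3, Metric.ball_subset_closedBall h3, ?_⟩
    have h4 := h2.2
    simp only [h0] at h4
    have h5 : Real.exp (m * t) ≤ 2 := by
      rw [← Real.exp_log (show (0 : ℝ) < 2 by norm_num)]
      exact Real.exp_le_exp.2 (hmt'.trans (hmt.trans (min_le_left _ _)))
    nlinarith [norm_nonneg (chartCovector q ⟨q, ξ⟩).2]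
  have hzO : ∀ ξ : Cotangent n q, S.hamiltonian q ξ = 1 / 2 → ∀ t ∈ Icc 0 t₀,
      (z ξ t).1 ∈ ψ.target ∩ ψ.symm ⁻¹' U := fun ξ hξ t ht => hrO (hbd ξ hξ t ht).2.1
  have hham : ∀ ξ : Cotangent n q, S.hamiltonian q ξ = 1 / 2 →
      S.IsHamiltonianCurve t₀ (fun t => ofChartCovector q (z ξ t)) := fun ξ hξ =>
    isHamiltonianCurve_ofChartCovector hX hU
      (fun t ht => by rw [← hYX _ (hbd ξ hξ t ht).1]; exact (hz ξ hξ).2 t ht) (hzO ξ hξ)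
  have hlip : ∀ R : ℝ, ∃ L, LipschitzOnWith L (hamField Y)
      (Metric.closedBall (ψ q) r ×ˢ Metric.closedBall 0 R) := fun R =>
    ((contDiff_hamField hYs).of_le (m := 1) (by simp)).locallyLipschitz.locallyLipschitzOn
      |>.exists_lipschitzOnWith_of_compact
        ((isCompact_closedBall _ _).prod (isCompact_closedBall _ _))
  refine ⟨t₀, ht₀0, Metric.closedBall (ψ q) r, hrO, isCompact_closedBall _ _,
    fun ξ t => ofChartCovector q (z ξ t), fun ξ hξ => ⟨?_, hham ξ hξ, fun t ht => ?_, ?_⟩, ?_⟩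
  · simp only [(hz ξ hξ).1]
    exact ofChartCovector_chartCovector (ξ := ⟨q, ξ⟩) (mem_extChartAt_source q)
  · rw [chartCovector_ofChartCovector (hzO ξ hξ t ht).1]
    exact ⟨ψ.map_target (hzO ξ hξ t ht).1, (hbd ξ hξ t ht).2⟩
  · intro t ht
    -- `exp` follows a curve picked by choice, so that curve has to be identified with the
    -- constructed one. Confinement puts it in the ball, where both solve the same ODE, and
    -- Grönwall's inequality makes them equal.
    have hexist : ∃ Λ : ℝ → Σ q : M, Cotangent n q, S.IsHamiltonianCurve t Λ ∧ Λ 0 = ⟨q, ξ⟩ := by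
      refine ⟨_, (hham ξ hξ).mono ht.2, ?_⟩
      simp only [(hz ξ hξ).1]
      exact ofChartCovector_chartCovector (ξ := ⟨q, ξ⟩) (mem_extChartAt_source q)
    rw [exp, dif_pos hexist]
    set Γ := hexist.choose with hΓ
    obtain ⟨hΓ1, hΓ0⟩ := hexist.choose_spec
    rw [← hΓ] at hΓ1 hΓ0
    have hconfΓ := hconf t (ht.2.trans (min_le_left _ _)) Γ hΓ1 (by rw [hΓ0])
      (by rw [hΓ0]; exact hξ)
    have hballΓ : ∀ s ∈ Icc 0 t, (chartCovector q (Γ s)).1 ∈ Metric.ball (ψ q) r := fun s hs => by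
      have h1 := (hconfΓ s hs).2
      rw [mem_preimage] at h1
      exact h1
    have hU' : ∀ s ∈ Icc 0 t, (Γ s).1 ∈ U := fun s hs => by
      have h1 := hrO (Metric.ball_subset_closedBall (hconfΓ s hs).2)
      have h2 := h1.2
      rwa [mem_preimage, ψ.left_inv (hconfΓ s hs).1] at h2
    have hd : ∀ s ∈ Icc 0 t, HasDerivWithinAt (fun s => chartCovector q (Γ s))
        (hamField Y (chartCovector q (Γ s))) (Icc 0 t) s := fun s hs => by
      have h1 : (chartCovector q (Γ s)).1 ∈ Metric.ball (ψ q) r := hballΓ s hs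
      rw [hYX (chartCovector q (Γ s)) h1]
      exact hΓ1.hamiltonAt hU hX hs (hU' s hs) (hconfΓ s hs).1
    have hcp : ContinuousOn (fun s => ‖(chartCovector q (Γ s)).2‖) (Icc 0 t) := fun s hs =>
      (hd s hs).continuousWithinAt.snd.norm
    obtain ⟨R, hR⟩ := isCompact_Icc.exists_bound_of_continuousOn hcp
    -- No a priori bound on the momentum of the chosen curve is available here, but it is bounded on
    -- the compact time interval. The radius covers both curves.
    obtain ⟨L, hL⟩ := hlip (max R (2 * ‖(chartCovector q ⟨q, ξ⟩).2‖))
    have hsub : Icc 0 t ⊆ Icc 0 t₀ := Icc_subset_Icc_right ht.2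
    have h5 := dist_le_of_hamField hL hd (fun s hs => ((hz ξ hξ).2 s (hsub hs)).mono hsub)
      (fun s hs => ⟨Metric.ball_subset_closedBall (hballΓ s hs), by
        rw [mem_closedBall_zero_iff]
        have := hR s hs
        rw [norm_norm] at this
        exact this.trans (le_max_left _ _)⟩)
      (fun s hs => ⟨(hbd ξ hξ s (hsub hs)).2.1, by
        rw [mem_closedBall_zero_iff]
        exact (hbd ξ hξ s (hsub hs)).2.2.trans (le_max_right _ _)⟩) t ⟨ht.1.le, le_rfl⟩
    rw [hΓ0, (hz ξ hξ).1, dist_self, zero_mul] at h5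
    have h6 := dist_le_zero.1 h5
    beta_reduce
    rw [← h6, ofChartCovector_chartCovector (hconfΓ t ⟨ht.1.le, le_rfl⟩).1]
  · intro t ht
    have hcov : Continuous (fun ξ : Cotangent n q => chartCovector q ⟨q, ξ⟩) :=
      (continuous_const (y := ψ q)).prodMk
        ((ContinuousLinearMap.compL ℝ (Model n) (Model n) ℝ).flip
          (chartDeriv q q).inverse).continuous
    have hcz : ContinuousOn (fun ξ => z ξ t) {ξ | S.hamiltonian q ξ = 1 / 2} := by
      intro ξ hξ
      obtain ⟨R, hR⟩ := (isCompact_closedBall ξ 1).exists_bound_of_continuousOn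
        (f := fun ξ : Cotangent n q => ‖(chartCovector q ⟨q, ξ⟩).2‖)
        (continuous_snd.comp hcov).norm.continuousOn
      -- One Lipschitz constant serves all initial covectors in the unit ball about ξ, since their
      -- momenta at most double. Grönwall's inequality then gives continuity at ξ.
      obtain ⟨L, hL⟩ := hlip (2 * R)
      have hmem : ∀ ξ' ∈ Metric.closedBall ξ 1, S.hamiltonian q ξ' = 1 / 2 → ∀ s ∈ Icc 0 t₀,
          z ξ' s ∈ Metric.closedBall (ψ q) r ×ˢ Metric.closedBall (0 : Model n →L[ℝ] ℝ) (2 * R) := by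
        intro ξ' hξ'1 hξ' s hs
        refine ⟨(hbd ξ' hξ' s hs).2.1, ?_⟩
        rw [mem_closedBall_zero_iff]
        have := hR ξ' hξ'1
        rw [norm_norm] at this
        linarith [(hbd ξ' hξ' s hs).2.2]
      have hlim : Tendsto (fun ξ' : Cotangent n q => dist (chartCovector q ⟨q, ξ'⟩)
          (chartCovector q ⟨q, ξ⟩) * Real.exp (L * t))
          (𝓝[{ξ | S.hamiltonian q ξ = 1 / 2}] ξ) (𝓝 0) := by
        have : Continuous (fun ξ' : Cotangent n q => dist (chartCovector q ⟨q, ξ'⟩)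
          (chartCovector q ⟨q, ξ⟩) * Real.exp (L * t)) :=
          (hcov.dist continuous_const).mul continuous_const
        have h := this.tendsto ξ
        rw [dist_self, zero_mul] at h
        exact h.mono_left nhdsWithin_le_nhds
      refine tendsto_iff_dist_tendsto_zero.2 (squeeze_zero' (Eventually.of_forall fun _ =>
        dist_nonneg) ?_ hlim)
      filter_upwards [self_mem_nhdsWithin,
        mem_nhdsWithin_of_mem_nhds (Metric.closedBall_mem_nhds ξ one_pos)] with ξ' hξ' hξ'1
      have h7 := dist_le_of_hamField hL (hz ξ' hξ').2 (hz ξ hξ).2 (hmem ξ' hξ'1 hξ')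
        (hmem ξ (Metric.mem_closedBall_self (by norm_num)) hξ) t ht
      rwa [(hz ξ' hξ').1, (hz ξ hξ).1] at h7
    exact (continuousOn_extChartAt_symm q).comp (continuous_fst.comp_continuousOn hcz)
      fun ξ hξ => (hzO ξ hξ t ht).1

end Curves

end Structure

end SubRiem

namespace SubRiem

/-! ### Moments of the uniform measure on the sphere. -/

section Sphere

variable {k : ℕ}

/-- The action of a linear isometry on the unit sphere. -/
def sphereMap (e : EuclideanSpace ℝ (Fin k) ≃ₗᵢ[ℝ] EuclideanSpace ℝ (Fin k))
    (a : Metric.sphere (0 : EuclideanSpace ℝ (Fin k)) 1) :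
    Metric.sphere (0 : EuclideanSpace ℝ (Fin k)) 1 :=
  ⟨e a.1, by simp⟩

theorem continuous_sphereMap (e : EuclideanSpace ℝ (Fin k) ≃ₗᵢ[ℝ] EuclideanSpace ℝ (Fin k)) :
    Continuous (sphereMap e) :=
  (e.continuous.comp continuous_subtype_val).subtype_mk _

/-- The sphere measure of a set is a multiple of the Lebesgue measure of the cone over it. A linear
isometry carries cones to cones and preserves Lebesgue measure. -/
theorem Structure.map_sphereMap_uniformSphere
    (e : EuclideanSpace ℝ (Fin k) ≃ₗᵢ[ℝ] EuclideanSpace ℝ (Fin k)) :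
    (Structure.uniformSphere k).map (sphereMap e) = Structure.uniformSphere k := by
  rw [uniformSphere, Measure.map_smul]
  congr 1
  refine Measure.ext fun s hs => ?_
  have hm := (continuous_sphereMap e).measurable
  rw [Measure.map_apply hm hs, Measure.toSphere_apply' _ (hm hs), Measure.toSphere_apply' _ hs]
  congr 1
  conv_rhs => rw [← e.measurePreserving.measure_preimage_emb e.toHomeomorph.measurableEmbedding]
  congr 1
  ext v
  simp only [mem_preimage, Set.mem_smul, mem_image]
  constructor
  · rintro ⟨r, hr, _, ⟨a, ha, rfl⟩, h⟩
    exact ⟨r, hr, _, ⟨sphereMap e a, ha, rfl⟩, by rw [← h]; simp [sphereMap]⟩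
  · rintro ⟨r, hr, _, ⟨a, ha, rfl⟩, h⟩
    refine ⟨r, hr, _, ⟨sphereMap e.symm a, ?_, rfl⟩, ?_⟩
    · have : sphereMap e (sphereMap e.symm a) = a := by
        ext1
        simp [sphereMap]
      rwa [this]
    · apply e.injective
      rw [← h]
      simp [sphereMap]

theorem Structure.isProbabilityMeasure_uniformSphere (hk : 1 ≤ k) :
    IsProbabilityMeasure (Structure.uniformSphere k) := by
  have : Nontrivial (EuclideanSpace ℝ (Fin k)) := by
    have : Nonempty (Fin k) := ⟨⟨0, hk⟩⟩
    infer_instance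
  refine ⟨?_⟩
  rw [uniformSphere, Measure.smul_apply, smul_eq_mul]
  refine ENNReal.inv_mul_cancel ?_ (measure_ne_top _ _)
  exact (Measure.measure_univ_ne_zero).2 (Measure.toSphere_ne_zero _)

theorem integral_sphereMap (e : EuclideanSpace ℝ (Fin k) ≃ₗᵢ[ℝ] EuclideanSpace ℝ (Fin k))
    {f : Metric.sphere (0 : EuclideanSpace ℝ (Fin k)) 1 → ℝ} (hf : Continuous f) :
    ∫ a, f (sphereMap e a) ∂Structure.uniformSphere k = ∫ a, f a ∂Structure.uniformSphere k := by
  conv_rhs => rw [← Structure.map_sphereMap_uniformSphere e]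
  rw [integral_map (continuous_sphereMap e).measurable.aemeasurable
    hf.measurable.aestronglyMeasurable]

theorem continuous_sphere_coord (i : Fin k) :
    Continuous (fun a : Metric.sphere (0 : EuclideanSpace ℝ (Fin k)) 1 => a.1 i) :=
  (EuclideanSpace.proj (𝕜 := ℝ) i).continuous.comp continuous_subtype_val

theorem continuous_sphere_coord_mul (i j : Fin k) :
    Continuous (fun a : Metric.sphere (0 : EuclideanSpace ℝ (Fin k)) 1 => a.1 i * a.1 j) :=
  (continuous_sphere_coord i).mul (continuous_sphere_coord j)

theorem exists_reflection (i : Fin k) :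
    ∃ e : EuclideanSpace ℝ (Fin k) ≃ₗᵢ[ℝ] EuclideanSpace ℝ (Fin k),
      ∀ v j, e v j = if j = i then -v j else v j := by
  refine ⟨LinearIsometryEquiv.piLpCongrRight 2 fun j =>
    if j = i then LinearIsometryEquiv.neg ℝ else LinearIsometryEquiv.refl ℝ ℝ, fun v j => ?_⟩
  by_cases h : j = i <;> simp [h]

theorem integral_sphere_coord (i : Fin k) :
    ∫ a : Metric.sphere (0 : EuclideanSpace ℝ (Fin k)) 1, a.1 i ∂Structure.uniformSphere k = 0 := by
  obtain ⟨e, he⟩ := exists_reflection i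
  have h := integral_sphereMap e (continuous_sphere_coord i)
  simp only [sphereMap, he, if_true] at h
  rw [integral_neg] at h
  linarith

theorem integrable_sphere [IsFiniteMeasure (Structure.uniformSphere k)]
    {f : Metric.sphere (0 : EuclideanSpace ℝ (Fin k)) 1 → ℝ} (hf : Continuous f) :
    Integrable f (Structure.uniformSphere k) :=
  hf.integrable_of_hasCompactSupport (HasCompactSupport.of_compactSpace f)

/-- Changing the sign of one coordinate kills the mixed moments. Swapping coordinates makes the
diagonal ones equal, and their sum is the integral of |a|² = 1. -/
theorem integral_sphere_coord_mul (hk : 1 ≤ k) (i j : Fin k) :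
    ∫ a : Metric.sphere (0 : EuclideanSpace ℝ (Fin k)) 1, a.1 i * a.1 j ∂Structure.uniformSphere k =
      if i = j then 1 / (k : ℝ) else 0 := by
  have hp := Structure.isProbabilityMeasure_uniformSphere hk
  split_ifs with hij
  · subst hij
    have h1 : ∀ j, ∫ a : Metric.sphere (0 : EuclideanSpace ℝ (Fin k)) 1, a.1 j * a.1 j
        ∂Structure.uniformSphere k = ∫ a : Metric.sphere (0 : EuclideanSpace ℝ (Fin k)) 1,
          a.1 i * a.1 i ∂Structure.uniformSphere k := by
      intro j
      rw [← integral_sphereMap (LinearIsometryEquiv.piLpCongrLeft 2 ℝ ℝ (Equiv.swap i j))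
        (continuous_sphere_coord_mul i i)]
      simp [sphereMap, LinearIsometryEquiv.piLpCongrLeft_apply, Equiv.piCongrLeft']
    have h2 : ∑ j, ∫ a : Metric.sphere (0 : EuclideanSpace ℝ (Fin k)) 1, a.1 j * a.1 j
        ∂Structure.uniformSphere k = 1 := by
      rw [← integral_finsetSum _ fun j _ =>
        integrable_sphere (continuous_sphere_coord_mul j j)]
      have h3 : ∀ a : Metric.sphere (0 : EuclideanSpace ℝ (Fin k)) 1,
          ∑ j, a.1 j * a.1 j = 1 := by
        intro a
        have h4 : ‖a.1‖ = 1 := by simp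
        have h5 := EuclideanSpace.real_norm_sq_eq a.1
        rw [h4] at h5
        simp only [← sq]
        linarith
      simp [h3]
    rw [Finset.sum_congr rfl fun j _ => h1 j, Finset.sum_const, Finset.card_univ, Fintype.card_fin,
      nsmul_eq_mul] at h2
    have hk' : (k : ℝ) ≠ 0 := by positivity
    rw [eq_div_iff hk']
    linarith
  · obtain ⟨e, he⟩ := exists_reflection i
    have h := integral_sphereMap e
      (continuous_sphere_coord_mul i j)
    simp only [sphereMap, he, if_true, if_neg (Ne.symm hij), neg_mul] at h
    rw [integral_neg] at h
    linarith

end Sphere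

/-! ### Moments of an adapted family of measures. -/

namespace Structure

variable {n k : ℕ} {M : Type*} [TopologicalSpace M] [ChartedSpace (EuclideanSpace ℝ (Fin n)) M]
    [IsManifold (𝓡 n) ∞ M] {S : Structure n k M}

/-- The projection of `T_q M` on `D_q` along `V_q`. -/
def Complement.proj (V : S.Complement) (q : M) : TangentSpace (𝓡 n) q →ₗ[ℝ] S.D q :=
  Submodule.projectionOnto (S.D q) (V.V q) (V.isCompl q)

theorem Complement.proj_of_mem_D (V : S.Complement) {q : M} (v : S.D q) :
    V.proj q (v : TangentSpace (𝓡 n) q) = v :=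
  Submodule.projectionOnto_apply_left _ v

theorem Complement.proj_of_mem_V (V : S.Complement) {q : M} {v : TangentSpace (𝓡 n) q}
    (hv : v ∈ V.V q) : V.proj q v = 0 :=
  (Submodule.projectionOnto_apply_eq_zero_iff _).2 hv

theorem Complement.flat_apply (V : S.Complement) {q : M} (u : S.D q) (v : TangentSpace (𝓡 n) q) :
    V.flat q u v = S.g q u (V.proj q v) := rfl

/-- The parametrization of the unit sphere of `h_q` by the sphere of `ℝ^k`. -/
def Complement.sphereParam (V : S.Complement) (q : M)
    (a : Metric.sphere (0 : EuclideanSpace ℝ (Fin k)) 1) : Cotangent n q :=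
  V.flat q (∑ i, a.1 i • (S.exists_orthonormal q).choose i)

theorem Complement.sphereParam_apply (V : S.Complement) (q : M)
    (a : Metric.sphere (0 : EuclideanSpace ℝ (Fin k)) 1) (v : TangentSpace (𝓡 n) q) :
    V.sphereParam q a v =
      ∑ i, a.1 i * S.g q ((S.exists_orthonormal q).choose i) (V.proj q v) := by
  rw [sphereParam, flat_apply]
  simp [LinearMap.sum_apply]

theorem Complement.continuous_sphereParam (V : S.Complement) (q : M) :
    Continuous (V.sphereParam q) := by
  have h : V.sphereParam q = fun a => ∑ i, a.1 i • V.flat q ((S.exists_orthonormal q).choose i) := by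
    funext a
    refine ContinuousLinearMap.ext fun v => ?_
    refine (V.sphereParam_apply q a v).trans ?_
    simp only [sum_apply, smul_apply, smul_eq_mul]
    rfl
  rw [h]
  exact continuous_finsetSum _ fun i _ => (continuous_sphere_coord i).smul continuous_const

/-- Dominates the norm of a covector by finitely many evaluations, each of which is integrable for
an adapted measure. It supplies the integrable majorant below. -/
theorem norm_dual_le (p : Model n →L[ℝ] ℝ) :
    ‖p‖ ≤ ∑ i, |p (EuclideanSpace.single i 1)| * ‖(EuclideanSpace.proj i : Model n →L[ℝ] ℝ)‖ := by
  conv_lhs => rw [dual_eq_sum p]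
  refine (norm_sum_le _ _).trans (Finset.sum_le_sum fun i _ => ?_)
  rw [norm_smul, Real.norm_eq_abs]

theorem continuous_hamiltonian (q : M) : Continuous (S.hamiltonian q) := by
  obtain ⟨e, he⟩ := S.exists_orthonormal q
  have h : S.hamiltonian q = fun ξ => 1 / 2 * ∑ i, ξ (e i : TangentSpace (𝓡 n) q) ^ 2 :=
    funext fun ξ => hamiltonian_eq_sum he ξ
  rw [h]
  refine continuous_const.mul (continuous_finsetSum _ fun i _ => ?_)
  exact ((ContinuousLinearMap.apply ℝ ℝ (show Model n from (e i).1)).continuous).pow 2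

/-- The first and second moments of an adapted family of measures. -/
theorem Complement.IsAdapted.moments {V : S.Complement} {μ : ∀ q : M, Measure (Cotangent n q)}
    (hμ : V.IsAdapted μ) (hk : 1 ≤ k) (q : M) :
    IsProbabilityMeasure (μ q) ∧ (∀ᵐ ξ ∂μ q, S.hamiltonian q ξ = 1 / 2) ∧
    (∀ w : TangentSpace (𝓡 n) q, Integrable (fun ξ : Cotangent n q => ξ w) (μ q)) ∧
    (∀ v w : TangentSpace (𝓡 n) q, v ∈ S.D q →
      Integrable (fun ξ : Cotangent n q => ξ v * ξ w) (μ q)) ∧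
    (∀ v : TangentSpace (𝓡 n) q, v ∈ S.D q → ∫ ξ, ξ v ∂μ q = 0) ∧
    (∀ (v : S.D q) (w : TangentSpace (𝓡 n) q),
      ∫ ξ, ξ (v : TangentSpace (𝓡 n) q) * ξ w ∂μ q = S.g q v (V.proj q w) / k) := by
  obtain ⟨ν, hν, hν0, hνL, hμν⟩ := hμ.1 q
  have hσ := isProbabilityMeasure_uniformSphere hk
  set u := (S.exists_orthonormal q).choose with hu
  have hu1 := (S.exists_orthonormal q).choose_spec
  rw [← hu] at hu1
  set A := V.sphereParam q with hA
  have hAm : Measurable A := (V.continuous_sphereParam q).measurable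
  have hΦ : Measurable (fun p : Metric.sphere (0 : EuclideanSpace ℝ (Fin k)) 1 × Cotangent n q =>
      A p.1 + p.2) := (hAm.comp measurable_fst).add measurable_snd
  have hμ' : μ q = ((uniformSphere k).prod ν).map (fun p => A p.1 + p.2) := by
    rw [hμν]
    have h1 : V.sphereMeasure q = (uniformSphere k).map A := rfl
    have h2 : ((uniformSphere k).map A).prod ν =
        ((uniformSphere k).prod ν).map (Prod.map A id) := by
      have := Measure.map_prod_map (uniformSphere k) ν hAm measurable_id
      rwa [Measure.map_id] at this
    rw [h1, h2]
    exact Measure.map_map (measurable_fst.add measurable_snd) (hAm.prodMap measurable_id)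
  have hev : ∀ w : Model n, Continuous (fun ξ : Model n →L[ℝ] ℝ => ξ w) := fun w =>
    (ContinuousLinearMap.apply ℝ ℝ w).continuous
  have hAev : ∀ w : Model n, Continuous (fun a => (A a : Model n →L[ℝ] ℝ) w) := fun w =>
    (hev w).comp (V.continuous_sphereParam q)
  have hevm : ∀ v w : Model n, Measurable (fun ξ : Model n →L[ℝ] ℝ => ξ v * ξ w) := fun v w =>
    ((hev v).mul (hev w)).measurable
  have hνi : ∀ w : Model n, Integrable (fun ζ : Model n →L[ℝ] ℝ => ζ w) ν := fun w =>
    (hνL (ContinuousLinearMap.apply ℝ ℝ w)).integrable (by norm_num)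
  have hAi : ∀ v : TangentSpace (𝓡 n) q, ∫ a, A a v ∂uniformSphere k = 0 := by
    intro v
    have h1 : ∀ a, A a v = ∑ i, a.1 i * S.g q (u i) (V.proj q v) := fun a => V.sphereParam_apply q a v
    simp only [h1]
    rw [integral_finsetSum _ fun i _ => (integrable_sphere (continuous_sphere_coord i)).mul_const _]
    simp [integral_mul_const, integral_sphere_coord]
  have hAii : ∀ v w : TangentSpace (𝓡 n) q, ∫ a, A a v * A a w ∂uniformSphere k =
      S.g q (V.proj q v) (V.proj q w) / k := by
    intro v w
    have h1 : ∀ (v : TangentSpace (𝓡 n) q) a,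
        A a v = ∑ i, a.1 i * S.g q (u i) (V.proj q v) := fun v a =>
      V.sphereParam_apply q a v
    have h2 : ∀ a, A a v * A a w = ∑ i, ∑ j, a.1 i * a.1 j *
        (S.g q (u i) (V.proj q v) * S.g q (u j) (V.proj q w)) := by
      intro a
      rw [h1, h1, Finset.sum_mul_sum]
      refine Finset.sum_congr rfl fun i _ => Finset.sum_congr rfl fun j _ => by ring
    have h3 : ∀ i j, Integrable (fun a : Metric.sphere (0 : EuclideanSpace ℝ (Fin k)) 1 =>
        a.1 i * a.1 j * (S.g q (u i) (V.proj q v) * S.g q (u j) (V.proj q w)))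
        (uniformSphere k) := fun i j =>
      (integrable_sphere (continuous_sphere_coord_mul i j)).mul_const _
    simp only [h2]
    rw [integral_finsetSum _ fun i _ => integrable_finsetSum _ fun j _ => h3 i j]
    have h4 : ∀ i, ∫ a : Metric.sphere (0 : EuclideanSpace ℝ (Fin k)) 1, ∑ j, a.1 i * a.1 j *
        (S.g q (u i) (V.proj q v) * S.g q (u j) (V.proj q w)) ∂uniformSphere k =
        1 / (k : ℝ) * (S.g q (u i) (V.proj q v) * S.g q (u i) (V.proj q w)) := by
      intro i
      rw [integral_finsetSum _ fun j _ => h3 i j]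
      simp [integral_mul_const, integral_sphere_coord_mul hk]
    rw [Finset.sum_congr rfl fun i _ => h4 i, ← Finset.mul_sum]
    have h5 : S.g q (V.proj q v) (V.proj q w) =
        ∑ i, S.g q (u i) (V.proj q v) * S.g q (u i) (V.proj q w) := by
      conv_lhs => rw [g_eq_sum hu1 (V.proj q v)]
      simp [LinearMap.sum_apply]
    rw [h5]
    ring
  -- Vertical covectors annihilate the distribution, so pairing with a horizontal vector sees only
  -- the spherical factor.
  have hDz : ∀ v : TangentSpace (𝓡 n) q, v ∈ S.D q →
      ∀ᵐ p ∂(uniformSphere k).prod ν, (A p.1 + p.2) v = A p.1 v := by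
    intro v hv
    have h1 : ∀ᵐ p ∂(uniformSphere k).prod ν, ∀ v ∈ S.D q, p.2 v = 0 :=
      Measure.quasiMeasurePreserving_snd.ae hν0
    filter_upwards [h1] with p hp
    exact (add_apply _ _ _).trans (by rw [hp v hv, add_zero])
  -- With v horizontal no vertical-vertical moment appears. What remains is a spherical second
  -- moment plus a product of independent factors; the factor 1 puts the first summand in product
  -- form for Fubini.
  have hint : ∀ v w : TangentSpace (𝓡 n) q, v ∈ S.D q →
      (fun p : Metric.sphere (0 : EuclideanSpace ℝ (Fin k)) 1 × Cotangent n q =>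
        (A p.1 + p.2) v * (A p.1 + p.2) w) =ᵐ[(uniformSphere k).prod ν]
      fun p => (A p.1 v * A p.1 w) * 1 + A p.1 v * p.2 w := by
    intro v w hv
    filter_upwards [hDz v hv] with p hp
    rw [hp, mul_one, ← mul_add]
    rfl
  have hi1 : ∀ v w : TangentSpace (𝓡 n) q, Integrable
      (fun p : Metric.sphere (0 : EuclideanSpace ℝ (Fin k)) 1 × Cotangent n q =>
        (A p.1 v * A p.1 w) * 1) ((uniformSphere k).prod ν) := fun v w =>
    (integrable_sphere ((hAev v).mul (hAev w))).mul_prod (integrable_const (1 : ℝ))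
  have hi2 : ∀ v w : TangentSpace (𝓡 n) q, Integrable
      (fun p : Metric.sphere (0 : EuclideanSpace ℝ (Fin k)) 1 × Cotangent n q =>
        A p.1 v * p.2 w) ((uniformSphere k).prod ν) := fun v w =>
    (integrable_sphere (hAev v)).mul_prod (hνi w)
  rw [hμ']
  refine ⟨Measure.isProbabilityMeasure_map hΦ.aemeasurable, ?_, fun w => ?_, fun v w hv => ?_,
    fun v hv => ?_, fun v w => ?_⟩
  · rw [ae_map_iff hΦ.aemeasurable
      (measurableSet_eq_fun (continuous_hamiltonian q).measurable measurable_const)]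
    have h1 : ∀ᵐ p ∂(uniformSphere k).prod ν, ∀ v ∈ S.D q, p.2 v = 0 :=
      Measure.quasiMeasurePreserving_snd.ae hν0
    filter_upwards [h1] with p hp
    rw [hamiltonian_eq_sum hu1]
    have h2 : ∀ i, (A p.1 + p.2) (u i : TangentSpace (𝓡 n) q) = p.1.1 i := by
      intro i
      refine (add_apply _ _ _).trans ?_
      rw [hp _ (u i).2, add_zero]
      refine (V.sphereParam_apply q p.1 _).trans ?_
      rw [V.proj_of_mem_D]
      simp only [← hu, hu1]
      simp
    have h4 : ‖p.1.1‖ = 1 := by simp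
    have h5 := EuclideanSpace.real_norm_sq_eq p.1.1
    rw [h4] at h5
    rw [Finset.sum_congr rfl fun i _ => by rw [h2 i], ← h5]
    norm_num
  · rw [integrable_map_measure (hev w).measurable.aestronglyMeasurable hΦ.aemeasurable]
    have h1 := ((integrable_sphere (hAev w)).mul_prod (integrable_const (μ := ν) (1 : ℝ))).add
      ((integrable_const (μ := uniformSphere k) (1 : ℝ)).mul_prod (hνi w))
    refine h1.congr (Eventually.of_forall fun p => ?_)
    simp only [Pi.add_apply, mul_one, one_mul]
    rfl
  · refine (integrable_map_measure (hevm v w).aestronglyMeasurable hΦ.aemeasurable).2 ?_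
    exact ((hi1 v w).add (hi2 v w)).congr (hint v w hv).symm
  · rw [integral_map hΦ.aemeasurable (hev v).measurable.aestronglyMeasurable,
      integral_congr_ae (hDz v hv)]
    have h1 := integral_prod_mul (μ := uniformSphere k) (ν := ν) (fun a => A a v) fun _ => (1 : ℝ)
    simp only [mul_one] at h1
    rw [h1, hAi, zero_mul]
  -- The mixed term factors and vanishes because the spherical first moment is zero, whatever the
  -- mean of the vertical measure.
  · rw [integral_map hΦ.aemeasurable
      (hevm v.1 w).aestronglyMeasurable,
      integral_congr_ae (hint v w v.2), integral_add (hi1 v w) (hi2 v w),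
      integral_prod_mul (fun a => A a v.1 * A a w) fun _ => (1 : ℝ),
      integral_prod_mul (fun a => A a v.1) fun ζ : Cotangent n q => ζ w, hAi, hAii,
      V.proj_of_mem_D]
    simp

end Structure

end SubRiem

namespace SubRiem

/-! ### The second order expansion along geodesics and the microscopic limit. -/

theorem exists_uniform_bound_of_continuousOn {E F : Type*} [TopologicalSpace E]
    [NormedAddCommGroup F] {ι : Type*} [Fintype ι] {f : ι → E → F} {K : Set E} (hK : IsCompact K)
    (hf : ∀ i, ContinuousOn (f i) K) : ∃ C, 0 ≤ C ∧ ∀ i, ∀ y ∈ K, ‖f i y‖ ≤ C := by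
  choose C hC using fun i => hK.exists_bound_of_continuousOn (hf i)
  refine ⟨∑ i, |C i|, Finset.sum_nonneg fun i _ => abs_nonneg _, fun i y hy => ?_⟩
  exact ((hC i y hy).trans (le_abs_self _)).trans
    (Finset.single_le_sum (f := fun i => |C i|) (fun j _ => abs_nonneg _) (Finset.mem_univ i))

/-- The second order Taylor quotient converges to half of the second derivative. -/
theorem tendsto_taylor_two {u v w : ℝ → ℝ} {t₀ : ℝ} (ht₀ : 0 < t₀)
    (hu : ∀ t ∈ Icc 0 t₀, HasDerivWithinAt u (v t) (Icc 0 t₀) t)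
    (hv : ∀ t ∈ Icc 0 t₀, HasDerivWithinAt v (w t) (Icc 0 t₀) t)
    (hw : ContinuousWithinAt w (Icc 0 t₀) 0) :
    Tendsto (fun t => (u t - u 0 - t * v 0) / t ^ 2) (𝓝[>] 0) (𝓝 (w 0 / 2)) := by
  rw [Metric.tendsto_nhds]
  intro ε hε
  have h1 := Metric.continuousWithinAt_iff.1 hw (ε / 2) (by positivity)
  obtain ⟨δ, hδ, h1⟩ := h1
  filter_upwards [Ioo_mem_nhdsGT (lt_min hδ ht₀)] with t ht
  have ht1 : t < δ := ht.2.trans_le (min_le_left _ _)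
  have ht2 : t < t₀ := ht.2.trans_le (min_le_right _ _)
  have hsub : Icc 0 t ⊆ Icc 0 t₀ := Icc_subset_Icc_right ht2.le
  have h2 := abs_taylor_two_le (c := w 0) (ε := ε / 2) (fun s hs => (hu s (hsub hs)).mono hsub)
    (fun s hs => (hv s (hsub hs)).mono hsub) ht.1.le fun s hs => by
      have := h1 (hsub hs) (by
        rw [Real.dist_eq, sub_zero, abs_of_nonneg hs.1]; exact hs.2.trans_lt ht1)
      rw [Real.dist_eq] at this
      exact this.le
  have ht3 : 0 < t ^ 2 := pow_pos ht.1 2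
  rw [Real.dist_eq]
  have h3 : (u t - u 0 - t * v 0) / t ^ 2 - w 0 / 2 =
      (u t - u 0 - t * v 0 - t ^ 2 / 2 * w 0) / t ^ 2 := by
    have ht0 : t ≠ 0 := ht.1.ne'
    rw [sub_div (u t - u 0 - t * v 0)]
    field_simp
  rw [h3, abs_div, abs_of_pos ht3]
  have h4 : |u t - u 0 - t * v 0 - t ^ 2 / 2 * w 0| / t ^ 2 ≤ ε / 2 := by
    rw [div_le_iff₀ ht3]
    exact h2
  linarith

namespace Structure

variable {n k : ℕ} {M : Type*} [TopologicalSpace M] [ChartedSpace (EuclideanSpace ℝ (Fin n)) M]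
    [IsManifold (𝓡 n) ∞ M] {S : Structure n k M}

/-- The expression of the microscopic Laplacian in a horizontal orthonormal frame. -/
def Complement.microOp (V : S.Complement) (X : Fin k → ∀ q : M, TangentSpace (𝓡 n) q) (f : M → ℝ)
    (q : M) : ℝ :=
  ∑ i, fieldDeriv (X i) (fieldDeriv (X i) f) q +
    ∑ i, (∑ j, S.g q (V.proj q (X j q)) (V.proj q (mlieBracket (𝓡 n) (X j) (X i) q))) *
      fieldDeriv (X i) f q

variable {U : Set M} {X : Fin k → ∀ q : M, TangentSpace (𝓡 n) q}

/-- The second derivative of `f` along a normal geodesic, at the covector `ξ ∈ T_q^* M`. -/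
def secondDeriv (X : Fin k → ∀ q : M, TangentSpace (𝓡 n) q) (f : M → ℝ)
    (ξ : Σ q : M, Cotangent n q) : ℝ :=
  ∑ i, ((∑ j, ξ.2 (X j ξ.1) * ξ.2 (mlieBracket (𝓡 n) (X j) (X i) ξ.1)) * fieldDeriv (X i) f ξ.1 +
    ξ.2 (X i ξ.1) * ∑ j, ξ.2 (X j ξ.1) * fieldDeriv (X j) (fieldDeriv (X i) f) ξ.1)

section Curve

variable {T : ℝ} {Λ : ℝ → Σ q : M, Cotangent n q} {f : M → ℝ}

theorem IsHamiltonianCurve.hasDerivWithinAt_fun (hΛ : S.IsHamiltonianCurve T Λ) (hU : IsOpen U)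
    (hX : S.IsHorizontalFrame U X) (hf : SmoothFunOn n f U) {t : ℝ} (ht : t ∈ Icc 0 T)
    (hq : (Λ t).1 ∈ U) :
    HasDerivWithinAt (fun s => f (Λ s).1)
      (∑ i, (Λ t).2 (X i (Λ t).1) * fieldDeriv (X i) f (Λ t).1) (Icc 0 T) t :=
  (hΛ.hamiltonAt hU hX ht hq (mem_extChartAt_source _)).hasDerivWithinAt_fun (hΛ.1 t ht) ht
    (mem_extChartAt_source _) (hf.contMDiffAt hU hq)

theorem IsHamiltonianCurve.hasDerivWithinAt_field (hΛ : S.IsHamiltonianCurve T Λ) (hU : IsOpen U)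
    (hX : S.IsHorizontalFrame U X) {Y : ∀ q : M, TangentSpace (𝓡 n) q} (hY : SmoothFieldOn Y U)
    {t : ℝ} (ht : t ∈ Icc 0 T) (hq : (Λ t).1 ∈ U) :
    HasDerivWithinAt (fun s => (Λ s).2 (Y (Λ s).1))
      (∑ i, (Λ t).2 (X i (Λ t).1) * (Λ t).2 (mlieBracket (𝓡 n) (X i) Y (Λ t).1)) (Icc 0 T) t :=
  (hΛ.hamiltonAt hU hX ht hq (mem_extChartAt_source _)).hasDerivWithinAt_field hX hU hq
    (hΛ.1 t ht) ht (mem_extChartAt_source _) hU hq hY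

theorem IsHamiltonianCurve.hasDerivWithinAt_deriv (hΛ : S.IsHamiltonianCurve T Λ) (hU : IsOpen U)
    (hX : S.IsHorizontalFrame U X) (hf : SmoothFunOn n f U) {t : ℝ} (ht : t ∈ Icc 0 T)
    (hq : (Λ t).1 ∈ U) :
    HasDerivWithinAt (fun s => ∑ i, (Λ s).2 (X i (Λ s).1) * fieldDeriv (X i) f (Λ s).1)
      (secondDeriv X f (Λ t)) (Icc 0 T) t :=
  HasDerivWithinAt.fun_sum fun i _ => (hΛ.hasDerivWithinAt_field hU hX (hX.smooth i) ht hq).mul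
    (hΛ.hasDerivWithinAt_fun hU hX ((hX.smooth i).smooth_fieldDeriv hU hf) ht hq)

theorem IsHamiltonianCurve.continuousWithinAt_secondDeriv (hΛ : S.IsHamiltonianCurve T Λ)
    (hU : IsOpen U) (hX : S.IsHorizontalFrame U X) (hf : SmoothFunOn n f U) {t : ℝ}
    (ht : t ∈ Icc 0 T) (hq : (Λ t).1 ∈ U) :
    ContinuousWithinAt (fun s => secondDeriv X f (Λ s)) (Icc 0 T) t := by
  have h1 : ∀ {Y : ∀ q : M, TangentSpace (𝓡 n) q}, SmoothFieldOn Y U →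
      ContinuousWithinAt (fun s => (Λ s).2 (Y (Λ s).1)) (Icc 0 T) t := fun hY =>
    (hΛ.hasDerivWithinAt_field hU hX hY ht hq).continuousWithinAt
  have h2 : ∀ {g : M → ℝ}, SmoothFunOn n g U →
      ContinuousWithinAt (fun s => g (Λ s).1) (Icc 0 T) t := fun hg =>
    (hΛ.hasDerivWithinAt_fun hU hX hg ht hq).continuousWithinAt
  have h3 : ∀ i, SmoothFunOn n (fieldDeriv (X i) f) U := fun i =>
    (hX.smooth i).smooth_fieldDeriv hU hf
  refine tendsto_finsetSum _ fun i _ => Tendsto.add (Tendsto.mul ?_ (h2 (h3 i)))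
    (Tendsto.mul (h1 (hX.smooth i)) ?_)
  · exact tendsto_finsetSum _ fun j _ => (h1 (hX.smooth j)).mul
      (h1 ((hX.smooth j).mlieBracketField (hX.smooth i) hU))
  · exact tendsto_finsetSum _ fun j _ => (h1 (hX.smooth j)).mul
      (h2 ((hX.smooth j).smooth_fieldDeriv hU (h3 i)))

/-- The second derivative is quadratic in ξ, but every product contains a factor ξ(X_j) bounded by 1
on the energy level. Only the pairing with a bracket is unbounded, so the growth is linear in the
momentum and a first moment suffices to dominate it. -/
theorem IsHorizontalFrame.exists_bound_secondDeriv (hX : S.IsHorizontalFrame U X) (hU : IsOpen U)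
    (hf : SmoothFunOn n f U) {x : M} {K : Set (Model n)}
    (hK : K ⊆ (extChartAt (𝓡 n) x).target ∩ (extChartAt (𝓡 n) x).symm ⁻¹' U) (hKc : IsCompact K) :
    ∃ C, 0 ≤ C ∧ ∀ ξ : Σ q : M, Cotangent n q, ξ.1 ∈ (extChartAt (𝓡 n) x).source →
      (chartCovector x ξ).1 ∈ K → S.hamiltonian ξ.1 ξ.2 = 1 / 2 →
      |secondDeriv X f ξ| ≤ C * (1 + ‖(chartCovector x ξ).2‖) := by
  have h3 : ∀ i, SmoothFunOn n (fieldDeriv (X i) f) U := fun i =>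
    (hX.smooth i).smooth_fieldDeriv hU hf
  obtain ⟨C₁, hC₁, h1⟩ := exists_uniform_bound_of_continuousOn hKc fun i =>
    ((h3 i).contDiffOn_chart x).continuousOn.mono hK
  obtain ⟨C₂, hC₂, h2⟩ := exists_uniform_bound_of_continuousOn hKc fun i : Fin k × Fin k =>
    ((((hX.smooth i.1).smooth_fieldDeriv hU (h3 i.2))).contDiffOn_chart x).continuousOn.mono hK
  obtain ⟨C₃, hC₃, h3⟩ := exists_uniform_bound_of_continuousOn hKc fun i : Fin k × Fin k =>
    ((((hX.smooth i.1).mlieBracketField (hX.smooth i.2) hU)).contDiffOn_chartRep hU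
      x).continuousOn.mono hK
  refine ⟨k * (k * C₃ * C₁ + k * C₂), by positivity, fun ξ hs hξK hH => ?_⟩
  have hqq : (extChartAt (𝓡 n) x).symm (chartCovector x ξ).1 = ξ.1 :=
    (extChartAt (𝓡 n) x).left_inv hs
  have hqU : ξ.1 ∈ U := by
    have := (hK hξK).2
    rwa [mem_preimage, hqq] at this
  have ha : ∀ i, |ξ.2 (X i ξ.1)| ≤ 1 := fun i => hX.abs_le_one hqU hH i
  have hb1 : ∀ i, |fieldDeriv (X i) f ξ.1| ≤ C₁ := fun i => by
    have := h1 i _ hξK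
    rwa [Function.comp_apply, hqq] at this
  have hb2 : ∀ j i, |fieldDeriv (X j) (fieldDeriv (X i) f) ξ.1| ≤ C₂ := fun j i => by
    have := h2 (j, i) _ hξK
    rwa [Function.comp_apply, hqq] at this
  set P := ‖(chartCovector x ξ).2‖ with hP
  have hb3 : ∀ j i, |ξ.2 (mlieBracket (𝓡 n) (X j) (X i) ξ.1)| ≤ P * C₃ := fun j i => by
    rw [← chartCovector_snd_chartRep hs]
    refine ((chartCovector x ξ).2.le_opNorm _).trans ?_
    exact mul_le_mul_of_nonneg_left (h3 (j, i) _ hξK) (norm_nonneg _)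
  have hP0 : 0 ≤ P := norm_nonneg _
  have hk : ∀ (a : Fin k → ℝ) (b : ℝ), (∀ i, |a i| ≤ b) → |∑ i, a i| ≤ k * b := fun a b h => by
    refine (Finset.abs_sum_le_sum_abs _ _).trans ((Finset.sum_le_sum fun i _ => h i).trans ?_)
    simp
  have h4 : ∀ i, |(∑ j, ξ.2 (X j ξ.1) * ξ.2 (mlieBracket (𝓡 n) (X j) (X i) ξ.1)) *
      fieldDeriv (X i) f ξ.1 +
      ξ.2 (X i ξ.1) * ∑ j, ξ.2 (X j ξ.1) * fieldDeriv (X j) (fieldDeriv (X i) f) ξ.1| ≤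
      k * (P * C₃) * C₁ + k * C₂ := by
    intro i
    refine (abs_add_le _ _).trans (add_le_add ?_ ?_)
    · rw [abs_mul]
      refine mul_le_mul (hk _ _ fun j => ?_) (hb1 i) (abs_nonneg _) (by positivity)
      rw [abs_mul]
      calc _ ≤ 1 * (P * C₃) := mul_le_mul (ha j) (hb3 j i) (abs_nonneg _) zero_le_one
        _ = _ := one_mul _
    · rw [abs_mul]
      calc _ ≤ 1 * (k * C₂) := by
            refine mul_le_mul (ha i) (hk _ _ fun j => ?_) (abs_nonneg _) zero_le_one
            rw [abs_mul]
            calc _ ≤ 1 * C₂ := mul_le_mul (ha j) (hb2 j i) (abs_nonneg _) zero_le_one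
              _ = _ := one_mul _
        _ = _ := one_mul _
  refine (hk _ _ h4).trans ?_
  have h5 : 0 ≤ (k : ℝ) * (k * C₃ * C₁) := by positivity
  have h6 : 0 ≤ (k : ℝ) * (k * C₂) * P := by positivity
  nlinarith

end Curve

variable [T2Space M]

/-- Expand f along each geodesic to second order. The linear term integrates to zero exactly, for
every t; the Taylor quotient of the rest converges pointwise and is dominated, and the second
moments evaluate the limit. -/
theorem tendsto_microQuotient {V : S.Complement} {μ : ∀ q : M, Measure (Cotangent n q)}
    (hμ : V.IsAdapted μ) (hk : 1 ≤ k) (hF : S.HasHorizontalFrames) (hU : IsOpen U)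
    (hX : S.IsHorizontalFrame U X) {q : M} (hq : q ∈ U) {f : M → ℝ} (hf : SmoothFunOn n f U) :
    Tendsto (S.microQuotient μ f q) (𝓝[>] 0) (𝓝 (V.microOp X f q)) := by
  obtain ⟨hprob, hae, hint1, hint2, hmom1, hmom2⟩ := hμ.moments hk q
  obtain ⟨t₀, ht₀, K, hK, hKc, Λ, hΛ, hΛc⟩ := exists_geodesics hF hU hX hq
  obtain ⟨C, hC, hCb⟩ := hX.exists_bound_secondDeriv hU hf hK hKc
  have hmemU : ∀ ξ : Cotangent n q, S.hamiltonian q ξ = 1 / 2 → ∀ t ∈ Icc 0 t₀,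
      (Λ ξ t).1 ∈ U := by
    intro ξ hξ t ht
    obtain ⟨h1, h2, -⟩ := (hΛ ξ hξ).2.2.1 t ht
    have h3 := (hK h2).2
    rwa [mem_preimage, show (extChartAt (𝓡 n) q).symm (chartCovector q (Λ ξ t)).1 = (Λ ξ t).1
      from (extChartAt (𝓡 n) q).left_inv h1] at h3
  set v₀ : Cotangent n q → ℝ := fun ξ => ∑ i, ξ (X i q) * fieldDeriv (X i) f q with hv₀
  have hv₀i : Integrable v₀ (μ q) := integrable_finsetSum _ fun i _ => (hint1 _).mul_const _
  have hv₀0 : ∫ ξ, v₀ ξ ∂μ q = 0 := by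
    rw [hv₀, integral_finsetSum _ fun i _ => (hint1 _).mul_const _]
    refine Finset.sum_eq_zero fun i _ => ?_
    rw [integral_mul_const, hmom1 _ (hX.mem_D i q hq), zero_mul]
  set R : ℝ → Cotangent n q → ℝ := fun t ξ => (f (S.exp q t ξ) - f q - t * v₀ ξ) / t ^ 2 with hR
  set N : Cotangent n q → ℝ := fun ξ =>
    ∑ i, |ξ (chartField q (EuclideanSpace.single i 1) q)| *
      ‖(EuclideanSpace.proj i : Model n →L[ℝ] ℝ)‖ with hN
  have hNi : Integrable N (μ q) := integrable_finsetSum _ fun i _ => (hint1 _).abs.mul_const _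
  have hpN : ∀ ξ : Cotangent n q, ‖(chartCovector q ⟨q, ξ⟩).2‖ ≤ N ξ := fun ξ => norm_dual_le _
  -- The factor 2 is the allowed doubling of the momentum along the geodesic.
  set bd : Cotangent n q → ℝ := fun ξ => C * (1 + 2 * N ξ) with hbd
  have hbdi : Integrable bd (μ q) :=
    ((integrable_const 1).add (hNi.const_mul 2)).const_mul C
  -- Taylor expansion along a geodesic
  have hderiv : ∀ ξ : Cotangent n q, S.hamiltonian q ξ = 1 / 2 → ∀ t ∈ Icc 0 t₀,
      HasDerivWithinAt (fun s => f (Λ ξ s).1)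
        (∑ i, (Λ ξ t).2 (X i (Λ ξ t).1) * fieldDeriv (X i) f (Λ ξ t).1) (Icc 0 t₀) t :=
    fun ξ hξ t ht => (hΛ ξ hξ).2.1.hasDerivWithinAt_fun hU hX hf ht (hmemU ξ hξ t ht)
  have hderiv' : ∀ ξ : Cotangent n q, S.hamiltonian q ξ = 1 / 2 → ∀ t ∈ Icc 0 t₀,
      HasDerivWithinAt (fun s => ∑ i, (Λ ξ s).2 (X i (Λ ξ s).1) * fieldDeriv (X i) f (Λ ξ s).1)
        (secondDeriv X f (Λ ξ t)) (Icc 0 t₀) t :=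
    fun ξ hξ t ht => (hΛ ξ hξ).2.1.hasDerivWithinAt_deriv hU hX hf ht (hmemU ξ hξ t ht)
  have hwbd : ∀ ξ : Cotangent n q, S.hamiltonian q ξ = 1 / 2 → ∀ t ∈ Icc 0 t₀,
      |secondDeriv X f (Λ ξ t)| ≤ bd ξ := by
    intro ξ hξ t ht
    obtain ⟨h1, h2, h3⟩ := (hΛ ξ hξ).2.2.1 t ht
    refine (hCb (Λ ξ t) h1 h2 ?_).trans ?_
    · rw [(hΛ ξ hξ).2.1.hamiltonian_const hF t ht, (hΛ ξ hξ).1]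
      exact hξ
    · refine mul_le_mul_of_nonneg_left ?_ hC
      linarith [hpN ξ]
  have hRbd : ∀ ξ : Cotangent n q, S.hamiltonian q ξ = 1 / 2 → ∀ t ∈ Ioc 0 t₀,
      ‖R t ξ‖ ≤ bd ξ := by
    intro ξ hξ t ht
    have hsub : Icc 0 t ⊆ Icc 0 t₀ := Icc_subset_Icc_right ht.2
    have h1 := abs_taylor_two_le (c := 0) (ε := bd ξ)
      (fun s hs => (hderiv ξ hξ s (hsub hs)).mono hsub)
      (fun s hs => (hderiv' ξ hξ s (hsub hs)).mono hsub) ht.1.le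
      (fun s hs => by rw [sub_zero]; exact hwbd ξ hξ s (hsub hs))
    rw [(hΛ ξ hξ).1, mul_zero, sub_zero, ← (hΛ ξ hξ).2.2.2 t ht] at h1
    have ht3 : 0 < t ^ 2 := pow_pos ht.1 2
    rw [hR, Real.norm_eq_abs, abs_div, abs_of_pos ht3, div_le_iff₀ ht3]
    exact h1
  have hRlim : ∀ ξ : Cotangent n q, S.hamiltonian q ξ = 1 / 2 →
      Tendsto (fun t => R t ξ) (𝓝[>] 0) (𝓝 (secondDeriv X f ⟨q, ξ⟩ / 2)) := by
    intro ξ hξ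
    have h0 : (0 : ℝ) ∈ Icc 0 t₀ := ⟨le_rfl, ht₀.le⟩
    have h1 := tendsto_taylor_two ht₀ (hderiv ξ hξ) (hderiv' ξ hξ)
      ((hΛ ξ hξ).2.1.continuousWithinAt_secondDeriv hU hX hf h0 (hmemU ξ hξ 0 h0))
    rw [(hΛ ξ hξ).1] at h1
    refine h1.congr' ?_
    filter_upwards [Ioc_mem_nhdsGT ht₀] with t ht
    simp only [hR, (hΛ ξ hξ).2.2.2 t ht]
    rfl
  have hms : MeasurableSet {ξ : Cotangent n q | S.hamiltonian q ξ = 1 / 2} :=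
    measurableSet_eq_fun (continuous_hamiltonian q).measurable measurable_const
  -- Nothing is known about `exp` off the level 2H = 1. Continuity on that closed set of full
  -- measure is enough.
  have hRm : ∀ t ∈ Ioc 0 t₀, AEStronglyMeasurable (R t) (μ q) := by
    intro t ht
    have h1 : ContinuousOn (fun ξ => f (Λ ξ t).1) {ξ | S.hamiltonian q ξ = 1 / 2} :=
      (hf.continuousOn).comp (hΛc t ⟨ht.1.le, ht.2⟩) fun ξ hξ => hmemU ξ hξ t ⟨ht.1.le, ht.2⟩
    have h2 := h1.aestronglyMeasurable (μ := μ q) hms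
    have hae' : ∀ᵐ ξ ∂μ q, ξ ∈ {ξ : Cotangent n q | S.hamiltonian q ξ = 1 / 2} := hae
    rw [Measure.restrict_eq_self_of_ae_mem hae'] at h2
    have h3 : AEStronglyMeasurable (fun ξ => f (S.exp q t ξ)) (μ q) := by
      refine h2.congr ?_
      filter_upwards [hae] with ξ hξ
      rw [(hΛ ξ hξ).2.2.2 t ht]
    exact ((h3.sub aestronglyMeasurable_const).sub (hv₀i.1.const_mul t)).mul_const _
  have hRi : ∀ t ∈ Ioc 0 t₀, Integrable (R t) (μ q) := fun t ht =>
    hbdi.mono' (hRm t ht) (by filter_upwards [hae] with ξ hξ using hRbd ξ hξ t ht)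
  have hlim : Tendsto (fun t => ∫ ξ, R t ξ ∂μ q) (𝓝[>] 0)
      (𝓝 (∫ ξ, secondDeriv X f ⟨q, ξ⟩ / 2 ∂μ q)) := by
    refine tendsto_integral_filter_of_dominated_convergence bd ?_ ?_ hbdi ?_
    · filter_upwards [Ioc_mem_nhdsGT ht₀] with t ht using hRm t ht
    · filter_upwards [Ioc_mem_nhdsGT ht₀] with t ht
      filter_upwards [hae] with ξ hξ using hRbd ξ hξ t ht
    · filter_upwards [hae] with ξ hξ using hRlim ξ hξ
  -- The constant 2k cancels the ½ of Taylor's formula and the 1/k of the sphere moments.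
  -- Orthonormality keeps only the diagonal second derivatives X_i X_i f.
  have hval : 2 * (k : ℝ) * ∫ ξ, secondDeriv X f ⟨q, ξ⟩ / 2 ∂μ q = V.microOp X f q := by
    have hk0 : (k : ℝ) ≠ 0 := by positivity
    have hD : ∀ i, X i q ∈ S.D q := fun i => hX.mem_D i q hq
    have hp : ∀ i, V.proj q (X i q) = ⟨X i q, hD i⟩ := fun i => V.proj_of_mem_D ⟨X i q, hD i⟩
    have hm : ∀ i (w : TangentSpace (𝓡 n) q), ∫ ξ : Cotangent n q, ξ (X i q) * ξ w ∂μ q =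
        S.g q (V.proj q (X i q)) (V.proj q w) / k := by
      intro i w
      rw [hp]
      exact hmom2 ⟨X i q, hD i⟩ w
    have hi : ∀ i j, Integrable (fun ξ : Cotangent n q =>
        ξ (X j q) * ξ (mlieBracket (𝓡 n) (X j) (X i) q)) (μ q) := fun i j => hint2 _ _ (hD j)
    have hi' : ∀ i j, Integrable (fun ξ : Cotangent n q =>
        ξ (X i q) * ξ (X j q)) (μ q) := fun i j => hint2 _ _ (hD i)
    have hsd : ∀ ξ : Cotangent n q, secondDeriv X f ⟨q, ξ⟩ / 2 =
        ∑ i, ∑ j, ((ξ (X j q) * ξ (mlieBracket (𝓡 n) (X j) (X i) q)) *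
          (fieldDeriv (X i) f q / 2) +
          (ξ (X i q) * ξ (X j q)) * (fieldDeriv (X j) (fieldDeriv (X i) f) q / 2)) := by
      intro ξ
      simp only [secondDeriv, Finset.sum_div]
      refine Finset.sum_congr rfl fun i _ => ?_
      rw [Finset.sum_mul, Finset.mul_sum, ← Finset.sum_add_distrib, Finset.sum_div]
      refine Finset.sum_congr rfl fun j _ => ?_
      ring
    simp only [hsd]
    have hij : ∀ i j, Integrable (fun ξ : Cotangent n q =>
        (ξ (X j q) * ξ (mlieBracket (𝓡 n) (X j) (X i) q)) * (fieldDeriv (X i) f q / 2) +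
          (ξ (X i q) * ξ (X j q)) * (fieldDeriv (X j) (fieldDeriv (X i) f) q / 2)) (μ q) :=
      fun i j => ((hi i j).mul_const _).add ((hi' i j).mul_const _)
    rw [integral_finsetSum _ fun i _ => integrable_finsetSum _ fun j _ => hij i j]
    have h1 : ∀ i, ∫ ξ, ∑ j, ((ξ (X j q) * ξ (mlieBracket (𝓡 n) (X j) (X i) q)) *
          (fieldDeriv (X i) f q / 2) +
          (ξ (X i q) * ξ (X j q)) * (fieldDeriv (X j) (fieldDeriv (X i) f) q / 2)) ∂μ q =
        1 / (2 * k) * ((∑ j, S.g q (V.proj q (X j q))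
          (V.proj q (mlieBracket (𝓡 n) (X j) (X i) q))) * fieldDeriv (X i) f q +
          fieldDeriv (X i) (fieldDeriv (X i) f) q) := by
      intro i
      rw [integral_finsetSum _ fun j _ => hij i j]
      have h2 : ∀ j, ∫ ξ, ((ξ (X j q) * ξ (mlieBracket (𝓡 n) (X j) (X i) q)) *
          (fieldDeriv (X i) f q / 2) +
          (ξ (X i q) * ξ (X j q)) * (fieldDeriv (X j) (fieldDeriv (X i) f) q / 2)) ∂μ q =
          1 / (2 * k) * (S.g q (V.proj q (X j q))
            (V.proj q (mlieBracket (𝓡 n) (X j) (X i) q)) * fieldDeriv (X i) f q +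
          if i = j then fieldDeriv (X j) (fieldDeriv (X i) f) q else 0) := by
        intro j
        rw [integral_add ((hi i j).mul_const _) ((hi' i j).mul_const _), integral_mul_const,
          integral_mul_const, hm, hm, hp i, hp j, hX.orthonormal q hq i j]
        split_ifs
        · field_simp
        · field_simp
          ring
      rw [Finset.sum_congr rfl fun j _ => h2 j, ← Finset.mul_sum, Finset.sum_add_distrib,
        Finset.sum_mul]
      simp
    rw [Finset.sum_congr rfl fun i _ => h1 i, ← Finset.mul_sum, Finset.sum_add_distrib,
      Complement.microOp]
    field_simp
    ring
  rw [← hval]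
  refine (hlim.const_mul (2 * (k : ℝ))).congr' ?_
  filter_upwards [Ioc_mem_nhdsGT ht₀] with t ht
  have ht0 : t ≠ 0 := ht.1.ne'
  have h1 : ∫ ξ, (f (S.exp q t ξ) - f q) ∂μ q = t ^ 2 * ∫ ξ, R t ξ ∂μ q := by
    have h2 : ∀ ξ, f (S.exp q t ξ) - f q = t ^ 2 * R t ξ + t * v₀ ξ := fun ξ => by
      simp only [hR]
      field_simp
      ring
    simp only [h2]
    rw [integral_add ((hRi t ht).const_mul _) (hv₀i.const_mul _), integral_const_mul,
      integral_const_mul, hv₀0, mul_zero, add_zero]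
  rw [microQuotient, h1]
  field_simp

end Structure

end SubRiem

namespace SubRiem

/-! ### Smooth orthonormal frames and adapted frames. -/

section Sections

variable {n : ℕ} {M : Type*} [TopologicalSpace M] [ChartedSpace (EuclideanSpace ℝ (Fin n)) M]
    [IsManifold (𝓡 n) ∞ M] {U : Set M}

theorem SmoothFieldOn.smul {X : ∀ q : M, TangentSpace (𝓡 n) q} {f : M → ℝ}
    (hf : SmoothFunOn n f U) (hX : SmoothFieldOn X U) : SmoothFieldOn (fun q => f q • X q) U :=
  ContMDiffOn.smul_section hf hX

theorem SmoothFieldOn.sub {X Y : ∀ q : M, TangentSpace (𝓡 n) q}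
    (hX : SmoothFieldOn X U) (hY : SmoothFieldOn Y U) : SmoothFieldOn (fun q => X q - Y q) U :=
  ContMDiffOn.sub_section hX hY

theorem SmoothFieldOn.sum {ι : Type*} {s : Finset ι} {X : ι → ∀ q : M, TangentSpace (𝓡 n) q}
    (hX : ∀ i ∈ s, SmoothFieldOn (X i) U) : SmoothFieldOn (fun q => ∑ i ∈ s, X i q) U :=
  ContMDiffOn.sum_section hX

theorem SmoothFieldOn.congr {X Y : ∀ q : M, TangentSpace (𝓡 n) q} (hX : SmoothFieldOn X U)
    (h : ∀ q ∈ U, Y q = X q) : SmoothFieldOn Y U :=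
  ContMDiffOn.congr hX fun q hq => by rw [h q hq]

theorem SmoothFunOn.comp_contDiffOn {f : M → ℝ} (hf : SmoothFunOn n f U) {φ : ℝ → ℝ} {s : Set ℝ}
    (hφ : ContDiffOn ℝ ∞ φ s) (h : ∀ q ∈ U, f q ∈ s) : SmoothFunOn n (fun q => φ (f q)) U :=
  (contMDiffOn_iff_contDiffOn.2 hφ).comp (ContMDiffOn.of_le hf le_rfl) h

end Sections

namespace Structure

variable {n k : ℕ} {M : Type*} [TopologicalSpace M] [ChartedSpace (EuclideanSpace ℝ (Fin n)) M]
    [IsManifold (𝓡 n) ∞ M] {S : Structure n k M}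

/-- The section `X` of `D` is smooth on `U`. -/
def SmoothSectionOn (X : ∀ q : M, S.D q) (U : Set M) : Prop :=
  SmoothFieldOn (fun q => (X q : TangentSpace (𝓡 n) q)) U

/-- Gram–Schmidt over U: every coefficient is built from values of g, and the norm to be inverted is
positive, so smoothness is preserved. Indexing by ℕ lets each induction step just overwrite the
value at m. The span clause serves only to show that the next vector is nonzero. -/
theorem exists_gramSchmidt {U : Set M} (hU : IsOpen U) (X : ℕ → ∀ q : M, S.D q)
    (hX : ∀ i < k, SmoothSectionOn (X i) U)
    (hli : ∀ q ∈ U, LinearIndependent ℝ fun i : Fin k => X i q) :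
    ∀ m ≤ k, ∃ Y : ℕ → ∀ q : M, S.D q, (∀ i < m, SmoothSectionOn (Y i) U) ∧
      (∀ q ∈ U, ∀ i < m, ∀ j < m, S.g q (Y i q) (Y j q) = if i = j then 1 else 0) ∧
      ∀ q ∈ U, ∀ i < m, Y i q ∈ Submodule.span ℝ ((fun j : ℕ => X j q) '' Iio m) := by
  intro m
  induction m with
  | zero => exact fun _ => ⟨X, by simp, by simp, by simp⟩
  | succ m ih =>
    intro hm
    obtain ⟨Y, hY1, hY2, hY3⟩ := ih (by omega)
    set Z : ∀ q : M, S.D q := fun q =>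
      X m q - ∑ i ∈ Finset.range m, S.g q (X m q) (Y i q) • Y i q with hZ
    have hZs : SmoothSectionOn Z U := by
      have h1 : SmoothFieldOn (fun q => (X m q : TangentSpace (𝓡 n) q) -
          ∑ i ∈ Finset.range m, S.g q (X m q) (Y i q) • (Y i q : TangentSpace (𝓡 n) q)) U := by
        refine SmoothFieldOn.sub (hX m (by omega)) (SmoothFieldOn.sum fun i hi => ?_)
        have hi := Finset.mem_range.1 hi
        exact SmoothFieldOn.smul (S.smooth_g U hU _ _ (hX m (by omega)) (hY1 i hi)) (hY1 i hi)
      refine h1.congr fun q _ => ?_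
      simp [hZ]
    have hZg : ∀ q ∈ U, ∀ i < m, S.g q (Z q) (Y i q) = 0 := by
      intro q hq i hi
      simp only [hZ, map_sub, map_sum, map_smul, LinearMap.sub_apply, LinearMap.sum_apply,
        LinearMap.smul_apply, smul_eq_mul]
      rw [Finset.sum_eq_single i]
      · rw [hY2 q hq i hi i hi]
        simp
      · intro j hj hji
        rw [hY2 q hq j (Finset.mem_range.1 hj) i hi, if_neg hji, mul_zero]
      · intro h
        exact absurd (Finset.mem_range.2 hi) h
    -- If the residual vanished, X_m would lie in the span of the earlier fields, against linear
    -- independence.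
    have hZ0 : ∀ q ∈ U, Z q ≠ 0 := by
      intro q hq h0
      have h1 : X m q ∈ Submodule.span ℝ ((fun j : ℕ => X j q) '' Iio m) := by
        rw [sub_eq_zero.1 h0]
        exact Submodule.sum_mem _ fun i hi =>
          Submodule.smul_mem _ _ (hY3 q hq i (Finset.mem_range.1 hi))
      have h2 := (hli q hq).notMem_span_image (s := {i : Fin k | (i : ℕ) < m}) (x := ⟨m, by omega⟩)
        (by simp)
      refine h2 ?_
      refine Submodule.span_mono ?_ h1
      rintro _ ⟨j, hj, rfl⟩
      exact ⟨⟨j, lt_of_lt_of_le hj (by omega)⟩, hj, rfl⟩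
    have hpos : ∀ q ∈ U, 0 < S.g q (Z q) (Z q) := fun q hq => S.pos_g q _ (hZ0 q hq)
    have hr : SmoothFunOn n (fun q => (Real.sqrt (S.g q (Z q) (Z q)))⁻¹) U := by
      have h1 : SmoothFunOn n (fun q => S.g q (Z q) (Z q)) U := S.smooth_g U hU _ _ hZs hZs
      refine h1.comp_contDiffOn (φ := fun r => (Real.sqrt r)⁻¹) (s := Ioi 0) ?_ hpos
      intro r hr
      have hr : (0 : ℝ) < r := hr
      exact ((Real.contDiffAt_sqrt hr.ne').inv (Real.sqrt_pos.2 hr).ne').contDiffWithinAt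
    set W : ∀ q : M, S.D q := fun q => (Real.sqrt (S.g q (Z q) (Z q)))⁻¹ • Z q with hW
    have hWs : SmoothSectionOn W U := by
      have h1 : SmoothFieldOn (fun q => (Real.sqrt (S.g q (Z q) (Z q)))⁻¹ •
        (Z q : TangentSpace (𝓡 n) q)) U := SmoothFieldOn.smul hr hZs
      exact h1
    have hWY : ∀ q ∈ U, ∀ i < m, S.g q (W q) (Y i q) = 0 := fun q hq i hi => by
      simp [hW, hZg q hq i hi]
    have hWW : ∀ q ∈ U, S.g q (W q) (W q) = 1 := fun q hq => by
      have h1 := hpos q hq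
      have h2 := Real.mul_self_sqrt h1.le
      have h3 := (Real.sqrt_pos.2 h1).ne'
      simp only [hW, map_smul, LinearMap.smul_apply, smul_eq_mul]
      field_simp
      nlinarith
    have hWm : ∀ q ∈ U, W q ∈ Submodule.span ℝ ((fun j : ℕ => X j q) '' Iio (m + 1)) := by
      intro q hq
      refine Submodule.smul_mem _ _ (Submodule.sub_mem _ ?_ (Submodule.sum_mem _ fun i hi => ?_))
      · exact Submodule.subset_span ⟨m, by simp, rfl⟩
      · refine Submodule.smul_mem _ _ (Submodule.span_mono ?_
          (hY3 q hq i (Finset.mem_range.1 hi)))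
        exact image_mono (Iio_subset_Iio (by omega))
    refine ⟨Function.update Y m W, fun i hi => ?_, fun q hq i hi j hj => ?_, fun q hq i hi => ?_⟩
    · rcases Nat.lt_succ_iff_lt_or_eq.1 hi with h | rfl
      · rw [Function.update_of_ne h.ne]
        exact hY1 i h
      · rw [Function.update_self]
        exact hWs
    · rcases Nat.lt_succ_iff_lt_or_eq.1 hi with h | rfl <;>
        rcases Nat.lt_succ_iff_lt_or_eq.1 hj with h' | rfl
      · rw [Function.update_of_ne h.ne, Function.update_of_ne h'.ne]
        exact hY2 q hq i h j h'
      · rw [Function.update_of_ne h.ne, Function.update_self, S.symm_g, hWY q hq i h, if_neg h.ne]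
      · rw [Function.update_of_ne h'.ne, Function.update_self, hWY q hq j h', if_neg h'.ne']
      · rw [Function.update_self, hWW q hq, if_pos rfl]
    · rcases Nat.lt_succ_iff_lt_or_eq.1 hi with h | rfl
      · rw [Function.update_of_ne h.ne]
        exact Submodule.span_mono (image_mono (Iio_subset_Iio (by omega))) (hY3 q hq i h)
      · rw [Function.update_self]
        exact hWm q hq

open Classical in
theorem hasHorizontalFrames (S : Structure n k M) : S.HasHorizontalFrames := by
  intro q₀
  obtain ⟨U, hU, hq₀, X, hXs, hX⟩ := S.smooth_D q₀
  have hXD : ∀ q ∈ U, ∀ i, X i q ∈ S.D q := fun q hq i => by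
    rw [← (hX q hq).2]
    exact Submodule.subset_span ⟨i, rfl⟩
  -- Extension by zero off U, where the X_i need not lie in the distribution, so that these are
  -- everywhere defined sections of it.
  set X' : ℕ → ∀ q : M, S.D q := fun i q =>
    if h : i < k ∧ q ∈ U then ⟨X ⟨i, h.1⟩ q, hXD q h.2 _⟩ else 0 with hX'
  have hX'e : ∀ q ∈ U, ∀ i : Fin k, (X' i q : TangentSpace (𝓡 n) q) = X i q := fun q hq i => by
    simp [hX', hq]
  obtain ⟨Y, hY1, hY2, -⟩ := exists_gramSchmidt hU X'
    (fun i hi => (hXs ⟨i, hi⟩).congr fun q hq => hX'e q hq ⟨i, hi⟩)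
    (fun q hq => by
      have h1 : (fun i => X i q) = fun i : Fin k => (S.D q).subtype (X' i q) :=
        funext fun i => (hX'e q hq i).symm
      have h2 := (hX q hq).1
      rw [h1] at h2
      exact LinearIndependent.of_comp _ h2) k le_rfl
  refine ⟨U, hU, hq₀, fun i q => Y i q, fun i => hY1 i i.2, fun i q _ => (Y i q).2,
    fun q hq i j => ?_⟩
  rw [Subtype.coe_eta, Subtype.coe_eta, hY2 q hq i i.2 j j.2]
  simp [Fin.ext_iff]

theorem rank_le [Nonempty M] (S : Structure n k M) : k ≤ n := by
  obtain ⟨q⟩ := ‹Nonempty M›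
  rw [← S.finrank_D q]
  refine (Submodule.finrank_le _).trans (le_of_eq ?_)
  exact finrank_euclideanSpace_fin (𝕜 := ℝ) (n := n)

/-- The horizontal part of an adapted frame. -/
theorem Complement.IsAdaptedFrame.horizontal {V : S.Complement} {U : Set M}
    {X : Fin n → ∀ q : M, TangentSpace (𝓡 n) q} (hX : V.IsAdaptedFrame U X) (hkn : k ≤ n) :
    S.IsHorizontalFrame U fun i : Fin k => X (i.castLE hkn) :=
  ⟨fun i => hX.frame.contMDiffOn _, fun i q hq => hX.mem_D _ i.2 q hq, fun q hq i j => by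
    rw [hX.orthonormal (i.castLE hkn) (j.castLE hkn) i.2 j.2 q hq]
    simp⟩

theorem Complement.exists_adaptedFrame (V : S.Complement) (q₀ : M) :
    ∃ U : Set M, IsOpen U ∧ q₀ ∈ U ∧ ∃ X : Fin n → ∀ q : M, TangentSpace (𝓡 n) q,
      V.IsAdaptedFrame U X := by
  have : Nonempty M := ⟨q₀⟩
  have hkn := S.rank_le
  obtain ⟨U, hU, hq, X, hX⟩ := S.hasHorizontalFrames q₀
  obtain ⟨U', hU', hq', Z, hZs, hZ⟩ := V.smooth_V q₀
  set W : Fin n → ∀ q : M, TangentSpace (𝓡 n) q := fun i =>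
    if h : (i : ℕ) < k then X ⟨i, h⟩ else Z ⟨i - k, by omega⟩ with hW
  have hW1 : ∀ i : Fin n, ∀ h : (i : ℕ) < k, W i = X ⟨i, h⟩ := fun i h => by simp [hW, h]
  have hW2 : ∀ i : Fin n, ∀ h : k ≤ (i : ℕ), W i = Z ⟨i - k, by omega⟩ := fun i h => by
    simp [hW, h.not_gt]
  -- The k + (n - k) fields span because D and V do, and n spanning vectors in dimension n are
  -- independent.
  have hspan : ∀ q ∈ U ∩ U', ⊤ ≤ Submodule.span ℝ (range fun i => W i q) := by
    intro q hq
    rw [← (V.isCompl q).sup_eq_top]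
    refine sup_le ?_ ?_
    · intro v hv
      have h1 := congrArg (S.D q).subtype (g_eq_sum (hX.orthonormal q hq.1) ⟨v, hv⟩)
      rw [map_sum] at h1
      have h2 : v = _ := h1
      rw [h2]
      refine Submodule.sum_mem _ fun i _ => ?_
      rw [map_smul]
      refine Submodule.smul_mem _ _ (Submodule.subset_span ⟨i.castLE hkn, ?_⟩)
      exact congrFun (hW1 (i.castLE hkn) i.2) q
    · rw [← (hZ q hq.2).2]
      refine Submodule.span_le.2 ?_
      rintro _ ⟨i, rfl⟩
      refine Submodule.subset_span ⟨⟨i + k, by omega⟩, ?_⟩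
      refine (congrFun (hW2 _ (by simp)) q).trans ?_
      simp
  have hWD : ∀ i : Fin n, (i : ℕ) < k → ∀ q ∈ U ∩ U', W i q ∈ S.D q := fun i h q hq => by
    rw [hW1 i h]
    exact hX.mem_D _ q hq.1
  refine ⟨U ∩ U', hU.inter hU', ⟨hq, hq'⟩, W, ⟨fun {q} hq => ?_, fun {q} hq => hspan q hq, fun i => ?_⟩,
    fun i h q hq => ?_, hWD, fun i j hi hj q hq => ?_⟩
  · exact linearIndependent_of_top_le_span_of_card_eq_finrank (hspan q hq)
      (by
        rw [Fintype.card_fin]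
        exact (finrank_euclideanSpace_fin (𝕜 := ℝ) (n := n)).symm)
  · by_cases h : (i : ℕ) < k
    · rw [hW1 i h]
      exact (hX.smooth _).mono inter_subset_left
    · rw [hW2 i (not_lt.1 h)]
      exact SmoothFieldOn.mono (hZs _) inter_subset_right
  · rw [hW2 i h, ← (hZ q hq.2).2]
    exact Submodule.subset_span ⟨_, rfl⟩
  · have := hX.orthonormal q hq.1 ⟨i, hi⟩ ⟨j, hj⟩
    simp only [Fin.mk.injEq, ← Fin.ext_iff] at this
    rw [← this]
    congr 1
    · congr 1
      exact Subtype.ext (congrFun (hW1 i hi) q)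
    · exact Subtype.ext (congrFun (hW1 j hj) q)

end Structure

end SubRiem

namespace SubRiem

/-! ### The divergence in charts and in arbitrary frames. -/

section Alternating

variable {n : ℕ} {E : Type*} [AddCommGroup E] [Module ℝ E]

/-- Both sides are linear in v. On basis vectors the form vanishes as soon as an argument is
repeated. -/
theorem map_update_basis (f : E [⋀^Fin n]→ₗ[ℝ] ℝ) (b : Module.Basis (Fin n) ℝ E) (i : Fin n)
    (v : E) : f (Function.update b i v) = b.repr v i * f b := by
  have h : (f.toMultilinearMap.toLinearMap b i) = f b • b.coord i := by
    refine b.ext fun j => ?_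
    simp only [MultilinearMap.toLinearMap_apply, LinearMap.smul_apply, Module.Basis.coord_apply,
      smul_eq_mul, Module.Basis.repr_self, Finsupp.single_apply]
    change f (Function.update b i (b j)) = _
    split_ifs with hij
    · rw [hij, Function.update_eq_self, mul_one]
    · rw [mul_zero]
      exact f.map_eq_zero_of_eq _ (i := i) (j := j)
        (by rw [Function.update_self, Function.update_of_ne hij]) (Ne.symm hij)
  have := congrArg (fun L : E →ₗ[ℝ] ℝ => L v) h
  simp only [MultilinearMap.toLinearMap_apply, LinearMap.smul_apply, Module.Basis.coord_apply,
    smul_eq_mul] at this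
  rw [mul_comm]
  exact this

/-- The trace of `T` as the infinitesimal change of volume. -/
theorem sum_update_eq_trace (f : E [⋀^Fin n]→ₗ[ℝ] ℝ) (b : Module.Basis (Fin n) ℝ E)
    (T : E →ₗ[ℝ] E) :
    ∑ i, f (Function.update b i (T (b i))) = LinearMap.trace ℝ E T * f b := by
  simp only [map_update_basis, ← Finset.sum_mul]
  rw [LinearMap.trace_eq_matrix_trace ℝ b, Matrix.trace]
  simp [LinearMap.toMatrix_apply]

end Alternating

/-- The determinant on `ℝⁿ`. -/
def detForm (n : ℕ) : Model n [⋀^Fin n]→ₗ[ℝ] ℝ :=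
  (EuclideanSpace.basisFun (Fin n) ℝ).toBasis.det

theorem detForm_single (n : ℕ) : detForm n (fun i => EuclideanSpace.single i 1) = 1 := by
  have h : (fun i : Fin n => (EuclideanSpace.single i 1 : Model n)) =
    (EuclideanSpace.basisFun (Fin n) ℝ).toBasis := by
    funext i
    rw [OrthonormalBasis.coe_toBasis, EuclideanSpace.basisFun_apply]
  rw [h]
  exact Module.Basis.det_self _

theorem continuous_detForm (n : ℕ) : Continuous (detForm n) := by
  have h : (detForm n : (Fin n → Model n) → ℝ) = fun v =>
      Matrix.det (Matrix.of fun i j => v j i) := by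
    funext v
    rw [detForm, Module.Basis.det_apply]
    congr 1
  rw [h]
  refine Continuous.matrix_det (continuous_matrix fun i j => ?_)
  exact (EuclideanSpace.proj i : Model n →L[ℝ] ℝ).continuous.comp (continuous_apply j)

/-- The determinant on `ℝⁿ`, as a continuous multilinear map. -/
def contDetForm (n : ℕ) : ContinuousMultilinearMap ℝ (fun _ : Fin n => Model n) ℝ :=
  ⟨(detForm n).toMultilinearMap, continuous_detForm n⟩

section Manifold

variable {n : ℕ} {M : Type*} [TopologicalSpace M] [ChartedSpace (EuclideanSpace ℝ (Fin n)) M]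
    [IsManifold (𝓡 n) ∞ M]

/-- The density of the volume form in the chart at `x`. -/
def VolumeForm.density (vol : VolumeForm n M) (x q : M) : ℝ :=
  vol.form q fun i => coordField x i q

/-- Top degree forms on ℝⁿ are multiples of the determinant. The factor is found by evaluating on
the coordinate basis. -/
theorem VolumeForm.form_eq (vol : VolumeForm n M) {x q : M}
    (hq : q ∈ (extChartAt (𝓡 n) x).source) (v : Fin n → TangentSpace (𝓡 n) q) :
    vol.form q v = vol.density x q * detForm n (fun i => chartDeriv x q (v i)) := by
  let L : Model n →ₗ[ℝ] TangentSpace (𝓡 n) q :=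
    show Model n →ₗ[ℝ] Model n from (chartDeriv (n := n) x q).inverse.toLinearMap
  have h1 := ((vol.form q).compLinearMap L).eq_smul_basis_det
    (EuclideanSpace.basisFun (Fin n) ℝ).toBasis
  have h2 := congrArg (fun A : Model n [⋀^Fin n]→ₗ[ℝ] ℝ => A fun i => chartDeriv x q (v i)) h1
  have h3 : ((vol.form q).compLinearMap L) (fun i => chartDeriv x q (v i)) = vol.form q v := by
    refine congrArg (vol.form q) (funext fun i => ?_)
    exact chartDeriv_inverse_apply hq (v i)
  have h4 : ((vol.form q).compLinearMap L) (EuclideanSpace.basisFun (Fin n) ℝ).toBasis =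
      vol.density x q := by
    refine congrArg (vol.form q) (funext fun i => ?_)
    change L ((EuclideanSpace.basisFun (Fin n) ℝ).toBasis i) = _
    rw [OrthonormalBasis.coe_toBasis, EuclideanSpace.basisFun_apply]
    rfl
  rw [← h3]
  refine h2.trans ?_
  rw [h4]
  rfl

theorem VolumeForm.density_ne_zero (vol : VolumeForm n M) {x q : M}
    (hq : q ∈ (extChartAt (𝓡 n) x).source) : vol.density x q ≠ 0 := by
  intro h
  refine vol.ne_zero q (AlternatingMap.ext fun v => ?_)
  rw [vol.form_eq hq, h, zero_mul]
  rfl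

theorem VolumeForm.smooth_density (vol : VolumeForm n M) (x : M) :
    SmoothFunOn n (vol.density x) (extChartAt (𝓡 n) x).source :=
  vol.smooth _ (isOpen_extChartAt_source x) _ fun _ => smoothFieldOn_chartField x _

theorem VolumeForm.contDiffOn_density (vol : VolumeForm n M) (x : M) :
    ContDiffOn ℝ ∞ (vol.density x ∘ (extChartAt (𝓡 n) x).symm) (extChartAt (𝓡 n) x).target :=
  ((vol.smooth_density x).contDiffOn_chart x).mono fun _ hy =>
    ⟨hy, (extChartAt (𝓡 n) x).map_target hy⟩

theorem SmoothFieldOn.differentiableAt_chartRep {X : ∀ q : M, TangentSpace (𝓡 n) q} {U : Set M}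
    (hX : SmoothFieldOn X U) (hU : IsOpen U) {x q : M} (hq : q ∈ (extChartAt (𝓡 n) x).source)
    (hqU : q ∈ U) : DifferentiableAt ℝ (chartRep x X) (extChartAt (𝓡 n) x q) :=
  ((hX.contDiffOn_chartRep hU x).contDiffAt ((isOpen_chart_inter x hU).mem_nhds
    (mem_chart_inter hq hqU))).differentiableAt (by simp)

theorem SmoothFunOn.differentiableAt_chart {f : M → ℝ} {U : Set M}
    (hf : SmoothFunOn n f U) (hU : IsOpen U) {x q : M} (hq : q ∈ (extChartAt (𝓡 n) x).source)
    (hqU : q ∈ U) : DifferentiableAt ℝ (f ∘ (extChartAt (𝓡 n) x).symm) (extChartAt (𝓡 n) x q) :=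
  ((hf.contDiffOn_chart x).contDiffAt ((isOpen_chart_inter x hU).mem_nhds
    (mem_chart_inter hq hqU))).differentiableAt (by simp)

theorem chartDeriv_coordField {x q : M} (hq : q ∈ (extChartAt (𝓡 n) x).source) (i : Fin n) :
    chartDeriv x q (coordField x i q) = EuclideanSpace.single i 1 :=
  chartDeriv_apply_inverse hq _

theorem linearIndependent_chartDeriv {x q : M} (hq : q ∈ (extChartAt (𝓡 n) x).source)
    {v : Fin n → TangentSpace (𝓡 n) q} : LinearIndependent ℝ v ↔
      LinearIndependent ℝ fun i => chartDeriv x q (v i) := by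
  have h := (chartDeriv (n := n) x q).toLinearMap.linearIndependent_iff (v := v) ?_
  · exact h.symm
  · refine LinearMap.ker_eq_bot_of_injective fun v w hvw => ?_
    have := congrArg (chartDeriv (n := n) x q).inverse hvw
    exact (chartDeriv_inverse_apply hq v).symm.trans (this.trans (chartDeriv_inverse_apply hq w))

theorem linearIndependent_coordField {x q : M} (hq : q ∈ (extChartAt (𝓡 n) x).source) :
    LinearIndependent ℝ fun i : Fin n => coordField x i q := by
  rw [linearIndependent_chartDeriv hq]
  have := (EuclideanSpace.basisFun (Fin n) ℝ).toBasis.linearIndependent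
  have h : (fun i => chartDeriv x q (coordField x i q)) =
      (EuclideanSpace.basisFun (Fin n) ℝ).toBasis := funext fun i => by
    rw [chartDeriv_coordField hq, OrthonormalBasis.coe_toBasis, EuclideanSpace.basisFun_apply]
  exact h ▸ this

/-- The divergence of a vector field in the chart at `x`, times the density. -/
def VolumeForm.chartDiv (vol : VolumeForm n M) (x : M) (X : ∀ q : M, TangentSpace (𝓡 n) q)
    (y : Model n) : ℝ :=
  fderiv ℝ (vol.density x ∘ (extChartAt (𝓡 n) x).symm) y (chartRep x X y) +
    (vol.density x ∘ (extChartAt (𝓡 n) x).symm) y *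
      LinearMap.trace ℝ (Model n) (fderiv ℝ (chartRep x X) y : Model n →ₗ[ℝ] Model n)

/-- In the chart the form is density times determinant. Differentiating the determinant along X
yields terms with DZ_i(X), which the same terms of the brackets cancel; the terms with DX(Z_i) sum
to the trace of DX. So the Lie derivative depends on the values Z_i(q) only, and div can be computed
in any frame. -/
theorem VolumeForm.lie_eq_chartDiv (vol : VolumeForm n M) {U : Set M} (hU : IsOpen U)
    {X : ∀ q : M, TangentSpace (𝓡 n) q} (hX : SmoothFieldOn X U)
    {Z : Fin n → ∀ q : M, TangentSpace (𝓡 n) q} (hZ : ∀ i, SmoothFieldOn (Z i) U) {x q : M}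
    (hq : q ∈ (extChartAt (𝓡 n) x).source) (hqU : q ∈ U)
    (hli : LinearIndependent ℝ fun i => Z i q) :
    fieldDeriv X (fun p => vol.form p fun i => Z i p) q -
      ∑ i, vol.form q (Function.update (fun j => Z j q) i (mlieBracket (𝓡 n) X (Z i) q)) =
    vol.chartDiv x X (extChartAt (𝓡 n) x q) * detForm n fun i => chartDeriv x q (Z i q) := by
  have hF := vol.smooth U hU Z hZ
  set y := extChartAt (𝓡 n) x q with hy
  have hqq : (extChartAt (𝓡 n) x).symm y = q := (extChartAt (𝓡 n) x).left_inv hq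
  have hO := (isOpen_chart_inter (n := n) x hU).mem_nhds (mem_chart_inter hq hqU)
  set W : Fin n → Model n → Model n := fun i => chartRep x (Z i) with hW
  have hWy : ∀ i, W i y = chartDeriv x q (Z i q) := fun i => chartRep_apply hq _
  have hXy : chartRep x X y = chartDeriv x q (X q) := chartRep_apply hq _
  have h1 : (fun p => vol.form p fun i => Z i p) ∘ (extChartAt (𝓡 n) x).symm =ᶠ[𝓝 y]
      fun z => (vol.density x ∘ (extChartAt (𝓡 n) x).symm) z * contDetForm n fun i => W i z := by
    filter_upwards [hO] with z hz
    exact vol.form_eq ((extChartAt (𝓡 n) x).map_target hz.1) _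
  have h2 := (((vol.smooth_density x).differentiableAt_chart (isOpen_extChartAt_source x) hq
    hq).hasFDerivAt).mul (HasFDerivAt.multilinear_comp (contDetForm n) fun i =>
      ((hZ i).differentiableAt_chartRep hU hq hqU).hasFDerivAt)
  have h3 : fieldDeriv X (fun p => vol.form p fun i => Z i p) q =
      (vol.density x ∘ (extChartAt (𝓡 n) x).symm) y *
        ∑ i, detForm n (Function.update (fun j => W j y) i (fderiv ℝ (W i) y (chartRep x X y))) +
      detForm n (fun i => W i y) *
        fderiv ℝ (vol.density x ∘ (extChartAt (𝓡 n) x).symm) y (chartRep x X y) := by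
    rw [fieldDeriv, differential_apply hq (hF.mdifferentiableAt hU hqU)]
    refine (congrArg₂ (fun (L : Model n →L[ℝ] ℝ) v => L v) (h1.fderiv_eq.trans h2.fderiv)
      hXy.symm).trans ?_
    simp only [add_apply, smul_apply, sum_apply, smul_eq_mul, ContinuousLinearMap.comp_apply]
    rfl
  have h4 : ∀ i, vol.form q
      (Function.update (fun j => Z j q) i (mlieBracket (𝓡 n) X (Z i) q)) =
      vol.density x q *
        (detForm n (Function.update (fun j => W j y) i (fderiv ℝ (W i) y (chartRep x X y))) -
        detForm n (Function.update (fun j => W j y) i (fderiv ℝ (chartRep x X) y (W i y)))) := by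
    intro i
    rw [vol.form_eq hq, ← AlternatingMap.map_update_sub]
    congr 2
    funext j
    by_cases hj : j = i
    · subst hj
      rw [Function.update_self, Function.update_self, chartDeriv_mlieBracket hU hX (hZ j) hqU hq]
      rfl
    · rw [Function.update_of_ne hj, Function.update_of_ne hj, hWy]
  have hliW : LinearIndependent ℝ fun i => W i y := by
    rw [funext hWy]
    exact (linearIndependent_chartDeriv hq).1 hli
  let b := Module.Basis.mk hliW (hliW.span_eq_top_of_card_eq_finrank' (by simp)).ge
  have hb : (b : Fin n → Model n) = fun i => W i y := funext fun i => by simp [b]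
  have h6 := sum_update_eq_trace (detForm n) b (fderiv ℝ (chartRep x X) y : Model n →ₗ[ℝ] Model n)
  rw [hb] at h6
  have h7 : (vol.density x ∘ (extChartAt (𝓡 n) x).symm) y = vol.density x q := by
    rw [Function.comp_apply, hqq]
  have h8 : (detForm n fun i => chartDeriv x q (Z i q)) = detForm n fun i => W i y := by
    congr 1
    funext i
    exact (hWy i).symm
  rw [h3, Finset.sum_congr rfl fun i _ => h4 i, ← Finset.mul_sum, Finset.sum_sub_distrib, h8,
    VolumeForm.chartDiv, h7]
  have h9 : ∑ i, detForm n (Function.update (fun j => W j y) i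
      (fderiv ℝ (chartRep x X) y (W i y))) = _ := h6
  rw [h9]
  ring

theorem VolumeForm.density_mul_div (vol : VolumeForm n M) {U : Set M} (hU : IsOpen U)
    {X : ∀ q : M, TangentSpace (𝓡 n) q} (hX : SmoothFieldOn X U) {q : M} (hqU : q ∈ U) :
    vol.div X q * vol.density q q = vol.chartDiv q X (extChartAt (𝓡 n) q q) := by
  have hq := mem_extChartAt_source (I := 𝓡 n) q
  have hs := chartDeriv_coordField hq
  have hli := linearIndependent_coordField hq
  have h := vol.lie_eq_chartDiv (hU.inter (isOpen_extChartAt_source q))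
    (hX.mono inter_subset_left) (Z := fun i => coordField q i)
    (fun i => (smoothFieldOn_chartField q _).mono inter_subset_right) hq ⟨hqU, hq⟩ hli
  rw [show (fun i => chartDeriv q q (coordField q i q)) = fun i : Fin n => EuclideanSpace.single i 1 from
    funext hs, detForm_single, mul_one] at h
  rw [← h, div, ← density, div_mul_cancel₀ _ (vol.density_ne_zero hq)]
  rfl

/-- The divergence can be computed with any frame. -/
theorem VolumeForm.div_mul_form (vol : VolumeForm n M) {U : Set M} (hU : IsOpen U)
    {X : ∀ q : M, TangentSpace (𝓡 n) q} (hX : SmoothFieldOn X U)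
    {Z : Fin n → ∀ q : M, TangentSpace (𝓡 n) q} (hZ : ∀ i, SmoothFieldOn (Z i) U) {q : M}
    (hqU : q ∈ U) (hli : LinearIndependent ℝ fun i => Z i q) :
    vol.div X q * vol.form q (fun i => Z i q) =
    fieldDeriv X (fun p => vol.form p fun i => Z i p) q -
      ∑ i, vol.form q (Function.update (fun j => Z j q) i (mlieBracket (𝓡 n) X (Z i) q)) := by
  have hq := mem_extChartAt_source (I := 𝓡 n) q
  rw [vol.lie_eq_chartDiv hU hX hZ hq hqU hli, ← vol.density_mul_div hU hX hqU, vol.form_eq hq]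
  ring

/-- The divergence in the chart at `x`. -/
theorem VolumeForm.div_mul_density (vol : VolumeForm n M) {U : Set M} (hU : IsOpen U)
    {X : ∀ q : M, TangentSpace (𝓡 n) q} (hX : SmoothFieldOn X U) {x q : M} (hqU : q ∈ U)
    (hq : q ∈ (extChartAt (𝓡 n) x).source) :
    vol.div X q * vol.density x q = vol.chartDiv x X (extChartAt (𝓡 n) x q) := by
  have hs := chartDeriv_coordField hq
  have hli := linearIndependent_coordField hq
  have hU' := hU.inter (isOpen_extChartAt_source (I := 𝓡 n) x)
  have hZ : ∀ i, SmoothFieldOn (coordField x i) (U ∩ (extChartAt (𝓡 n) x).source) := fun i =>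
    (smoothFieldOn_chartField x _).mono inter_subset_right
  have h := vol.lie_eq_chartDiv hU' (hX.mono inter_subset_left) hZ hq ⟨hqU, hq⟩ hli
  rw [show (fun i => chartDeriv x q (coordField x i q)) = fun i : Fin n => EuclideanSpace.single i 1 from
    funext hs, detForm_single, mul_one] at h
  rw [← h, ← vol.div_mul_form hU' (hX.mono inter_subset_left) hZ ⟨hqU, hq⟩ hli]
  rfl

end Manifold

end SubRiem

namespace SubRiem

/-! ### The two Laplacians in an adapted frame. -/

section Manifold

variable {n : ℕ} {M : Type*} [TopologicalSpace M] [ChartedSpace (EuclideanSpace ℝ (Fin n)) M]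
    [IsManifold (𝓡 n) ∞ M] {U : Set M}

theorem SmoothFieldOn.mdifferentiableAt {X : ∀ q : M, TangentSpace (𝓡 n) q}
    (hX : SmoothFieldOn X U) (hU : IsOpen U) {q : M} (hq : q ∈ U) :
    MDifferentiableAt (𝓡 n) (𝓡 n).tangent (fun q => (⟨q, X q⟩ : TangentBundle (𝓡 n) M)) q :=
  (ContMDiffOn.contMDiffAt hX (hU.mem_nhds hq)).mdifferentiableAt (by simp)

theorem isManifold_minSmoothness : IsManifold (𝓡 n) (minSmoothness ℝ 2) M :=
  IsManifold.of_le (n := ∞) (by rw [minSmoothness_of_isRCLikeNormedField]; exact two_le_infty)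

theorem mlieBracket_sum_smul_left {ι : Type*} (s : Finset ι) (hU : IsOpen U) {q : M} (hq : q ∈ U)
    {a : ι → M → ℝ} (ha : ∀ i, SmoothFunOn n (a i) U)
    {V : ι → ∀ q : M, TangentSpace (𝓡 n) q} (hV : ∀ i, SmoothFieldOn (V i) U)
    (W : ∀ q : M, TangentSpace (𝓡 n) q) :
    mlieBracket (𝓡 n) (fun p => ∑ i ∈ s, a i p • V i p) W q =
      ∑ i ∈ s, (a i q • mlieBracket (𝓡 n) (V i) W q - fieldDeriv W (a i) q • V i q) := by
  classical
  have hM : IsManifold (𝓡 n) (minSmoothness ℝ 2) M := isManifold_minSmoothness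
  induction s using Finset.induction_on with
  | empty =>
    simp only [Finset.sum_empty]
    exact congrFun (mlieBracket_zero_left (I := 𝓡 n) (W := W)) q
  | insert i s hi ih =>
    have h1 : (fun p => ∑ j ∈ insert i s, a j p • V j p) =
        (a i • V i) + fun p => ∑ j ∈ s, a j p • V j p := by
      funext p
      rw [Finset.sum_insert hi]
      rfl
    have h2 : SmoothFieldOn (a i • V i) U := SmoothFieldOn.smul (ha i) (hV i)
    have h3 : SmoothFieldOn (fun p => ∑ j ∈ s, a j p • V j p) U :=
      SmoothFieldOn.sum fun j _ => SmoothFieldOn.smul (ha j) (hV j)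
    rw [h1, mlieBracket_add_left (h2.mdifferentiableAt hU hq) (h3.mdifferentiableAt hU hq), ih,
      Finset.sum_insert hi, mlieBracket_smul_left ((ha i).mdifferentiableAt hU hq)
        ((hV i).mdifferentiableAt hU hq)]
    congr 1
    rw [sub_eq_add_neg, add_comm, ← neg_smul]
    rfl

theorem fieldDeriv_sum {ι : Type*} (s : Finset ι) (a : ι → M → ℝ)
    (V : ι → ∀ q : M, TangentSpace (𝓡 n) q) (f : M → ℝ) (q : M) :
    fieldDeriv (fun p => ∑ i ∈ s, a i p • V i p) f q = ∑ i ∈ s, a i q * fieldDeriv (V i) f q := by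
  rw [fieldDeriv]
  refine (map_sum (differential n f q) _ _).trans (Finset.sum_congr rfl fun i _ => ?_)
  exact (map_smul (differential n f q) _ _)

theorem fieldDeriv_log_abs {X : ∀ q : M, TangentSpace (𝓡 n) q} {f : M → ℝ} (hU : IsOpen U)
    (hf : SmoothFunOn n f U) {q : M} (hq : q ∈ U) (h0 : f q ≠ 0) :
    fieldDeriv X (fun p => Real.log |f p|) q = fieldDeriv X f q / f q := by
  have hs := mem_extChartAt_source (I := 𝓡 n) q
  have h1 := (hf.differentiableAt_chart hU hs hq).hasFDerivAt
  have hqq : (f ∘ (extChartAt (𝓡 n) q).symm) (extChartAt (𝓡 n) q q) = f q := by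
    rw [Function.comp_apply, (extChartAt (𝓡 n) q).left_inv hs]
  have h2 := h1.log (by rwa [hqq])
  have hd : MDifferentiableAt (𝓡 n) 𝓘(ℝ, ℝ) (fun p => Real.log |f p|) q := by
    have h3 : MDifferentiableAt 𝓘(ℝ, ℝ) 𝓘(ℝ, ℝ) (fun r : ℝ => Real.log r) (f q) :=
      (Real.differentiableAt_log h0).mdifferentiableAt
    have h4 := h3.comp q (hf.mdifferentiableAt hU hq)
    refine h4.congr_of_eventuallyEq (Eventually.of_forall fun p => ?_)
    exact Real.log_abs _
  rw [fieldDeriv, fieldDeriv, differential_apply hs hd,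
    differential_apply hs (hf.mdifferentiableAt hU hq)]
  have h3 : (fun p => Real.log |f p|) ∘ (extChartAt (𝓡 n) q).symm =
      fun y => Real.log ((f ∘ (extChartAt (𝓡 n) q).symm) y) := by
    funext y
    exact Real.log_abs _
  rw [h3, h2.fderiv, hqq, smul_apply, smul_eq_mul, div_eq_inv_mul]

theorem form_update_eq {X : Fin n → ∀ q : M, TangentSpace (𝓡 n) q}
    (hX : IsLocalFrameOn (𝓡 n) (Model n) ∞ X U) {q : M} (hq : q ∈ U)
    (A : (TangentSpace (𝓡 n) q) [⋀^Fin n]→ₗ[ℝ] ℝ) (i : Fin n) (v : TangentSpace (𝓡 n) q) :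
    A (Function.update (fun j => X j q) i v) = hX.coeff i q v * A fun j => X j q := by
  have h1 := map_update_basis A (hX.toBasisAt hq) i v
  have h2 : (hX.toBasisAt hq : Fin n → TangentSpace (𝓡 n) q) = fun j => X j q :=
    funext fun j => hX.toBasisAt_coe hq j
  rw [h2] at h1
  rw [h1]
  congr 1
  simp [IsLocalFrameOn.coeff, hq]

theorem form_frame_ne_zero (vol : VolumeForm n M) {X : Fin n → ∀ q : M, TangentSpace (𝓡 n) q}
    (hX : IsLocalFrameOn (𝓡 n) (Model n) ∞ X U) {q : M} (hq : q ∈ U) :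
    vol.form q (fun j => X j q) ≠ 0 := by
  have h2 : (hX.toBasisAt hq : Fin n → TangentSpace (𝓡 n) q) = fun j => X j q :=
    funext fun j => hX.toBasisAt_coe hq j
  rw [← h2]
  exact ((vol.form q).map_basis_ne_zero_iff _).2 (vol.ne_zero q)

end Manifold

namespace Structure

variable {n k : ℕ} {M : Type*} [TopologicalSpace M] [ChartedSpace (EuclideanSpace ℝ (Fin n)) M]
    [IsManifold (𝓡 n) ∞ M] {S : Structure n k M} {U : Set M}

theorem IsHorizontalFrame.grad_eq {X : Fin k → ∀ q : M, TangentSpace (𝓡 n) q}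
    (hX : S.IsHorizontalFrame U X) (f : M → ℝ) {q : M} (hq : q ∈ U) :
    S.grad f q = ∑ i, fieldDeriv (X i) f q • X i q := by
  have h := congrArg (S.D q).subtype (sharp_eq_sum (hX.orthonormal q hq) (differential n f q))
  rw [map_sum] at h
  exact h

theorem smooth_grad {X : Fin k → ∀ q : M, TangentSpace (𝓡 n) q}
    (hX : S.IsHorizontalFrame U X) (hU : IsOpen U) {f : M → ℝ} (hf : SmoothFunOn n f U) :
    SmoothFieldOn (S.grad f) U := by
  have h : SmoothFieldOn (fun q => ∑ i, fieldDeriv (X i) f q • X i q) U :=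
    SmoothFieldOn.sum fun i _ =>
      SmoothFieldOn.smul ((hX.smooth i).smooth_fieldDeriv hU hf) (hX.smooth i)
  exact h.congr fun q hq => hX.grad_eq f hq

theorem differential_grad {X : Fin k → ∀ q : M, TangentSpace (𝓡 n) q}
    (hX : S.IsHorizontalFrame U X) (f g : M → ℝ) {q : M} (hq : q ∈ U) :
    differential n f q (S.grad g q) = ∑ i, fieldDeriv (X i) g q * fieldDeriv (X i) f q := by
  rw [hX.grad_eq g hq]
  exact fieldDeriv_sum Finset.univ (fun i => fieldDeriv (X i) g) X f q

section Frame

variable {V : S.Complement} {X : Fin n → ∀ q : M, TangentSpace (𝓡 n) q}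

theorem Complement.IsAdaptedFrame.smooth (hX : V.IsAdaptedFrame U X) (i : Fin n) :
    SmoothFieldOn (X i) U := hX.frame.contMDiffOn i

theorem structureFun_swap (hX : V.IsAdaptedFrame U X) (i j l : Fin n) (q : M) :
    structureFun hX.frame i j l q = -structureFun hX.frame j i l q := by
  rw [structureFun, structureFun, mlieBracket_swap_apply, map_neg]

/-- The macroscopic Laplacian in an adapted frame. -/
theorem macroLaplacian_eq (vol : VolumeForm n M) (hkn : k ≤ n) (hX : V.IsAdaptedFrame U X)
    {U' : Set M} (hU' : IsOpen U') (hsub : U' ⊆ U) {f : M → ℝ} (hf : SmoothFunOn n f U') {q : M}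
    (hq : q ∈ U') :
    S.macroLaplacian vol f q =
      ∑ i : Fin k, fieldDeriv (X (i.castLE hkn)) (fieldDeriv (X (i.castLE hkn)) f) q +
      ∑ i : Fin k, (∑ j, structureFun hX.frame j (i.castLE hkn) j q +
        fieldDeriv (X (i.castLE hkn)) (fun p => Real.log |vol.form p fun i => X i p|) q) *
        fieldDeriv (X (i.castLE hkn)) f q := by
  have hH := (hX.horizontal hkn).mono hsub
  set Y : Fin k → ∀ q : M, TangentSpace (𝓡 n) q := fun i => X (i.castLE hkn) with hY
  have hXs : ∀ i, SmoothFieldOn (X i) U' := fun i => (hX.smooth i).mono hsub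
  have hq' := hsub hq
  have h0 := form_frame_ne_zero vol hX.frame hq'
  set F : M → ℝ := fun p => vol.form p fun i => X i p with hF
  have hFs : SmoothFunOn n F U' := vol.smooth U' hU' X hXs
  -- The adapted frame itself serves as test frame for the divergence of grad f = ∑ (X_i f) X_i.
  -- Only the X_j-component of [grad f, X_j] will matter.
  have h1 := vol.div_mul_form hU' (smooth_grad hH hU' hf) hXs hq
    (hX.frame.linearIndependent hq')
  have ha : ∀ i, SmoothFunOn n (fieldDeriv (Y i) f) U' := fun i =>
    (hH.smooth i).smooth_fieldDeriv hU' hf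
  have h2 : ∀ j, mlieBracket (𝓡 n) (S.grad f) (X j) q =
      ∑ i, (fieldDeriv (Y i) f q • mlieBracket (𝓡 n) (Y i) (X j) q -
        fieldDeriv (X j) (fieldDeriv (Y i) f) q • Y i q) := by
    intro j
    rw [← mlieBracket_sum_smul_left Finset.univ hU' hq ha hH.smooth (X j)]
    refine Filter.EventuallyEq.mlieBracket_vectorField_eq ?_ EventuallyEq.rfl
    filter_upwards [hU'.mem_nhds hq] with p hp
    exact hH.grad_eq f hp
  -- The X_j-component is -(X_i f) c_{ji}^j summed over i ≤ k, minus X_j X_j f when j ≤ k. After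
  -- summation over j and the sign of the Lie derivative, the sum of squares appears.
  have h3 : ∀ j, vol.form q (Function.update (fun l => X l q) j
      (mlieBracket (𝓡 n) (S.grad f) (X j) q)) =
      (∑ i : Fin k, (-(fieldDeriv (Y i) f q * structureFun hX.frame j (i.castLE hkn) j q) -
        if i.castLE hkn = j then fieldDeriv (X j) (fieldDeriv (Y i) f) q else 0)) * F q := by
    intro j
    rw [form_update_eq hX.frame hq', h2, map_sum]
    congr 1
    refine Finset.sum_congr rfl fun i _ => ?_
    rw [map_sub, map_smul, map_smul, smul_eq_mul, smul_eq_mul]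
    have h4 : hX.frame.coeff j q (Y i q) = if i.castLE hkn = j then 1 else 0 := by
      have h5 := (hX.frame.toBasisAt hq').repr_self (i.castLE hkn)
      rw [hX.frame.toBasisAt_coe hq'] at h5
      simp only [IsLocalFrameOn.coeff, hq', dif_pos, Module.Basis.coord_apply]
      rw [h5, Finsupp.single_apply]
    rw [h4]
    congr 1
    · have h6 := structureFun_swap hX (i.castLE hkn) j j q
      rw [structureFun] at h6
      rw [h6, mul_neg]
    · split_ifs <;> simp
  have h7 : fieldDeriv (S.grad f) F q = ∑ i, fieldDeriv (Y i) f q * fieldDeriv (Y i) F q :=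
    differential_grad hH F f hq
  have h8 : ∀ i, fieldDeriv (Y i) (fun p => Real.log |vol.form p fun i => X i p|) q =
      fieldDeriv (Y i) F q / F q := fun i => fieldDeriv_log_abs hU' hFs hq h0
  change vol.div (S.grad f) q * F q = fieldDeriv (S.grad f) F q - _ at h1
  rw [Finset.sum_congr rfl fun j _ => h3 j, h7, ← Finset.sum_mul, Finset.sum_comm] at h1
  have h9 : ∀ i : Fin k, ∑ j, (-(fieldDeriv (Y i) f q *
      structureFun hX.frame j (i.castLE hkn) j q) -
        if i.castLE hkn = j then fieldDeriv (X j) (fieldDeriv (Y i) f) q else 0) =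
      -(fieldDeriv (Y i) f q * ∑ j, structureFun hX.frame j (i.castLE hkn) j q) -
        fieldDeriv (Y i) (fieldDeriv (Y i) f) q := by
    intro i
    rw [Finset.sum_sub_distrib, Finset.sum_neg_distrib, Finset.mul_sum]
    simp [hY]
  rw [Finset.sum_congr rfl fun i _ => h9 i] at h1
  have h10 : vol.div (S.grad f) q = (∑ i, fieldDeriv (Y i) f q * fieldDeriv (Y i) F q) / F q +
      ∑ i, (fieldDeriv (Y i) f q * ∑ j, structureFun hX.frame j (i.castLE hkn) j q +
        fieldDeriv (Y i) (fieldDeriv (Y i) f) q) := by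
    have h11 : ∑ i : Fin k, (-(fieldDeriv (Y i) f q *
        ∑ j, structureFun hX.frame j (i.castLE hkn) j q) -
        fieldDeriv (Y i) (fieldDeriv (Y i) f) q) =
        -∑ i, (fieldDeriv (Y i) f q * ∑ j, structureFun hX.frame j (i.castLE hkn) j q +
        fieldDeriv (Y i) (fieldDeriv (Y i) f) q) := by
      rw [← Finset.sum_neg_distrib]
      exact Finset.sum_congr rfl fun i _ => by ring
    rw [h11] at h1
    have h0' : F q ≠ 0 := h0
    refine mul_right_cancel₀ h0' ?_
    rw [h1, add_mul, div_mul_cancel₀ _ h0']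
    ring
  rw [macroLaplacian, h10, Finset.sum_div, ← Finset.sum_add_distrib, ← Finset.sum_add_distrib]
  refine Finset.sum_congr rfl fun i _ => ?_
  rw [h8]
  ring

/-- The operator `microOp` in an adapted frame. -/
theorem Complement.microOp_eq (hkn : k ≤ n) (hX : V.IsAdaptedFrame U X) (f : M → ℝ) {q : M}
    (hq : q ∈ U) :
    V.microOp (fun i : Fin k => X (i.castLE hkn)) f q =
      ∑ i : Fin k, fieldDeriv (X (i.castLE hkn)) (fieldDeriv (X (i.castLE hkn)) f) q +
      ∑ i : Fin k, (∑ j : Fin k, structureFun hX.frame (j.castLE hkn) (i.castLE hkn)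
        (j.castLE hkn) q) * fieldDeriv (X (i.castLE hkn)) f q := by
  have hH := hX.horizontal hkn
  -- Pairing with X_j after projection along V gives the dual coframe element of X_j: both forms
  -- take the same values on the frame, since V is killed and the X_i with i ≤ k are orthonormal.
  -- Hence the moments produce the c_{ji}^j.
  have h1 : ∀ (j : Fin k) (w : TangentSpace (𝓡 n) q),
      S.g q (V.proj q (X (j.castLE hkn) q)) (V.proj q w) = hX.frame.coeff (j.castLE hkn) q w := by
    intro j w
    have h2 : S.g q (V.proj q (X (j.castLE hkn) q)) ∘ₗ V.proj q =
        hX.frame.coeff (j.castLE hkn) q := by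
      refine (hX.frame.toBasisAt hq).ext fun l => ?_
      have h3 : hX.frame.coeff (j.castLE hkn) q (hX.frame.toBasisAt hq l) =
          if l = j.castLE hkn then 1 else 0 := by
        simp only [IsLocalFrameOn.coeff, hq, dif_pos, Module.Basis.coord_apply,
          Module.Basis.repr_self, Finsupp.single_apply]
      rw [h3, hX.frame.toBasisAt_coe hq, LinearMap.comp_apply]
      have h4 : V.proj q (X (j.castLE hkn) q) = ⟨X (j.castLE hkn) q, hH.mem_D j q hq⟩ :=
        V.proj_of_mem_D ⟨X (j.castLE hkn) q, hH.mem_D j q hq⟩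
      by_cases hl : (l : ℕ) < k
      · have h5 : V.proj q (X l q) = ⟨X l q, hX.mem_D l hl q hq⟩ :=
          V.proj_of_mem_D ⟨X l q, hX.mem_D l hl q hq⟩
        rw [h4, h5, hX.orthonormal (j.castLE hkn) l j.2 hl q hq]
        simp only [eq_comm]
      · rw [V.proj_of_mem_V (hX.mem_V l (not_lt.1 hl) q hq), map_zero, if_neg]
        rintro rfl
        exact hl j.2
    exact congrArg (fun L : TangentSpace (𝓡 n) q →ₗ[ℝ] ℝ => L w) h2
  rw [Complement.microOp]
  simp only [h1]
  rfl

theorem sum_filter_lt (hkn : k ≤ n) {E : Type*} [AddCommMonoid E] (F : Fin n → E) :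
    ∑ i ∈ Finset.univ.filter (fun i : Fin n => (i : ℕ) < k), F i =
      ∑ i : Fin k, F (i.castLE hkn) := by
  have h : Finset.univ.filter (fun i : Fin n => (i : ℕ) < k) =
      Finset.univ.map (Fin.castLEEmb hkn) := by
    ext i
    simp only [Finset.mem_filter, Finset.mem_univ, true_and, Finset.mem_map]
    exact ⟨fun hi => ⟨⟨i, hi⟩, rfl⟩, fun ⟨j, hj⟩ => hj ▸ j.2⟩
  rw [h, Finset.sum_map]
  rfl

theorem sum_eq_sum_castLE_add (hkn : k ≤ n) {E : Type*} [AddCommMonoid E] (F : Fin n → E) :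
    ∑ i, F i = ∑ i : Fin k, F (i.castLE hkn) +
      ∑ i ∈ Finset.univ.filter (fun i : Fin n => k ≤ (i : ℕ)), F i := by
  rw [← sum_filter_lt hkn, ← Finset.sum_filter_add_sum_filter_not _ fun i : Fin n => (i : ℕ) < k]
  simp only [not_lt]

theorem differential_chi (vol : VolumeForm n M) (hkn : k ≤ n) (hX : V.IsAdaptedFrame U X)
    (f : M → ℝ) {q : M} (hq : q ∈ U) :
    differential n f q (V.chi vol hX q) =
      ∑ i : Fin k, (∑ j ∈ Finset.univ.filter (fun j : Fin n => k ≤ (j : ℕ)),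
        structureFun hX.frame j (i.castLE hkn) j q +
        fieldDeriv (X (i.castLE hkn)) (fun p => Real.log |vol.form p fun i => X i p|) q) *
        fieldDeriv (X (i.castLE hkn)) f q := by
  rw [Complement.chi]
  refine (map_add (differential n f q) _ _).trans ?_
  have h1 := differential_grad (hX.horizontal hkn) f
    (fun p => Real.log |vol.form p fun i => X i p|) hq
  simp only [add_mul, Finset.sum_add_distrib]
  refine congrArg₂ (· + ·) ?_ h1
  rw [sum_filter_lt hkn]
  refine (map_sum (differential n f q) _ _).trans (Finset.sum_congr rfl fun i _ => ?_)
  refine (map_sum (differential n f q) _ _).trans ?_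
  rw [Finset.sum_mul]
  exact Finset.sum_congr rfl fun j _ => map_smul (differential n f q) _ _

/-- The sums of squares cancel, and so do the c_{ji}^j with j ≤ k. The geodesic average misses
exactly the vertical part of the trace and the derivative of θ. -/
theorem macroLaplacian_sub_microOp (vol : VolumeForm n M) (hkn : k ≤ n)
    (hX : V.IsAdaptedFrame U X) (hU : IsOpen U) {f : M → ℝ} (hf : SmoothFunOn n f U) {q : M}
    (hq : q ∈ U) :
    S.macroLaplacian vol f q - V.microOp (fun i : Fin k => X (i.castLE hkn)) f q =
      differential n f q (V.chi vol hX q) := by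
  rw [macroLaplacian_eq vol hkn hX hU subset_rfl hf hq, V.microOp_eq hkn hX f hq,
    differential_chi vol hkn hX f hq, add_sub_add_left_eq_sub, ← Finset.sum_sub_distrib]
  refine Finset.sum_congr rfl fun i _ => ?_
  rw [sum_eq_sum_castLE_add hkn]
  ring

/-- Cramer's rule: a frame coefficient is the quotient of two values of the volume form on smooth
fields, the denominator being nowhere zero. -/
theorem smooth_structureFun (vol : VolumeForm n M) (hX : V.IsAdaptedFrame U X) (hU : IsOpen U)
    (i j l : Fin n) : SmoothFunOn n (structureFun hX.frame i j l) U := by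
  have h1 : ∀ Z : ∀ q : M, TangentSpace (𝓡 n) q, SmoothFieldOn Z U →
      SmoothFunOn n (fun q => vol.form q (Function.update (fun m => X m q) l (Z q))) U := by
    intro Z hZ
    have h2 := vol.smooth U hU (Function.update X l Z) fun m => by
      by_cases hm : m = l
      · subst hm
        rwa [Function.update_self]
      · rw [Function.update_of_ne hm]
        exact hX.smooth m
    refine ContMDiffOn.congr h2 fun q _ => ?_
    congr 1
    funext m
    by_cases hm : m = l
    · subst hm
      simp
    · simp [hm]
  have h2 := h1 _ ((hX.smooth i).mlieBracketField (hX.smooth j) hU)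
  have h3 := vol.smooth U hU X hX.smooth
  have h4 : SmoothFunOn n (fun q => vol.form q (Function.update (fun m => X m q) l
      (mlieBracket (𝓡 n) (X i) (X j) q)) / vol.form q fun m => X m q) U :=
    ContMDiffOn.div₀ h2 h3 fun q hq => form_frame_ne_zero vol hX.frame hq
  refine ContMDiffOn.congr h4 fun q hq => ?_
  rw [form_update_eq hX.frame hq, mul_div_cancel_right₀ _ (form_frame_ne_zero vol hX.frame hq)]
  rfl

theorem smooth_log_form (vol : VolumeForm n M) (hX : V.IsAdaptedFrame U X) (hU : IsOpen U) :
    SmoothFunOn n (fun p => Real.log |vol.form p fun i => X i p|) U := by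
  have h1 := vol.smooth U hU X hX.smooth
  have h2 : SmoothFunOn n (fun p => Real.log (vol.form p fun i => X i p)) U :=
    h1.comp_contDiffOn (s := {0}ᶜ) (fun r hr => (Real.contDiffAt_log.2 hr).contDiffWithinAt)
      fun q hq => form_frame_ne_zero vol hX.frame hq
  exact ContMDiffOn.congr h2 fun q _ => Real.log_abs _

end Frame

end Structure

end SubRiem

namespace SubRiem

/-! ### Principal symbol and coefficients of a local sum of squares. -/

section Operators

variable {n : ℕ} {M : Type*} [TopologicalSpace M] [ChartedSpace (EuclideanSpace ℝ (Fin n)) M]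
    [IsManifold (𝓡 n) ∞ M]

/-- The operator `P` is locally of the form `∑ Z_i Z_i + ∑ a_i Z_i`, and its symbol is
`∑ ξ(Z_i)²`. -/
def IsLocallySumOfSquares (m : ℕ) (P : (M → ℝ) → M → ℝ) (σ : ∀ q : M, Cotangent n q → ℝ) : Prop :=
  ∀ q₀ : M, ∃ U : Set M, IsOpen U ∧ q₀ ∈ U ∧ ∃ (Z : Fin m → ∀ q : M, TangentSpace (𝓡 n) q)
    (a : Fin m → M → ℝ), (∀ i, SmoothFieldOn (Z i) U) ∧ (∀ i, SmoothFunOn n (a i) U) ∧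
    (∀ U' : Set M, IsOpen U' → U' ⊆ U → ∀ f : M → ℝ, SmoothFunOn n f U' → ∀ q ∈ U',
      P f q = ∑ i, fieldDeriv (Z i) (fieldDeriv (Z i) f) q + ∑ i, a i q * fieldDeriv (Z i) f q) ∧
    ∀ q ∈ U, ∀ ξ : Cotangent n q, σ q ξ = ∑ i, ξ (Z i q) ^ 2

/-- The `i`-th coordinate of the chart at `x`. -/
def coordFun (x : M) (i : Fin n) (q : M) : ℝ := extChartAt (𝓡 n) x q i

theorem coordFun_comp_symm (x : M) (i : Fin n) {y : Model n}
    (hy : y ∈ (extChartAt (𝓡 n) x).target) :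
    (coordFun x i ∘ (extChartAt (𝓡 n) x).symm) y = EuclideanSpace.proj (𝕜 := ℝ) i y := by
  rw [Function.comp_apply, coordFun, (extChartAt (𝓡 n) x).right_inv hy]
  rfl

theorem smooth_coordFun (x : M) (i : Fin n) :
    SmoothFunOn n (coordFun x i) (extChartAt (𝓡 n) x).source := by
  have h : SmoothFunOn n (coordFun x i) ((extChartAt (𝓡 n) x).source ∩ univ) := by
    refine smoothFunOn_of_chart (ContDiffOn.congr
      ((EuclideanSpace.proj (𝕜 := ℝ) i : Model n →L[ℝ] ℝ).contDiff.contDiffOn) fun y hy => ?_)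
    exact coordFun_comp_symm x i hy.1
  rwa [inter_univ] at h

theorem model_eq_sum (v : Model n) : v = ∑ i, v i • EuclideanSpace.single i (1 : ℝ) := by
  have := (EuclideanSpace.basisFun (Fin n) ℝ).sum_repr v
  simpa using this.symm

theorem fderiv_eq_sum (L : Model n →L[ℝ] ℝ) (v : Model n) :
    L v = ∑ i, v i * L (EuclideanSpace.single i 1) := by
  conv_lhs => rw [model_eq_sum v]
  simp

/-- The second derivative along a vector field, in a chart. -/
theorem fieldDeriv_fieldDeriv_chart {Z : ∀ q : M, TangentSpace (𝓡 n) q} {f : M → ℝ} {U : Set M}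
    (hU : IsOpen U) (hZ : SmoothFieldOn Z U) (hf : SmoothFunOn n f U) {x : M} {y : Model n}
    (hy : y ∈ (extChartAt (𝓡 n) x).target ∩ (extChartAt (𝓡 n) x).symm ⁻¹' U) :
    fieldDeriv Z (fieldDeriv Z f) ((extChartAt (𝓡 n) x).symm y) =
      fderiv ℝ (fderiv ℝ (f ∘ (extChartAt (𝓡 n) x).symm)) y (chartRep x Z y) (chartRep x Z y) +
      fderiv ℝ (f ∘ (extChartAt (𝓡 n) x).symm) y (fderiv ℝ (chartRep x Z) y (chartRep x Z y)) := by
  have hO := (isOpen_chart_inter (n := n) x hU)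
  rw [fieldDeriv_comp_symm hU (hZ.smooth_fieldDeriv hU hf) hy]
  have h1 : fieldDeriv Z f ∘ (extChartAt (𝓡 n) x).symm =ᶠ[𝓝 y] fun z =>
      fderiv ℝ (f ∘ (extChartAt (𝓡 n) x).symm) z (chartRep x Z z) := by
    filter_upwards [hO.mem_nhds hy] with z hz
    exact fieldDeriv_comp_symm hU hf hz
  have h2 : DifferentiableAt ℝ (chartRep x Z) y :=
    ((hZ.contDiffOn_chartRep hU x).contDiffAt (hO.mem_nhds hy)).differentiableAt (by simp)
  have h3 : DifferentiableAt ℝ (fderiv ℝ (f ∘ (extChartAt (𝓡 n) x).symm)) y :=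
    ((((hf.contDiffOn_chart x).fderiv_of_isOpen hO (m := ∞) le_rfl)).contDiffAt
      (hO.mem_nhds hy)).differentiableAt (by simp)
  rw [h1.fderiv_eq, (h3.hasFDerivAt.clm_apply h2.hasFDerivAt).fderiv]
  simp only [add_apply, ContinuousLinearMap.comp_apply, ContinuousLinearMap.flip_apply]
  exact add_comm _ _

variable {m : ℕ} {P : (M → ℝ) → M → ℝ} {σ : ∀ q : M, Cotangent n q → ℝ}

/-- The covector `dx_i`. -/
def coordCovector (x : M) (i : Fin n) (q : M) : Cotangent n q :=
  (EuclideanSpace.proj (𝕜 := ℝ) i : Model n →L[ℝ] ℝ).comp (chartDeriv x q)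

/-- Coefficients are wanted on a whole chart, while the frames are only local. They are therefore
defined without a frame: a_ij by polarizing the symbol on dx_i, dx_j, and b_i by applying P to the
i-th coordinate function. Smoothness and the formula for P are then checked near each point.
Coordinate functions are smooth only on the chart domain, which is why the hypothesis covers
functions smooth on smaller open sets. -/
theorem IsLocallySumOfSquares.isSecondOrderOperator (hP : IsLocallySumOfSquares m P σ) :
    IsSecondOrderOperator P σ fun _ => 0 := by
  refine ⟨contMDiff_const, fun x => ?_⟩
  set T := (extChartAt (𝓡 n) x).target with hT
  set s := (extChartAt (𝓡 n) x).symm with hs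
  have hsrc : ∀ {y}, y ∈ T → s y ∈ (extChartAt (𝓡 n) x).source := fun hy =>
    (extChartAt (𝓡 n) x).map_target hy
  -- the coefficients
  set A : Fin n → Fin n → Model n → ℝ := fun i j y =>
    (σ (s y) (coordCovector x i (s y) + coordCovector x j (s y)) -
      σ (s y) (coordCovector x i (s y)) - σ (s y) (coordCovector x j (s y))) / 2 with hA
  set B : Fin n → Model n → ℝ := fun i y => P (coordFun x i) (s y) with hB
  have key : ∀ y₀ ∈ T, ∃ (O : Set (Model n)) (W : Fin m → Model n → Model n)
      (c : Fin m → Model n → ℝ), IsOpen O ∧ y₀ ∈ O ∧ O ⊆ T ∧ (∀ r, ContDiffOn ℝ ∞ (W r) O) ∧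
      (∀ r, ContDiffOn ℝ ∞ (c r) O) ∧
      (∀ y ∈ O, ∀ i j, A i j y = ∑ r, W r y i * W r y j) ∧
      (∀ y ∈ O, ∀ i, B i y = ∑ r, (fderiv ℝ (W r) y (W r y) i + c r y * W r y i)) ∧
      (∀ y ∈ O, ∀ ξ : Cotangent n (s y), σ (s y) ξ =
        ∑ r, (∑ i, W r y i * ξ (coordField x i (s y))) ^ 2) ∧
      ∀ y ∈ O, ∀ f : M → ℝ, SmoothFun n f → P f (s y) =
        ∑ r, (fderiv ℝ (fderiv ℝ (f ∘ s)) y (W r y) (W r y) +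
          fderiv ℝ (f ∘ s) y (fderiv ℝ (W r) y (W r y)) + c r y * fderiv ℝ (f ∘ s) y (W r y)) := by
    intro y₀ hy₀
    obtain ⟨U, hU, hq₀, Z, a, hZ, ha, hform, hσ⟩ := hP (s y₀)
    have hU' := hU.inter (isOpen_extChartAt_source (I := 𝓡 n) x)
    have hPf : ∀ y ∈ T ∩ s ⁻¹' U, ∀ f : M → ℝ,
        SmoothFunOn n f (U ∩ (extChartAt (𝓡 n) x).source) → P f (s y) =
        ∑ r, (fderiv ℝ (fderiv ℝ (f ∘ s)) y (chartRep x (Z r) y) (chartRep x (Z r) y) +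
          fderiv ℝ (f ∘ s) y (fderiv ℝ (chartRep x (Z r)) y (chartRep x (Z r) y)) +
          (a r ∘ s) y * fderiv ℝ (f ∘ s) y (chartRep x (Z r) y)) := by
      intro y hy f hf
      have hy' : y ∈ T ∩ s ⁻¹' (U ∩ (extChartAt (𝓡 n) x).source) := ⟨hy.1, hy.2, hsrc hy.1⟩
      rw [hform _ hU' inter_subset_left f hf (s y) hy'.2, ← Finset.sum_add_distrib]
      refine Finset.sum_congr rfl fun r _ => ?_
      rw [fieldDeriv_fieldDeriv_chart hU' ((hZ r).mono inter_subset_left) hf hy',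
        fieldDeriv_comp_symm hU' hf hy']
      rfl
    have hξ : ∀ y ∈ T, ∀ (ξ : Cotangent n (s y)) r,
        ξ (Z r (s y)) = ∑ i, chartRep x (Z r) y i * ξ (coordField x i (s y)) := by
      intro y hy ξ r
      have h1 := fderiv_eq_sum (ξ.comp (chartDeriv x (s y)).inverse) (chartRep x (Z r) y)
      refine Eq.trans ?_ h1
      exact (congrArg ξ (chartDeriv_inverse_apply (hsrc hy) (Z r (s y)))).symm
    have hdx : ∀ y r i, coordCovector x i (s y) (Z r (s y)) = chartRep x (Z r) y i := fun y r i =>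
      rfl
    refine ⟨T ∩ s ⁻¹' U, fun r => chartRep x (Z r), fun r => a r ∘ s, isOpen_chart_inter x hU,
      ⟨hy₀, hq₀⟩, inter_subset_left, fun r => (hZ r).contDiffOn_chartRep hU x,
      fun r => (ha r).contDiffOn_chart x, ?_, ?_, ?_, ?_⟩
    · intro y hy i j
      simp only [hA]
      rw [hσ _ hy.2, hσ _ hy.2, hσ _ hy.2, ← Finset.sum_sub_distrib, ← Finset.sum_sub_distrib,
        Finset.sum_div]
      refine Finset.sum_congr rfl fun r _ => ?_
      have h1 : (coordCovector x i (s y) + coordCovector x j (s y)) (Z r (s y)) =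
        chartRep x (Z r) y i + chartRep x (Z r) y j := rfl
      rw [h1, hdx, hdx]
      ring
    · intro y hy i
      simp only [hB]
      rw [hPf y hy _ ((smooth_coordFun x i).mono inter_subset_right)]
      have h1 : ∀ z ∈ T, fderiv ℝ (coordFun x i ∘ s) z = EuclideanSpace.proj (𝕜 := ℝ) i := by
        intro z hz
        have h2 : coordFun x i ∘ s =ᶠ[𝓝 z] (EuclideanSpace.proj (𝕜 := ℝ) i : Model n →L[ℝ] ℝ) := by
          filter_upwards [(isOpen_extChartAt_target x).mem_nhds hz] with w hw
          exact coordFun_comp_symm x i hw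
        rw [h2.fderiv_eq, ContinuousLinearMap.fderiv]
      -- Coordinate functions are linear in the chart, so only the first order part of P survives on
      -- them.
      have h3 : fderiv ℝ (fderiv ℝ (coordFun x i ∘ s)) y = 0 := by
        have h4 : fderiv ℝ (coordFun x i ∘ s) =ᶠ[𝓝 y] fun _ => EuclideanSpace.proj (𝕜 := ℝ) i := by
          filter_upwards [(isOpen_extChartAt_target x).mem_nhds hy.1] with w hw
          exact h1 w hw
        rw [h4.fderiv_eq, fderiv_fun_const]
        rfl
      refine Finset.sum_congr rfl fun r _ => ?_
      rw [h3, h1 y hy.1]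
      simp
    · intro y hy ξ
      rw [hσ _ hy.2]
      exact Finset.sum_congr rfl fun r _ => by rw [hξ y hy.1]
    · intro y hy f hf
      exact hPf y hy f (hf.smoothFunOn _)
  refine ⟨A, B, fun i j => ?_, fun i => ?_, fun i j y _ => ?_, fun f hf y hy => ?_,
    fun q hq ξ => ?_⟩
  · intro y₀ hy₀
    obtain ⟨O, W, c, hO, hyO, -, hW, -, hAe, -⟩ := key y₀ hy₀
    have hp : ∀ r i, ContDiffOn ℝ ∞ (fun y => W r y i) O := fun r i =>
      (EuclideanSpace.proj (𝕜 := ℝ) i : Model n →L[ℝ] ℝ).contDiff.comp_contDiffOn (hW r)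
    have h1 : ContDiffOn ℝ ∞ (fun y => ∑ r, W r y i * W r y j) O :=
      ContDiffOn.sum fun r _ => (hp r i).mul (hp r j)
    have h2 : ContDiffOn ℝ ∞ (A i j) O := h1.congr fun y hy => hAe y hy i j
    exact (h2.contDiffAt (hO.mem_nhds hyO)).contDiffWithinAt
  · intro y₀ hy₀
    obtain ⟨O, W, c, hO, hyO, -, hW, hc, -, hBe, -⟩ := key y₀ hy₀
    have hp : ∀ r i, ContDiffOn ℝ ∞ (fun y => W r y i) O := fun r i =>
      (EuclideanSpace.proj (𝕜 := ℝ) i : Model n →L[ℝ] ℝ).contDiff.comp_contDiffOn (hW r)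
    have hd : ∀ r, ContDiffOn ℝ ∞ (fun y => fderiv ℝ (W r) y (W r y) i) O := fun r =>
      (EuclideanSpace.proj (𝕜 := ℝ) i : Model n →L[ℝ] ℝ).contDiff.comp_contDiffOn
        (((hW r).fderiv_of_isOpen hO (m := ∞) le_rfl).clm_apply (hW r))
    have h1 : ContDiffOn ℝ ∞ (fun y => ∑ r, (fderiv ℝ (W r) y (W r y) i + c r y * W r y i)) O :=
      ContDiffOn.sum fun r _ => (hd r).add ((hc r).mul (hp r i))
    have h2 : ContDiffOn ℝ ∞ (B i) O := h1.congr fun y hy => hBe y hy i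
    exact (h2.contDiffAt (hO.mem_nhds hyO)).contDiffWithinAt
  · simp only [hA]
    rw [add_comm (coordCovector x i (s y))]
    ring
  · obtain ⟨O, W, c, hO, hyO, hOT, hW, hc, hAe, hBe, -, hPe⟩ := key y hy
    rw [hPe y hyO f hf]
    have hd2 : DifferentiableAt ℝ (fderiv ℝ (f ∘ s)) y := by
      have h1 : ContDiffOn ℝ ∞ (f ∘ s) T :=
        ((hf.smoothFunOn univ).contDiffOn_chart x).mono fun z hz => ⟨hz, mem_univ _⟩
      exact ((h1.fderiv_of_isOpen (isOpen_extChartAt_target x) (m := ∞) le_rfl).contDiffAt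
        ((isOpen_extChartAt_target x).mem_nhds hy)).differentiableAt (by simp)
    have h2 : ∀ i j, fderiv ℝ (fun z => fderiv ℝ (f ∘ s) z (EuclideanSpace.single j 1)) y
        (EuclideanSpace.single i 1) =
        fderiv ℝ (fderiv ℝ (f ∘ s)) y (EuclideanSpace.single i 1) (EuclideanSpace.single j 1) := by
      intro i j
      rw [(hd2.hasFDerivAt.clm_apply (hasFDerivAt_const _ _)).fderiv]
      simp
    have h3 : ∀ v : Model n, fderiv ℝ (fderiv ℝ (f ∘ s)) y v v = ∑ i, ∑ j, v i * v j *
        fderiv ℝ (fderiv ℝ (f ∘ s)) y (EuclideanSpace.single i 1)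
          (EuclideanSpace.single j 1) := by
      intro v
      have h4 := fderiv_eq_sum ((fderiv ℝ (fderiv ℝ (f ∘ s)) y).flip v) v
      simp only [ContinuousLinearMap.flip_apply] at h4
      rw [h4]
      refine Finset.sum_congr rfl fun i _ => ?_
      rw [fderiv_eq_sum (fderiv ℝ (fderiv ℝ (f ∘ s)) y _) v, Finset.mul_sum]
      exact Finset.sum_congr rfl fun j _ => by ring
    simp only [h2, hAe y hyO, hBe y hyO, zero_mul, add_zero, Finset.sum_add_distrib, h3]
    rw [add_assoc]
    congr 1
    · rw [Finset.sum_comm]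
      refine Finset.sum_congr rfl fun i _ => ?_
      rw [Finset.sum_comm]
      exact Finset.sum_congr rfl fun j _ => by rw [Finset.sum_mul]
    · rw [← Finset.sum_add_distrib]
      simp only [← Finset.sum_add_distrib, Finset.sum_mul]
      rw [Finset.sum_comm]
      refine Finset.sum_congr rfl fun r _ => ?_
      rw [fderiv_eq_sum (fderiv ℝ (f ∘ s) y) (fderiv ℝ (W r) y (W r y)),
        fderiv_eq_sum (fderiv ℝ (f ∘ s) y) (W r y), Finset.mul_sum, ← Finset.sum_add_distrib]
      exact Finset.sum_congr rfl fun i _ => by ring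
  · obtain ⟨O, W, c, hO, hyO, hOT, hW, hc, hAe, -, hσe, -⟩ := key (extChartAt (𝓡 n) x q)
      ((extChartAt (𝓡 n) x).map_source hq)
    have hqq : s (extChartAt (𝓡 n) x q) = q := (extChartAt (𝓡 n) x).left_inv hq
    have h1 := hσe _ hyO
    rw [hqq] at h1
    rw [h1]
    simp only [hAe _ hyO, Finset.sum_mul]
    have h2 : ∀ r, (∑ i, W r (extChartAt (𝓡 n) x q) i * ξ (coordField x i q)) ^ 2 =
        ∑ i, ∑ j, W r (extChartAt (𝓡 n) x q) i * W r (extChartAt (𝓡 n) x q) j *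
          ξ (coordField x i q) * ξ (coordField x j q) := by
      intro r
      rw [sq, Finset.sum_mul_sum]
      exact Finset.sum_congr rfl fun i _ => Finset.sum_congr rfl fun j _ => by ring
    simp only [h2]
    rw [Finset.sum_comm]
    refine Finset.sum_congr rfl fun i _ => ?_
    rw [Finset.sum_comm]

end Operators

namespace Structure

variable {n k : ℕ} {M : Type*} [TopologicalSpace M] [ChartedSpace (EuclideanSpace ℝ (Fin n)) M]
    [IsManifold (𝓡 n) ∞ M] {S : Structure n k M}

theorem IsHorizontalFrame.two_mul_hamiltonian {U : Set M}
    {X : Fin k → ∀ q : M, TangentSpace (𝓡 n) q} (hX : S.IsHorizontalFrame U X) {q : M}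
    (hq : q ∈ U) (ξ : Cotangent n q) : 2 * S.hamiltonian q ξ = ∑ i, ξ (X i q) ^ 2 := by
  rw [hX.hamiltonian_eq hq]
  ring

theorem isLocallySumOfSquares_macroLaplacian (V : S.Complement) (vol : VolumeForm n M) :
    IsLocallySumOfSquares k (S.macroLaplacian vol) fun q ξ => 2 * S.hamiltonian q ξ := by
  intro q₀
  have : Nonempty M := ⟨q₀⟩
  have hkn := S.rank_le
  obtain ⟨U, hU, hq, X, hX⟩ := V.exists_adaptedFrame q₀
  have hH := hX.horizontal hkn
  refine ⟨U, hU, hq, fun i => X (i.castLE hkn), fun i q =>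
    ∑ j, structureFun hX.frame j (i.castLE hkn) j q +
        fieldDeriv (X (i.castLE hkn)) (fun p => Real.log |vol.form p fun i => X i p|) q,
    hH.smooth, fun i => ?_, fun U' hU' hsub f hf q hq =>
      macroLaplacian_eq vol hkn hX hU' hsub hf hq, fun q hq ξ => hH.two_mul_hamiltonian hq ξ⟩
  have h1 : SmoothFunOn n (fun q => ∑ j, structureFun hX.frame j (i.castLE hkn) j q) U :=
    contMDiffOn_finsetSum fun j _ => smooth_structureFun vol hX hU _ _ _
  exact ContMDiffOn.add h1 ((hH.smooth i).smooth_fieldDeriv hU (smooth_log_form vol hX hU))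

variable [T2Space M]

theorem tendsto_microQuotient_adapted {V : S.Complement} {μ : ∀ q : M, Measure (Cotangent n q)}
    (hμ : V.IsAdapted μ) (hk : 1 ≤ k) (hkn : k ≤ n) {U : Set M}
    {X : Fin n → ∀ q : M, TangentSpace (𝓡 n) q} (hX : V.IsAdaptedFrame U X) {U' : Set M}
    (hU' : IsOpen U') (hsub : U' ⊆ U) {f : M → ℝ} (hf : SmoothFunOn n f U') {q : M} (hq : q ∈ U') :
    Tendsto (S.microQuotient μ f q) (𝓝[>] 0)
      (𝓝 (V.microOp (fun i : Fin k => X (i.castLE hkn)) f q)) :=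
  tendsto_microQuotient hμ hk S.hasHorizontalFrames hU' ((hX.horizontal hkn).mono hsub) hq hf

theorem isLocallySumOfSquares_microLaplacian (vol : VolumeForm n M) {V : S.Complement}
    {μ : ∀ q : M, Measure (Cotangent n q)} (hμ : V.IsAdapted μ) (hk : 1 ≤ k) :
    IsLocallySumOfSquares k (S.microLaplacian μ) fun q ξ => 2 * S.hamiltonian q ξ := by
  intro q₀
  have : Nonempty M := ⟨q₀⟩
  have hkn := S.rank_le
  obtain ⟨U, hU, hq, X, hX⟩ := V.exists_adaptedFrame q₀
  have hH := hX.horizontal hkn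
  refine ⟨U, hU, hq, fun i => X (i.castLE hkn), fun i q =>
    ∑ j : Fin k, structureFun hX.frame (j.castLE hkn) (i.castLE hkn) (j.castLE hkn) q,
    hH.smooth, fun i => contMDiffOn_finsetSum fun j _ => smooth_structureFun vol hX hU _ _ _,
      fun U' hU' hsub f hf q hq => ?_, fun q hq ξ => hH.two_mul_hamiltonian hq ξ⟩
  rw [← V.microOp_eq hkn hX f (hsub hq)]
  exact (tendsto_microQuotient_adapted hμ hk hkn hX hU' hsub hf hq).limUnder_eq

end Structure

end SubRiem

namespace SubRiem

/-! ### The measure defined by the volume form. -/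

section Measure

variable {n : ℕ} {M : Type*} [TopologicalSpace M] [ChartedSpace (EuclideanSpace ℝ (Fin n)) M]
    [IsManifold (𝓡 n) ∞ M]

/-- The derivative of the change of chart. -/
theorem hasFDerivAt_chartChange {x x' : M} {y : Model n} (hy : y ∈ (extChartAt (𝓡 n) x).target)
    (hy' : (extChartAt (𝓡 n) x).symm y ∈ (extChartAt (𝓡 n) x').source) :
    HasFDerivAt (fun z => extChartAt (𝓡 n) x' ((extChartAt (𝓡 n) x).symm z))
      ((chartDeriv x' ((extChartAt (𝓡 n) x).symm y)).comp
        (chartDeriv x ((extChartAt (𝓡 n) x).symm y)).inverse) y := by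
  have h1 := ((contMDiffAt_extChartAt'' hy').mdifferentiableAt (by simp)).hasMFDerivAt
  have h2 := ((contMDiffAt_extChartAt_symm' hy).mdifferentiableAt (by simp)).hasMFDerivAt
  have h3 := (h1.comp y h2).hasFDerivAt
  refine h3.congr_fderiv ?_
  rw [← mfderiv_extChartAt_symm_eq hy]
  rfl

/-- Densities in two charts differ by the Jacobian determinant of the change of chart. This
compensates the Jacobian of Lebesgue measure. -/
theorem VolumeForm.density_eq_mul_det (vol : VolumeForm n M) {x x' q : M}
    (hq' : q ∈ (extChartAt (𝓡 n) x').source) :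
    vol.density x q = vol.density x' q *
      ((chartDeriv x' q).comp (chartDeriv x q).inverse : Model n →L[ℝ] Model n).det := by
  rw [density, vol.form_eq hq']
  congr 1
  have h1 := Module.Basis.det_comp (EuclideanSpace.basisFun (Fin n) ℝ).toBasis
    (((chartDeriv x' q).comp (chartDeriv x q).inverse : Model n →L[ℝ] Model n) :
      Model n →ₗ[ℝ] Model n) (EuclideanSpace.basisFun (Fin n) ℝ).toBasis
  rw [Module.Basis.det_self, mul_one] at h1
  refine Eq.trans ?_ h1
  refine congrArg (detForm n) (funext fun i => ?_)
  rw [Function.comp_apply, OrthonormalBasis.coe_toBasis, EuclideanSpace.basisFun_apply]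
  rfl

variable [MeasurableSpace M] [BorelSpace M]

/-- The density of `vol` with respect to the Lebesgue measure of the chart at `x`. -/
def VolumeForm.chartDensity (vol : VolumeForm n M) (x : M) (y : Model n) : ENNReal :=
  ENNReal.ofReal |vol.density x ((extChartAt (𝓡 n) x).symm y)|

theorem aemeasurable_extChartAt_symm (x : M) :
    AEMeasurable (extChartAt (𝓡 n) x).symm
      ((volume : Measure (Model n)).restrict (extChartAt (𝓡 n) x).target) :=
  (continuousOn_extChartAt_symm x).aemeasurable (isOpen_extChartAt_target x).measurableSet

theorem VolumeForm.aemeasurable_chartDensity (vol : VolumeForm n M) (x : M) :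
    AEMeasurable (vol.chartDensity x)
      ((volume : Measure (Model n)).restrict (extChartAt (𝓡 n) x).target) :=
  (ContinuousOn.aemeasurable ((vol.contDiffOn_density x).continuousOn.abs)
    (isOpen_extChartAt_target x).measurableSet).ennreal_ofReal

theorem VolumeForm.chartMeasure_eq (vol : VolumeForm n M) (x : M) :
    vol.chartMeasure x = Measure.map (extChartAt (𝓡 n) x).symm
      (((volume : Measure (Model n)).restrict (extChartAt (𝓡 n) x).target).withDensity
        (vol.chartDensity x)) := rfl

theorem VolumeForm.aemeasurable_symm_withDensity (vol : VolumeForm n M) (x : M) :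
    AEMeasurable (extChartAt (𝓡 n) x).symm
      (((volume : Measure (Model n)).restrict (extChartAt (𝓡 n) x).target).withDensity
        (vol.chartDensity x)) :=
  (aemeasurable_extChartAt_symm x).mono_ac (withDensity_absolutelyContinuous _ _)

theorem VolumeForm.chartMeasure_apply (vol : VolumeForm n M) (x : M) {A : Set M}
    (hA : MeasurableSet A) : vol.chartMeasure x A =
      ∫⁻ y in (extChartAt (𝓡 n) x).symm ⁻¹' A ∩ (extChartAt (𝓡 n) x).target,
        vol.chartDensity x y := by
  rw [chartMeasure_eq, Measure.map_apply_of_aemeasurable (vol.aemeasurable_symm_withDensity x) hA,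
    withDensity_apply', Measure.restrict_restrict' (isOpen_extChartAt_target x).measurableSet]

theorem measurableSet_chart_preimage (x : M) {A : Set M} (hA : MeasurableSet A) :
    MeasurableSet ((extChartAt (𝓡 n) x).symm ⁻¹' A ∩ (extChartAt (𝓡 n) x).target) := by
  have hT := (isOpen_extChartAt_target (I := 𝓡 n) x).measurableSet
  have h1 := (continuousOn_extChartAt_symm (I := 𝓡 n) x)
  have h2 : Measurable ((extChartAt (𝓡 n) x).target.domRestrict (extChartAt (𝓡 n) x).symm) :=
    (continuousOn_iff_continuous_domRestrict.1 h1).measurable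
  have h3 := (MeasurableEmbedding.subtype_coe hT).measurableSet_image.2 (h2 hA)
  convert h3 using 1
  ext y
  exact ⟨fun ⟨h4, h5⟩ => ⟨⟨y, h5⟩, h4, rfl⟩, fun ⟨⟨z, hz⟩, h4, h5⟩ => h5 ▸ ⟨h4, hz⟩⟩

theorem VolumeForm.chartMeasure_compl_source (vol : VolumeForm n M) (x : M) :
    vol.chartMeasure x (extChartAt (𝓡 n) x).sourceᶜ = 0 := by
  rw [vol.chartMeasure_apply x (isOpen_extChartAt_source x).measurableSet.compl]
  have h : (extChartAt (𝓡 n) x).symm ⁻¹' (extChartAt (𝓡 n) x).sourceᶜ ∩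
      (extChartAt (𝓡 n) x).target = ∅ := by
    refine eq_empty_of_forall_notMem fun y hy => ?_
    exact hy.1 ((extChartAt (𝓡 n) x).map_target hy.2)
  rw [h]
  simp

/-- The measures of the charts agree on overlaps. -/
theorem VolumeForm.chartMeasure_eq_of_subset (vol : VolumeForm n M) {x x' : M} {A : Set M}
    (hA : MeasurableSet A) (hx : A ⊆ (extChartAt (𝓡 n) x).source)
    (hx' : A ⊆ (extChartAt (𝓡 n) x').source) : vol.chartMeasure x A = vol.chartMeasure x' A := by
  set B := (extChartAt (𝓡 n) x).symm ⁻¹' A ∩ (extChartAt (𝓡 n) x).target with hB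
  set φ : Model n → Model n := fun z => extChartAt (𝓡 n) x' ((extChartAt (𝓡 n) x).symm z) with hφ
  have hBm : MeasurableSet B := measurableSet_chart_preimage x hA
  have himg : (extChartAt (𝓡 n) x').symm ⁻¹' A ∩ (extChartAt (𝓡 n) x').target = φ '' B := by
    ext z
    constructor
    · rintro ⟨h1, h2⟩
      refine ⟨extChartAt (𝓡 n) x ((extChartAt (𝓡 n) x').symm z), ⟨?_, ?_⟩, ?_⟩
      · rw [mem_preimage, (extChartAt (𝓡 n) x).left_inv (hx h1)]
        exact h1
      · exact (extChartAt (𝓡 n) x).map_source (hx h1)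
      · simp only [hφ]
        rw [(extChartAt (𝓡 n) x).left_inv (hx h1), (extChartAt (𝓡 n) x').right_inv h2]
    · rintro ⟨y, ⟨h1, h2⟩, rfl⟩
      refine ⟨?_, (extChartAt (𝓡 n) x').map_source (hx' h1)⟩
      simp only [hφ, mem_preimage]
      rw [(extChartAt (𝓡 n) x').left_inv (hx' h1)]
      exact h1
  have hinj : InjOn φ B := by
    intro y hy z hz h
    exact (extChartAt (𝓡 n) x).symm.injOn hy.2 hz.2
      ((extChartAt (𝓡 n) x').injOn (hx' hy.1) (hx' hz.1) h)
  -- Change of variables by the transition map; its Jacobian is absorbed by the transformation law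
  -- of the densities.
  rw [vol.chartMeasure_apply x hA, vol.chartMeasure_apply x' hA, himg,
    lintegral_image_eq_lintegral_abs_det_fderiv_mul volume hBm
      (fun y hy => (hasFDerivAt_chartChange hy.2 (hx' hy.1)).hasFDerivWithinAt) hinj]
  refine setLIntegral_congr_fun hBm fun y hy => ?_
  simp only [chartDensity]
  rw [(extChartAt (𝓡 n) x').left_inv (hx' hy.1), ← ENNReal.ofReal_mul (abs_nonneg _), ← abs_mul,
    vol.density_eq_mul_det (hx' hy.1), mul_comm]

/-- The supremum clearly dominates. Conversely, the measure restricted off the chart domain plus the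
measure of this chart bounds every chart measure, because those agree on overlaps; hence it bounds
the supremum. Restricting to the domain gives the claim. -/
theorem VolumeForm.restrict_measure (vol : VolumeForm n M) (x : M) :
    vol.measure.restrict (extChartAt (𝓡 n) x).source = vol.chartMeasure x := by
  set s := (extChartAt (𝓡 n) x).source with hs
  have hsm : MeasurableSet s := (isOpen_extChartAt_source x).measurableSet
  have hself : (vol.chartMeasure x).restrict s = vol.chartMeasure x :=
    Measure.restrict_eq_self_of_ae_mem (by
      rw [ae_iff]
      exact vol.chartMeasure_compl_source x)
  refine le_antisymm ?_ ?_
  · have h1 : vol.measure ≤ vol.measure.restrict sᶜ + vol.chartMeasure x := by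
      refine iSup_le fun x' => ?_
      rw [← Measure.restrict_add_restrict_compl (μ := vol.chartMeasure x') hsm, add_comm]
      refine add_le_add (Measure.restrict_mono le_rfl (le_iSup vol.chartMeasure x')) ?_
      refine Measure.le_iff.2 fun A hA => ?_
      have hs'm := (isOpen_extChartAt_source (I := 𝓡 n) x').measurableSet
      rw [Measure.restrict_apply hA]
      have h2 : vol.chartMeasure x' (A ∩ s) =
          vol.chartMeasure x' (A ∩ s ∩ (extChartAt (𝓡 n) x').source) :=
        (measure_inter_conull (vol.chartMeasure_compl_source x')).symm
      rw [h2, ← vol.chartMeasure_eq_of_subset ((hA.inter hsm).inter hs'm)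
        (x := x) (fun p hp => hp.1.2) fun p hp => hp.2]
      exact measure_mono fun p hp => hp.1.1
    have h3 := Measure.restrict_mono (le_refl s) h1
    rwa [Measure.restrict_add, Measure.restrict_restrict hsm, inter_compl_self,
      Measure.restrict_empty, zero_add, hself] at h3
  · rw [← hself]
    exact Measure.restrict_mono le_rfl (le_iSup vol.chartMeasure x)

/-- Integrals of functions that vanish outside of the domain of a chart. -/
theorem VolumeForm.integral_measure (vol : VolumeForm n M) (x : M) {h : M → ℝ}
    (hc : Continuous h) (h0 : ∀ q ∉ (extChartAt (𝓡 n) x).source, h q = 0) :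
    ∫ q, h q ∂vol.measure = ∫ y in (extChartAt (𝓡 n) x).target,
      |vol.density x ((extChartAt (𝓡 n) x).symm y)| * h ((extChartAt (𝓡 n) x).symm y) := by
  rw [← setIntegral_eq_integral_of_forall_compl_eq_zero h0, vol.restrict_measure, chartMeasure_eq,
    integral_map (vol.aemeasurable_symm_withDensity x) (by
      exact hc.stronglyMeasurable.aestronglyMeasurable),
    integral_withDensity_eq_integral_toReal_smul₀ (vol.aemeasurable_chartDensity x)
      (Eventually.of_forall fun y => ENNReal.ofReal_lt_top)]
  refine integral_congr_ae (Eventually.of_forall fun y => ?_)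
  simp only [chartDensity, smul_eq_mul]
  rw [ENNReal.toReal_ofReal (abs_nonneg _)]

theorem VolumeForm.isLocallyFiniteMeasure (vol : VolumeForm n M) :
    IsLocallyFiniteMeasure vol.measure := by
  refine ⟨fun q => ?_⟩
  set s := (extChartAt (𝓡 n) q).symm with hs
  set T := (extChartAt (𝓡 n) q).target with hT
  have hO := isOpen_extChartAt_target (I := 𝓡 n) q
  obtain ⟨K, hKc, hyK, hK⟩ := exists_compact_subset hO (mem_extChartAt_target (I := 𝓡 n) q)
  have hc : ContinuousOn (fun y => |vol.density q (s y)|) K :=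
    ((vol.contDiffOn_density q).continuousOn.abs).mono hK
  obtain ⟨C, hC⟩ := hKc.exists_bound_of_continuousOn hc
  set N := (extChartAt (𝓡 n) q).source ∩ extChartAt (𝓡 n) q ⁻¹' interior K with hN
  have hNo : IsOpen N :=
    (continuousOn_extChartAt q).isOpen_inter_preimage (isOpen_extChartAt_source q) isOpen_interior
  refine ⟨N, hNo.mem_nhds ⟨mem_extChartAt_source q, hyK⟩, ?_⟩
  have h1 : vol.measure N = vol.chartMeasure q N := by
    rw [← vol.restrict_measure q, Measure.restrict_apply hNo.measurableSet,
      inter_eq_self_of_subset_left inter_subset_left]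
  rw [h1, vol.chartMeasure_apply q hNo.measurableSet]
  have h2 : s ⁻¹' N ∩ T ⊆ K := by
    rintro y ⟨hy1, hy2⟩
    have := hy1.2
    rw [mem_preimage, (extChartAt (𝓡 n) q).right_inv hy2] at this
    exact interior_subset this
  calc ∫⁻ y in s ⁻¹' N ∩ T, vol.chartDensity q y ≤ ∫⁻ y in K, vol.chartDensity q y :=
        lintegral_mono_set h2
    _ ≤ ∫⁻ _ in K, ENNReal.ofReal C := by
        refine setLIntegral_mono' hKc.measurableSet fun y hy => ENNReal.ofReal_le_ofReal ?_
        exact (le_abs_self _).trans (hC y hy)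
    _ < ⊤ := by
        rw [setLIntegral_const]
        exact ENNReal.mul_lt_top ENNReal.ofReal_lt_top hKc.measure_lt_top

/-- The density vanishes nowhere and a nonempty open set has positive Lebesgue measure in a chart.
This upgrades almost everywhere vanishing of continuous functions to vanishing. -/
theorem VolumeForm.isOpenPosMeasure (vol : VolumeForm n M) :
    vol.measure.IsOpenPosMeasure := by
  refine ⟨fun O hO ⟨q, hq⟩ h0 => ?_⟩
  set N := O ∩ (extChartAt (𝓡 n) q).source with hN
  have hNo : IsOpen N := hO.inter (isOpen_extChartAt_source q)
  have h1 : vol.chartMeasure q N = 0 := by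
    rw [← vol.restrict_measure q]
    exact le_antisymm ((Measure.restrict_apply_le _ _).trans
      ((measure_mono inter_subset_left).trans h0.le)) zero_le
  set W := (extChartAt (𝓡 n) q).symm ⁻¹' N ∩ (extChartAt (𝓡 n) q).target with hW
  have hWo : IsOpen W := by
    rw [hW, inter_comm]
    exact isOpen_chart_inter q hNo
  have hWne : W.Nonempty := by
    refine ⟨extChartAt (𝓡 n) q q, ?_, mem_extChartAt_target q⟩
    rw [mem_preimage, (extChartAt (𝓡 n) q).left_inv (mem_extChartAt_source q)]
    exact ⟨hq, mem_extChartAt_source q⟩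
  rw [vol.chartMeasure_apply q hNo.measurableSet, lintegral_eq_zero_iff'
    ((vol.aemeasurable_chartDensity q).mono_set inter_subset_right)] at h1
  have h2 := (ae_restrict_iff' hWo.measurableSet).1 h1
  refine (hWo.measure_pos volume hWne).ne' (measure_mono_null (fun y hy => ?_) (ae_iff.1 h2))
  rw [mem_ofPred_eq, not_forall]
  refine ⟨hy, ?_⟩
  have h3 := abs_pos.2 (vol.density_ne_zero ((extChartAt (𝓡 n) q).map_target hy.2))
  exact (ENNReal.ofReal_pos.2 h3).ne'

end Measure

end SubRiem

/-! ### The divergence theorem. -/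

namespace SubRiem

/-- Integration by parts against the constant function 1. -/
theorem integral_fderiv_eq_zero {E : Type*} [NormedAddCommGroup E] [NormedSpace ℝ E]
    [FiniteDimensional ℝ E] [MeasurableSpace E] [BorelSpace E] {μ : Measure E}
    [μ.IsAddHaarMeasure] {w : E → ℝ} (hw : ContDiff ℝ 1 w) (hc : HasCompactSupport w) (v : E) :
    ∫ y, fderiv ℝ w y v ∂μ = 0 := by
  have h1 : Integrable (fun y => fderiv ℝ w y v) μ :=
    ((hw.continuous_fderiv (by simp)).clm_apply continuous_const).integrable_of_hasCompactSupport
      (hc.fderiv_apply ℝ v)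
  have h2 : Integrable w μ := hw.continuous.integrable_of_hasCompactSupport hc
  have h := integral_mul_fderiv_eq_neg_fderiv_mul_of_integrable (μ := μ) (f := fun _ => (1 : ℝ))
    (g := w) (v := v) (by simp) (by simpa using h1) (by simpa using h2)
    (fun _ _ => differentiableAt_const _) (fun y _ => hw.differentiable (by simp) y)
  simpa using h

theorem trace_eq_sum {n : ℕ} (T : Model n →L[ℝ] Model n) :
    LinearMap.trace ℝ (Model n) (T : Model n →ₗ[ℝ] Model n) =
      ∑ i, T (EuclideanSpace.single i 1) i := by
  rw [LinearMap.trace_eq_matrix_trace ℝ (EuclideanSpace.basisFun (Fin n) ℝ).toBasis, Matrix.trace]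
  simp [LinearMap.toMatrix_apply]

section Manifold

variable {n : ℕ} {M : Type*} [TopologicalSpace M] [ChartedSpace (EuclideanSpace ℝ (Fin n)) M]
    [IsManifold (𝓡 n) ∞ M]

theorem SmoothFun.mdifferentiableAt {f : M → ℝ} (hf : SmoothFun n f) (q : M) :
    MDifferentiableAt (𝓡 n) 𝓘(ℝ, ℝ) f q :=
  (ContMDiff.contMDiffAt hf).mdifferentiableAt (by simp)

theorem SmoothFun.mul {f g : M → ℝ} (hf : SmoothFun n f) (hg : SmoothFun n g) :
    SmoothFun n fun q => f q * g q := ContMDiff.mul hf hg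

theorem SmoothFun.add {f g : M → ℝ} (hf : SmoothFun n f) (hg : SmoothFun n g) :
    SmoothFun n fun q => f q + g q := ContMDiff.add hf hg

theorem SmoothFun.differentiableAt_chart {f : M → ℝ} (hf : SmoothFun n f) {x q : M}
    (hq : q ∈ (extChartAt (𝓡 n) x).source) :
    DifferentiableAt ℝ (f ∘ (extChartAt (𝓡 n) x).symm) (extChartAt (𝓡 n) x q) :=
  (hf.smoothFunOn univ).differentiableAt_chart isOpen_univ hq (mem_univ q)

theorem differential_mul {f g : M → ℝ} (hf : SmoothFun n f) (hg : SmoothFun n g) (q : M)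
    (v : TangentSpace (𝓡 n) q) : differential n (fun p => f p * g p) q v =
      f q * differential n g q v + g q * differential n f q v := by
  have hs := mem_extChartAt_source (I := 𝓡 n) q
  have hqq := (extChartAt (𝓡 n) q).left_inv hs
  rw [differential_apply hs (hf.mdifferentiableAt q), differential_apply hs (hg.mdifferentiableAt q),
    differential_apply hs ((hf.mul hg).mdifferentiableAt q)]
  have h := ((hf.differentiableAt_chart hs).hasFDerivAt.mul
    (hg.differentiableAt_chart hs).hasFDerivAt).fderiv
  refine (congrArg (fun L : Model n →L[ℝ] ℝ => L (chartDeriv q q v)) h).trans ?_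
  simp only [add_apply, smul_apply, smul_eq_mul, Function.comp_apply, hqq]

theorem differential_add {f g : M → ℝ} (hf : SmoothFun n f) (hg : SmoothFun n g) (q : M)
    (v : TangentSpace (𝓡 n) q) : differential n (fun p => f p + g p) q v =
      differential n f q v + differential n g q v := by
  have hs := mem_extChartAt_source (I := 𝓡 n) q
  rw [differential_apply hs (hf.mdifferentiableAt q), differential_apply hs (hg.mdifferentiableAt q),
    differential_apply hs ((hf.add hg).mdifferentiableAt q)]
  have h := ((hf.differentiableAt_chart hs).hasFDerivAt.add
    (hg.differentiableAt_chart hs).hasFDerivAt).fderiv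
  exact (congrArg (fun L : Model n →L[ℝ] ℝ => L (chartDeriv q q v)) h).trans (add_apply _ _ _)

theorem differential_congr {f g : M → ℝ} {q : M} (h : f =ᶠ[𝓝 q] g) :
    differential n f q = differential n g q := h.mfderiv_eq

theorem differential_eq_zero_of_notMem_tsupport {f : M → ℝ} {q : M} (h : q ∉ tsupport f)
    (v : TangentSpace (𝓡 n) q) : differential n f q v = 0 := by
  have h1 : f =ᶠ[𝓝 q] fun _ => 0 := notMem_tsupport_iff_eventuallyEq.1 h
  rw [differential_congr h1]
  exact congrArg (fun L : Model n →L[ℝ] ℝ => L v) (mfderiv_const (I := 𝓡 n) (x := q) (c := (0 : ℝ)))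

theorem IsLocallySumOfSquares.smoothFun {m : ℕ} {P : (M → ℝ) → M → ℝ}
    {σ : ∀ q : M, Cotangent n q → ℝ} (hP : IsLocallySumOfSquares m P σ) {f : M → ℝ}
    (hf : SmoothFun n f) : SmoothFun n (P f) := by
  intro q
  obtain ⟨U, hU, hq, Z, a, hZ, ha, hform, -⟩ := hP q
  have hf' := hf.smoothFunOn U
  have h1 : ∀ i, SmoothFunOn n (fieldDeriv (Z i) f) U := fun i => (hZ i).smooth_fieldDeriv hU hf'
  have h2 : SmoothFunOn n (fun q => ∑ i, fieldDeriv (Z i) (fieldDeriv (Z i) f) q +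
      ∑ i, a i q * fieldDeriv (Z i) f q) U :=
    ContMDiffOn.add (contMDiffOn_finsetSum fun i _ => (hZ i).smooth_fieldDeriv hU (h1 i))
      (contMDiffOn_finsetSum fun i _ => ContMDiffOn.mul (ha i) (h1 i))
  have h3 : SmoothFunOn n (P f) U := ContMDiffOn.congr h2 fun p hp => hform U hU subset_rfl f hf' p hp
  exact h3.contMDiffAt hU hq

theorem SmoothFun.continuous {f : M → ℝ} (hf : SmoothFun n f) : Continuous f :=
  ContMDiff.continuous hf

theorem smoothFun_fieldDeriv {Y : ∀ q : M, TangentSpace (𝓡 n) q} (hY : SmoothFieldOn Y univ)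
    {h : M → ℝ} (hh : SmoothFun n h) : SmoothFun n (fieldDeriv Y h) :=
  contMDiffOn_univ.1 (hY.smooth_fieldDeriv isOpen_univ (hh.smoothFunOn univ))

variable [T2Space M] [MeasurableSpace M] [BorelSpace M]

/-- The divergence theorem for functions supported in the domain of a chart. -/
theorem VolumeForm.integral_div_chart (vol : VolumeForm n M) {Y : ∀ q : M, TangentSpace (𝓡 n) q}
    (hY : SmoothFieldOn Y univ) (hdiv : Continuous (vol.div Y)) {h : M → ℝ} (hh : SmoothFun n h)
    (hc : HasCompactSupport h) {x : M} (hx : tsupport h ⊆ (extChartAt (𝓡 n) x).source) :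
    ∫ q, (h q * vol.div Y q + fieldDeriv Y h q) ∂vol.measure = 0 := by
  have hcont : Continuous fun q => h q * vol.div Y q + fieldDeriv Y h q :=
    (hh.continuous.mul hdiv).add (smoothFun_fieldDeriv hY hh).continuous
  have hzero : ∀ q ∉ tsupport h, h q * vol.div Y q + fieldDeriv Y h q = 0 := by
    intro q hq
    rw [image_eq_zero_of_notMem_tsupport hq, zero_mul, zero_add]
    exact differential_eq_zero_of_notMem_tsupport hq _
  rw [vol.integral_measure x hcont fun q hq => hzero q fun hq' => hq (hx hq')]
  set T := (extChartAt (𝓡 n) x).target with hT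
  set s := (extChartAt (𝓡 n) x).symm with hs
  have hTo : IsOpen T := isOpen_extChartAt_target x
  have hsrc : ∀ {y}, y ∈ T → s y ∈ (extChartAt (𝓡 n) x).source := fun hy =>
    (extChartAt (𝓡 n) x).map_target hy
  set δ : Model n → ℝ := vol.density x ∘ s with hδ
  have hδs : ContDiffOn ℝ ∞ δ T := vol.contDiffOn_density x
  have hδ0 : ∀ y ∈ T, δ y ≠ 0 := fun y hy => vol.density_ne_zero (hsrc hy)
  have huniv : T ∩ s ⁻¹' univ = T := by simp
  have hYs : ContDiffOn ℝ ∞ (chartRep x Y) T := by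
    have := hY.contDiffOn_chartRep isOpen_univ x
    rwa [huniv] at this
  have hhs : ContDiffOn ℝ ∞ (h ∘ s) T := by
    have := (hh.smoothFunOn univ).contDiffOn_chart x
    rwa [huniv] at this
  -- the compactly supported field
  set K : Set (Model n) := extChartAt (𝓡 n) x '' tsupport h with hK
  have hKc : IsCompact K := IsCompact.image_of_continuousOn hc ((continuousOn_extChartAt x).mono hx)
  have hKT : K ⊆ T := by
    rintro _ ⟨q, hq, rfl⟩
    exact (extChartAt (𝓡 n) x).map_source (hx hq)
  have hsK : ∀ y ∈ T, y ∉ K → s y ∉ tsupport h := fun y hy hyK hq =>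
    hyK ⟨s y, hq, (extChartAt (𝓡 n) x).right_inv hy⟩
  classical
  -- The field |δ| h Y in coordinates, extended by zero. Its Euclidean divergence is the integrand
  -- times the density, so the claim reduces to ℝⁿ.
  set W : Model n → Model n := fun y => if y ∈ T then (|δ y| * (h ∘ s) y) • chartRep x Y y else 0
    with hW
  have hWT : ∀ y ∈ T, W y = (|δ y| * (h ∘ s) y) • chartRep x Y y := fun y hy => if_pos hy
  have hWK : ∀ y ∉ K, W y = 0 := by
    intro y hy
    by_cases hyT : y ∈ T
    · rw [hWT y hyT, Function.comp_apply, image_eq_zero_of_notMem_tsupport (hsK y hyT hy), mul_zero,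
        zero_smul]
    · exact if_neg hyT
  have hWK' : ∀ y ∉ K, W =ᶠ[𝓝 y] fun _ => 0 := fun y hy => by
    filter_upwards [hKc.isClosed.isOpen_compl.mem_nhds hy] with z hz using hWK z hz
  -- the absolute value of the density
  have habs : ∀ y ∈ T, ∃ c : ℝ, c * δ y = |δ y| ∧ ∀ᶠ z in 𝓝 y, |δ z| = c * δ z := by
    intro y hy
    have hct : ContinuousAt δ y := (hδs.continuousOn).continuousAt (hTo.mem_nhds hy)
    rcases lt_or_gt_of_ne (hδ0 y hy) with h0 | h0
    · refine ⟨-1, by rw [abs_of_neg h0]; ring, ?_⟩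
      filter_upwards [hct.eventually_lt_const h0] with z hz
      rw [abs_of_neg hz]
      ring
    · refine ⟨1, by rw [abs_of_pos h0]; ring, ?_⟩
      filter_upwards [hct.eventually_const_lt h0] with z hz
      rw [abs_of_pos hz]
      ring
  -- Near each point |δ| is a constant sign times δ, so W is smooth despite the absolute value.
  have hloc : ∀ y ∈ T, ∃ c : ℝ, c * δ y = |δ y| ∧
      W =ᶠ[𝓝 y] fun z => (c * δ z * (h ∘ s) z) • chartRep x Y z := by
    intro y hy
    obtain ⟨c, hc1, hc2⟩ := habs y hy
    refine ⟨c, hc1, ?_⟩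
    filter_upwards [hc2, hTo.mem_nhds hy] with z hz hzT
    rw [hWT z hzT, hz]
  have hWs : ContDiff ℝ ∞ W := by
    rw [contDiff_iff_contDiffAt]
    intro y
    by_cases hyK : y ∈ K
    · have hy := hKT hyK
      obtain ⟨c, -, hc2⟩ := hloc y hy
      have hn := hTo.mem_nhds hy
      exact ((((contDiffAt_const.mul (hδs.contDiffAt hn)).mul (hhs.contDiffAt hn))).smul
        (hYs.contDiffAt hn)).congr_of_eventuallyEq hc2
    · exact contDiffAt_const.congr_of_eventuallyEq (hWK' y hyK)
  have hWc : HasCompactSupport W := HasCompactSupport.intro hKc fun y hy => hWK y hy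
  -- Leibniz: div W collects h times (δ tr DY + Dδ(Y)), which is h δ div_ω(Y), and δ Y h, all with
  -- the local sign.
  have htr : ∀ y ∈ T, |vol.density x (s y)| * (h (s y) * vol.div Y (s y) + fieldDeriv Y h (s y)) =
      ∑ i, fderiv ℝ W y (EuclideanSpace.single i 1) i := by
    intro y hy
    obtain ⟨c, hc1, hc2⟩ := hloc y hy
    have hn := hTo.mem_nhds hy
    have d1 := ((hδs.contDiffAt hn).differentiableAt (by simp)).hasFDerivAt
    have d2 := ((hhs.contDiffAt hn).differentiableAt (by simp)).hasFDerivAt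
    have d3 := ((hYs.contDiffAt hn).differentiableAt (by simp)).hasFDerivAt
    have d4 : HasFDerivAt (fun z => (c * δ z * (h ∘ s) z) • chartRep x Y z) _ y :=
      ((d1.const_mul c).mul d2).smul d3
    have e1 : fieldDeriv Y h (s y) = fderiv ℝ (h ∘ s) y (chartRep x Y y) :=
      fieldDeriv_comp_symm isOpen_univ (hh.smoothFunOn univ) ⟨hy, mem_univ _⟩
    have e2 : vol.div Y (s y) * δ y = vol.chartDiv x Y y := by
      have := vol.div_mul_density isOpen_univ hY (mem_univ (s y)) (hsrc hy)
      rwa [(extChartAt (𝓡 n) x).right_inv hy] at this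
    have e3 : ∀ i, fderiv ℝ W y (EuclideanSpace.single i 1) i =
        c * δ y * (h ∘ s) y * fderiv ℝ (chartRep x Y) y (EuclideanSpace.single i 1) i +
        (chartRep x Y y i * (fderiv ℝ (h ∘ s) y (EuclideanSpace.single i 1))) * (c * δ y) +
        (chartRep x Y y i * (fderiv ℝ δ y (EuclideanSpace.single i 1))) * ((h ∘ s) y * c) := by
      intro i
      rw [hc2.fderiv_eq, d4.fderiv]
      simp
      ring
    rw [Finset.sum_congr rfl fun i _ => e3 i, Finset.sum_add_distrib, Finset.sum_add_distrib,
      ← Finset.sum_mul, ← Finset.sum_mul, ← Finset.mul_sum, ← fderiv_eq_sum, ← fderiv_eq_sum,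
      ← trace_eq_sum]
    rw [VolumeForm.chartDiv] at e2
    have e4 : |vol.density x (s y)| = c * δ y := hc1.symm
    rw [e4, e1]
    have e5 : h (s y) = (h ∘ s) y := rfl
    rw [e5]
    change _ = fderiv ℝ δ y (chartRep x Y y) + δ y * _ at e2
    linear_combination c * (h ∘ s) y * e2
  rw [setIntegral_congr_fun hTo.measurableSet htr]
  have hout : ∀ y ∉ T, ∑ i, fderiv ℝ W y (EuclideanSpace.single i 1) i = 0 := by
    intro y hy
    rw [(hWK' y fun hyK => hy (hKT hyK)).fderiv_eq]
    simp
  rw [setIntegral_eq_integral_of_forall_compl_eq_zero hout]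
  have hpr : ∀ i y, fderiv ℝ W y (EuclideanSpace.single i 1) i =
      fderiv ℝ (fun z => W z i) y (EuclideanSpace.single i 1) := by
    intro i y
    have := ((EuclideanSpace.proj (𝕜 := ℝ) i : Model n →L[ℝ] ℝ).hasFDerivAt.comp y
      (hWs.differentiable (by simp) y).hasFDerivAt).fderiv
    exact (congrArg (fun L : Model n →L[ℝ] ℝ => L (EuclideanSpace.single i 1)) this).symm
  have hWi : ∀ i, ContDiff ℝ ∞ fun z => W z i := fun i =>
    (EuclideanSpace.proj (𝕜 := ℝ) i : Model n →L[ℝ] ℝ).contDiff.comp hWs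
  have hWic : ∀ i, HasCompactSupport fun z => W z i := fun i =>
    hWc.comp_left (g := fun v : Model n => v i) rfl
  simp only [hpr]
  rw [integral_finsetSum _ fun i _ => (((hWi i).continuous_fderiv (by simp)).clm_apply
    continuous_const).integrable_of_hasCompactSupport ((hWic i).fderiv_apply ℝ _)]
  exact Finset.sum_eq_zero fun i _ =>
    integral_fderiv_eq_zero ((hWi i).of_le (by simp)) (hWic i) _

/-- The divergence theorem. -/
theorem VolumeForm.integral_div (vol : VolumeForm n M) {Y : ∀ q : M, TangentSpace (𝓡 n) q}
    (hY : SmoothFieldOn Y univ) (hdiv : Continuous (vol.div Y)) {h : M → ℝ} (hh : SmoothFun n h)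
    (hc : HasCompactSupport h) :
    ∫ q, (h q * vol.div Y q + fieldDeriv Y h q) ∂vol.measure = 0 := by
  classical
  have hfin := vol.isLocallyFiniteMeasure
  have hb : ∀ x : M, ∃ ρ : M → ℝ, SmoothFun n ρ ∧ tsupport ρ ⊆ (extChartAt (𝓡 n) x).source ∧
      ∀ᶠ q in 𝓝 x, ρ q = 1 := by
    intro x
    obtain ⟨ρ, -, hρ⟩ := (SmoothBumpFunction.nhds_basis_tsupport (I := 𝓡 n) x).mem_iff.1
      ((isOpen_extChartAt_source x).mem_nhds (mem_extChartAt_source (I := 𝓡 n) x))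
    exact ⟨ρ, ρ.contMDiff, hρ, ρ.eventuallyEq_one⟩
  choose ρ hρs hρt hρ1 using hb
  -- Induction on the number of charts needed to cover {h ≠ 0}. Splitting h = hρ + h(1 - ρ), the
  -- first part lives in one chart and the second vanishes where ρ = 1, so it needs one chart fewer.
  have key : ∀ (t : Finset M) (h : M → ℝ), SmoothFun n h → HasCompactSupport h →
      (∀ q, h q ≠ 0 → ∃ x ∈ t, ρ x q = 1) →
      ∫ q, (h q * vol.div Y q + fieldDeriv Y h q) ∂vol.measure = 0 := by
    intro t
    induction t using Finset.induction_on with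
    | empty =>
      intro h hh hc h0
      have h1 : h = fun _ => 0 := funext fun q => by
        by_contra hq
        obtain ⟨x, hx, -⟩ := h0 q hq
        simp at hx
      refine integral_eq_zero_of_ae (Eventually.of_forall fun q => ?_)
      have h2 : q ∉ tsupport h := by
        rw [notMem_tsupport_iff_eventuallyEq, h1]
        exact EventuallyEq.rfl
      change h q * vol.div Y q + differential n h q (Y q) = 0
      rw [differential_eq_zero_of_notMem_tsupport h2, image_eq_zero_of_notMem_tsupport h2]
      ring
    | insert x t hxt ih =>
      intro h hh hc h0
      have hr : SmoothFun n fun q => 1 - ρ x q := contMDiff_const.sub (hρs x)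
      have hc1 : HasCompactSupport fun q => h q * ρ x q := hc.mul_right
      have hc2 : HasCompactSupport fun q => h q * (1 - ρ x q) := hc.mul_right
      have h1 := vol.integral_div_chart hY hdiv (hh.mul (hρs x)) hc1 (x := x)
        ((tsupport_mul_subset_right (f := h) (g := ρ x)).trans (hρt x))
      have h2 := ih (fun q => h q * (1 - ρ x q)) (hh.mul hr) hc2 fun q hq => by
        obtain ⟨z, hz, hz1⟩ := h0 q (left_ne_zero_of_mul hq)
        rcases Finset.mem_insert.1 hz with rfl | hz
        · exact absurd (by rw [hz1, sub_self]) (right_ne_zero_of_mul hq)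
        · exact ⟨z, hz, hz1⟩
      have hint : ∀ g : M → ℝ, SmoothFun n g → HasCompactSupport g →
          Integrable (fun q => g q * vol.div Y q + fieldDeriv Y g q) vol.measure := by
        intro g hg hgc
        have hcont : Continuous fun q => g q * vol.div Y q + fieldDeriv Y g q :=
          (hg.continuous.mul hdiv).add (smoothFun_fieldDeriv hY hg).continuous
        refine hcont.integrable_of_hasCompactSupport (HasCompactSupport.intro hgc fun q hq => ?_)
        change g q * vol.div Y q + differential n g q (Y q) = 0
        rw [differential_eq_zero_of_notMem_tsupport hq, image_eq_zero_of_notMem_tsupport hq]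
        ring
      have h3 := integral_add (hint _ (hh.mul (hρs x)) hc1) (hint _ (hh.mul hr) hc2)
      rw [h1, h2, add_zero] at h3
      rw [← h3]
      refine integral_congr_ae (Eventually.of_forall fun q => ?_)
      have h4 : h = fun q => h q * ρ x q + h q * (1 - ρ x q) := funext fun q => by ring
      have h5 : fieldDeriv Y h q = fieldDeriv Y (fun q => h q * ρ x q) q +
          fieldDeriv Y (fun q => h q * (1 - ρ x q)) q := by
        have := differential_add (hh.mul (hρs x)) (hh.mul hr) q (Y q)
        rw [← h4] at this
        exact this
      simp only [h5]
      ring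
  obtain ⟨t, -, ht⟩ := IsCompact.elim_nhds_subcover hc (fun x => {q | ρ x q = 1})
    fun x _ => hρ1 x
  refine key t h hh hc fun q hq => ?_
  have := ht (subset_tsupport h hq)
  simpa using this

end Manifold

end SubRiem

namespace SubRiem

/-! ### Test functions, symmetry and the equivalences. -/

section Manifold

variable {n : ℕ} {M : Type*} [TopologicalSpace M] [ChartedSpace (EuclideanSpace ℝ (Fin n)) M]
    [IsManifold (𝓡 n) ∞ M] [T2Space M]

/-- Differentials of compactly supported functions separate tangent vectors. -/
theorem eq_zero_of_differential_eq_zero {q : M} {v : TangentSpace (𝓡 n) q}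
    (h : ∀ f : M → ℝ, SmoothFun n f → HasCompactSupport f → differential n f q v = 0) : v = 0 := by
  have hs := mem_extChartAt_source (I := 𝓡 n) q
  obtain ⟨ρ, -, -⟩ := (SmoothBumpFunction.nhds_basis_tsupport (I := 𝓡 n) q).mem_iff.1 univ_mem
  have h1 : ∀ i, chartDeriv q q v i = 0 := by
    intro i
    have hc := smooth_coordFun q i
    have hsm : SmoothFun n fun p => ρ p • coordFun q i p := by
      refine ρ.contMDiff_smul ?_
      rw [← extChartAt_source (𝓡 n)]
      exact hc
    have hcs : HasCompactSupport fun p => ρ p • coordFun q i p :=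
      ρ.hasCompactSupport.smul_right
    have h2 := h _ hsm hcs
    have h3 : (fun p => ρ p • coordFun q i p) =ᶠ[𝓝 q] coordFun q i := by
      filter_upwards [ρ.eventuallyEq_one] with p hp
      rw [hp]
      simp
    rw [differential_congr h3, differential_apply hs
      (hc.mdifferentiableAt (isOpen_extChartAt_source q) hs)] at h2
    have h4 : coordFun q i ∘ (extChartAt (𝓡 n) q).symm =ᶠ[𝓝 (extChartAt (𝓡 n) q q)]
        (EuclideanSpace.proj (𝕜 := ℝ) i : Model n →L[ℝ] ℝ) := by
      filter_upwards [(isOpen_extChartAt_target q).mem_nhds (mem_extChartAt_target q)] with w hw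
      exact coordFun_comp_symm q i hw
    rw [h4.fderiv_eq, ContinuousLinearMap.fderiv] at h2
    exact h2
  have h5 : chartDeriv q q v = 0 := by
    ext i
    exact h1 i
  have h6 := chartDeriv_inverse_apply hs v
  rw [h5, map_zero] at h6
  exact h6.symm

variable [SecondCountableTopology M] [MeasurableSpace M] [BorelSpace M]

/-- A continuous function that is orthogonal to all test functions vanishes. -/
theorem VolumeForm.eq_zero_of_integral_eq_zero (vol : VolumeForm n M) {h : M → ℝ}
    (hc : Continuous h)
    (h0 : ∀ f : M → ℝ, SmoothFun n f → HasCompactSupport f → ∫ q, f q * h q ∂vol.measure = 0) :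
    h = fun _ => 0 := by
  have hfin := vol.isLocallyFiniteMeasure
  have hpos := vol.isOpenPosMeasure
  have hlc : LocallyCompactSpace M := ChartedSpace.locallyCompactSpace (Model n) M
  have hae := ae_eq_zero_of_integral_contMDiff_smul_eq_zero (𝓡 n) (μ := vol.measure)
    (f := h) hc.locallyIntegrable h0
  exact (Continuous.ae_eq_iff_eq vol.measure hc continuous_const).1 hae

end Manifold

namespace Structure

variable {n k : ℕ} {M : Type*} [TopologicalSpace M] [ChartedSpace (EuclideanSpace ℝ (Fin n)) M]
    [IsManifold (𝓡 n) ∞ M] {S : Structure n k M} [T2Space M] [SecondCountableTopology M]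
    [MeasurableSpace M] [BorelSpace M]

theorem smoothFieldOn_grad {f : M → ℝ} (hf : SmoothFun n f) : SmoothFieldOn (S.grad f) univ := by
  intro q _
  obtain ⟨U, hU, hq, X, hX⟩ := S.hasHorizontalFrames q
  have h := smooth_grad hX hU (hf.smoothFunOn U)
  exact (ContMDiffOn.contMDiffAt h (hU.mem_nhds hq)).contMDiffWithinAt

theorem fieldDeriv_grad_comm (f g : M → ℝ) (q : M) :
    fieldDeriv (S.grad f) g q = fieldDeriv (S.grad g) f q := by
  obtain ⟨U, -, hq, X, hX⟩ := S.hasHorizontalFrames q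
  rw [fieldDeriv, fieldDeriv, differential_grad hX _ _ hq, differential_grad hX _ _ hq]
  exact Finset.sum_congr rfl fun i _ => mul_comm _ _

/-- Green's identity: ∫ h Δf = -∫ dh(grad f), and dh(grad f) is symmetric in f and h. The complement
serves only to provide adapted frames, through which Δf is seen to be smooth. -/
theorem macroLaplacian_symmetric (V : S.Complement) (vol : VolumeForm n M) :
    IsSymmetricL2 vol (S.macroLaplacian vol) := by
  have hfin := vol.isLocallyFiniteMeasure
  have hsm : ∀ {f : M → ℝ}, SmoothFun n f → SmoothFun n (S.macroLaplacian vol f) := fun hf =>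
    (isLocallySumOfSquares_macroLaplacian V vol).smoothFun hf
  have green : ∀ f h : M → ℝ, SmoothFun n f → SmoothFun n h → HasCompactSupport h →
      ∫ q, h q * S.macroLaplacian vol f q ∂vol.measure =
        -∫ q, fieldDeriv (S.grad f) h q ∂vol.measure := by
    intro f h hf hh hc
    have hY := smoothFieldOn_grad (S := S) hf
    have hdiv : Continuous (vol.div (S.grad f)) := (hsm hf).continuous
    have h1 := vol.integral_div hY hdiv hh hc
    have i1 : Integrable (fun q => h q * vol.div (S.grad f) q) vol.measure :=
      (hh.continuous.mul hdiv).integrable_of_hasCompactSupport hc.mul_right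
    have i2 : Integrable (fieldDeriv (S.grad f) h) vol.measure :=
      (smoothFun_fieldDeriv hY hh).continuous.integrable_of_hasCompactSupport
        (HasCompactSupport.intro hc fun q hq => differential_eq_zero_of_notMem_tsupport hq _)
    rw [integral_add i1 i2] at h1
    exact eq_neg_of_add_eq_zero_left h1
  intro f₁ f₂ hf₁ hc₁ hf₂ hc₂
  rw [green f₂ f₁ hf₂ hf₁ hc₁]
  have h1 := green f₁ f₂ hf₁ hf₂ hc₂
  simp only [mul_comm (f₂ _)] at h1
  rw [h1]
  congr 1
  exact integral_congr_ae (Eventually.of_forall fun q => fieldDeriv_grad_comm _ _ _)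

variable {V : S.Complement} {μ : ∀ q : M, Measure (Cotangent n q)}


theorem tendsto_microLaplacian (hμ : V.IsAdapted μ) (hk : 1 ≤ k) {f : M → ℝ}
    (hf : SmoothFun n f) (q : M) :
    Tendsto (S.microQuotient μ f q) (𝓝[>] (0 : ℝ)) (𝓝 (S.microLaplacian μ f q)) := by
  have : Nonempty M := ⟨q⟩
  obtain ⟨U, hU, hq, X, hX⟩ := V.exists_adaptedFrame q
  have h := tendsto_microQuotient_adapted hμ hk S.rank_le hX hU subset_rfl (hf.smoothFunOn U) hq
  rw [microLaplacian, h.limUnder_eq]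
  exact h

/-- The difference of the two Laplacians. -/
theorem macroLaplacian_sub_microLaplacian (vol : VolumeForm n M) (hμ : V.IsAdapted μ) (hk : 1 ≤ k)
    {U : Set M} (hU : IsOpen U) {X : Fin n → ∀ q : M, TangentSpace (𝓡 n) q}
    (hX : V.IsAdaptedFrame U X) {f : M → ℝ} (hf : SmoothFun n f) {q : M} (hq : q ∈ U) :
    S.macroLaplacian vol f q - S.microLaplacian μ f q =
      differential n f q (V.chi vol hX q) := by
  have : Nonempty M := ⟨q⟩
  have hf' := hf.smoothFunOn U
  rw [← macroLaplacian_sub_microOp vol S.rank_le hX hU hf' hq, microLaplacian,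
    (tendsto_microQuotient_adapted hμ hk S.rank_le hX hU subset_rfl hf' hq).limUnder_eq]

/-- The difference D is a derivation, and it is symmetric when both Laplacians are. A symmetric
derivation vanishes. -/
theorem microLaplacian_eq_of_symmetric (vol : VolumeForm n M) (hμ : V.IsAdapted μ) (hk : 1 ≤ k)
    (hsym : IsSymmetricL2 vol (S.microLaplacian μ)) {f : M → ℝ} (hf : SmoothFun n f) :
    S.microLaplacian μ f = S.macroLaplacian vol f := by
  have hfin := vol.isLocallyFiniteMeasure
  set D : (M → ℝ) → M → ℝ := fun f q => S.macroLaplacian vol f q - S.microLaplacian μ f q with hD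
  have hMs : ∀ {f : M → ℝ}, SmoothFun n f → SmoothFun n (S.macroLaplacian vol f) := fun hf =>
    (isLocallySumOfSquares_macroLaplacian V vol).smoothFun hf
  have hms : ∀ {f : M → ℝ}, SmoothFun n f → SmoothFun n (S.microLaplacian μ f) := fun hf =>
    (isLocallySumOfSquares_microLaplacian vol hμ hk).smoothFun hf
  have hDc : ∀ {f : M → ℝ}, SmoothFun n f → Continuous (D f) := fun hf =>
    (hMs hf).continuous.sub (hms hf).continuous
  have hmul : ∀ {f g : M → ℝ}, SmoothFun n f → SmoothFun n g → ∀ q,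
      D (fun p => f p * g p) q = f q * D g q + g q * D f q := by
    intro f g hf hg q
    obtain ⟨U, hU, hq, X, hX⟩ := V.exists_adaptedFrame q
    simp only [hD]
    rw [macroLaplacian_sub_microLaplacian vol hμ hk hU hX (hf.mul hg) hq,
      macroLaplacian_sub_microLaplacian vol hμ hk hU hX hf hq,
      macroLaplacian_sub_microLaplacian vol hμ hk hU hX hg hq]
    exact differential_mul hf hg q _
  have hint : ∀ {f g : M → ℝ}, Continuous f → Continuous g → HasCompactSupport g →
      Integrable (fun q => f q * g q) vol.measure := fun hf hg hgc =>
    (hf.mul hg).integrable_of_hasCompactSupport hgc.mul_left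
  have hDsym : ∀ f₁ f₂ : M → ℝ, SmoothFun n f₁ → HasCompactSupport f₁ → SmoothFun n f₂ →
      HasCompactSupport f₂ →
      ∫ q, D f₁ q * f₂ q ∂vol.measure = ∫ q, D f₂ q * f₁ q ∂vol.measure := by
    intro f₁ f₂ hf₁ hc₁ hf₂ hc₂
    have h1 := macroLaplacian_symmetric V vol f₁ f₂ hf₁ hc₁ hf₂ hc₂
    have h2 := hsym f₁ f₂ hf₁ hc₁ hf₂ hc₂
    simp only [mul_comm (f₁ _)] at h1 h2
    simp only [hD, sub_mul]
    rw [integral_sub (hint (hMs hf₁).continuous hf₂.continuous hc₂)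
      (hint (hms hf₁).continuous hf₂.continuous hc₂),
      integral_sub (hint (hMs hf₂).continuous hf₁.continuous hc₁)
      (hint (hms hf₂).continuous hf₁.continuous hc₁), h1, h2]
  -- Symmetry for the pairs (fφ, ψ) and (φ, fψ) expresses the integral of φψ Df as B - A and as A -
  -- B, where A = ∫ fψ Dφ and B = ∫ fφ Dψ. Only φ and ψ need compact support.
  have key : ∀ φ ψ : M → ℝ, SmoothFun n φ → HasCompactSupport φ → SmoothFun n ψ →
      HasCompactSupport ψ → ∫ q, ψ q * (φ q * D f q) ∂vol.measure = 0 := by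
    intro φ ψ hφ hφc hψ hψc
    have e1 := hDsym (fun p => f p * φ p) ψ (hf.mul hφ) hφc.mul_left hψ hψc
    have e2 := hDsym φ (fun p => f p * ψ p) hφ hφc (hf.mul hψ) hψc.mul_left
    simp only [hmul hf hφ, hmul hf hψ] at e1 e2
    have i1 : Integrable (fun q => (f q * D φ q) * ψ q) vol.measure :=
      hint (hf.continuous.mul (hDc hφ)) hψ.continuous hψc
    have i2 : Integrable (fun q => (φ q * D f q) * ψ q) vol.measure :=
      hint (hφ.continuous.mul (hDc hf)) hψ.continuous hψc
    have i3 : Integrable (fun q => (f q * D ψ q) * φ q) vol.measure :=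
      hint (hf.continuous.mul (hDc hψ)) hφ.continuous hφc
    have i4 : Integrable (fun q => (ψ q * D f q) * φ q) vol.measure :=
      hint (hψ.continuous.mul (hDc hf)) hφ.continuous hφc
    have f1 : ∫ q, (f q * D φ q + φ q * D f q) * ψ q ∂vol.measure =
        ∫ q, (f q * D φ q) * ψ q ∂vol.measure + ∫ q, (φ q * D f q) * ψ q ∂vol.measure := by
      rw [← integral_add i1 i2]
      exact integral_congr_ae (Eventually.of_forall fun q => add_mul _ _ _)
    have f2 : ∫ q, (f q * D ψ q + ψ q * D f q) * φ q ∂vol.measure =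
        ∫ q, (f q * D ψ q) * φ q ∂vol.measure + ∫ q, (ψ q * D f q) * φ q ∂vol.measure := by
      rw [← integral_add i3 i4]
      exact integral_congr_ae (Eventually.of_forall fun q => add_mul _ _ _)
    have g1 : ∫ q, D ψ q * (f q * φ q) ∂vol.measure = ∫ q, (f q * D ψ q) * φ q ∂vol.measure :=
      integral_congr_ae (Eventually.of_forall fun q => by ring)
    have g2 : ∫ q, D φ q * (f q * ψ q) ∂vol.measure = ∫ q, (f q * D φ q) * ψ q ∂vol.measure :=
      integral_congr_ae (Eventually.of_forall fun q => by ring)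
    have g3 : ∫ q, (ψ q * D f q) * φ q ∂vol.measure = ∫ q, ψ q * (φ q * D f q) ∂vol.measure :=
      integral_congr_ae (Eventually.of_forall fun q => by ring)
    have g4 : ∫ q, (φ q * D f q) * ψ q ∂vol.measure = ∫ q, ψ q * (φ q * D f q) ∂vol.measure :=
      integral_congr_ae (Eventually.of_forall fun q => by ring)
    linarith
  funext q
  -- Taking φ = ρ, a bump function equal to 1 at q, makes ρ Df orthogonal to all test functions,
  -- hence zero.
  obtain ⟨ρ, -, -⟩ := (SmoothBumpFunction.nhds_basis_tsupport (I := 𝓡 n) q).mem_iff.1 univ_mem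
  have hρ : SmoothFun n (ρ : M → ℝ) := ρ.contMDiff
  have h1 := vol.eq_zero_of_integral_eq_zero (h := fun p => ρ p * D f p)
    (hρ.continuous.mul (hDc hf)) fun ψ hψ hψc => key ρ ψ hρ ρ.hasCompactSupport hψ hψc
  have h2 := congrFun h1 q
  simp only [ρ.eq_one, one_mul, hD] at h2
  linarith

end Structure

end SubRiem

end

theorem theoremt {n k : ℕ} (hk : 1 ≤ k) {M : Type*} [TopologicalSpace M]
    [ChartedSpace (EuclideanSpace ℝ (Fin n)) M] [IsManifold (𝓡 n) ∞ M]
    [T2Space M] [SecondCountableTopology M] [ConnectedSpace M]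
    [MeasurableSpace M] [BorelSpace M]
    (S : SubRiem.Structure n k M) (V : S.Complement) (vol : SubRiem.VolumeForm n M)
    (μ : ∀ q : M, Measure (SubRiem.Cotangent n q)) (hμ : V.IsAdapted μ) :
    -- the limit that defines `L^V` exists, for every smooth function at every point
    (∀ φ : M → ℝ, SubRiem.SmoothFun n φ → ∀ q : M,
      Tendsto (S.microQuotient μ φ q) (𝓝[>] (0 : ℝ)) (𝓝 (S.microLaplacian μ φ q))) ∧
    -- same principal symbol `2H` and no constant term
    SubRiem.IsSecondOrderOperator (S.microLaplacian μ) (fun q ξ => 2 * S.hamiltonian q ξ) (fun _ => 0) ∧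
    SubRiem.IsSecondOrderOperator (S.macroLaplacian vol) (fun q ξ => 2 * S.hamiltonian q ξ) (fun _ => 0) ∧
    -- the formula for `χ = Δ_ω - L^V` in every local adapted frame
    (∀ (U : Set M) (_ : IsOpen U) (X : Fin n → ∀ q : M, TangentSpace (𝓡 n) q)
      (hX : V.IsAdaptedFrame U X) (f : M → ℝ), SubRiem.SmoothFun n f → ∀ q ∈ U,
      S.macroLaplacian vol f q - S.microLaplacian μ f q = SubRiem.differential n f q (V.chi vol hX q)) ∧
    -- the equivalences
    List.TFAE [
      SubRiem.IsSymmetricL2 vol (S.microLaplacian μ),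
      ∀ f : M → ℝ, SubRiem.SmoothFun n f → HasCompactSupport f →
        S.microLaplacian μ f = S.macroLaplacian vol f,
      ∀ f : M → ℝ, SubRiem.SmoothFun n f → S.microLaplacian μ f = S.macroLaplacian vol f,
      ∀ (U : Set M) (_ : IsOpen U) (X : Fin n → ∀ q : M, TangentSpace (𝓡 n) q)
        (hX : V.IsAdaptedFrame U X), ∀ q ∈ U, V.chi vol hX q = 0] := by
  have hkey := fun (U : Set M) (hU : IsOpen U) (X : Fin n → ∀ q : M, TangentSpace (𝓡 n) q)
    (hX : V.IsAdaptedFrame U X) (f : M → ℝ) (hf : SubRiem.SmoothFun n f) (q : M) (hq : q ∈ U) =>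
    SubRiem.Structure.macroLaplacian_sub_microLaplacian (S := S) vol hμ hk hU hX hf hq
  refine ⟨fun φ hφ q => SubRiem.Structure.tendsto_microLaplacian hμ hk hφ q,
    (SubRiem.Structure.isLocallySumOfSquares_microLaplacian vol hμ hk).isSecondOrderOperator,
    (SubRiem.Structure.isLocallySumOfSquares_macroLaplacian V vol).isSecondOrderOperator,
    hkey, ?_⟩
  tfae_have 1 → 3 := fun h f hf =>
    SubRiem.Structure.microLaplacian_eq_of_symmetric vol hμ hk h hf
  tfae_have 3 → 2 := fun h f hf _ => h f hf
  tfae_have 2 → 4 := by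
    -- By the formula for the difference, χ annihilates every test function at q, and differentials
    -- of test functions separate tangent vectors.
    intro h U hU X hX q hq
    refine SubRiem.eq_zero_of_differential_eq_zero fun f hf hc => ?_
    rw [← hkey U hU X hX f hf q hq, h f hf hc, sub_self]
  tfae_have 4 → 3 := by
    intro h f hf
    funext q
    obtain ⟨U, hU, hq, X, hX⟩ := V.exists_adaptedFrame q
    have h1 := hkey U hU X hX f hf q hq
    rw [h U hU X hX q hq] at h1
    exact (sub_eq_zero.1 (h1.trans (map_zero (SubRiem.differential n f q)))).symm
  tfae_have 3 → 1 := by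
    intro h f₁ f₂ hf₁ hc₁ hf₂ hc₂
    rw [h f₁ hf₁, h f₂ hf₂]
    exact SubRiem.Structure.macroLaplacian_symmetric V vol f₁ f₂ hf₁ hc₁ hf₂ hc₂
  tfae_finish
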